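/- Let $d\ge 2$ and let $\mathbb T^d=\mathbb R^d/\mathbb Z^d$. Let $A:\mathbb T^d\to\mathbb R^{d\times d}$ (not necessarily symmetric), $b,c:\mathbb T^d\to\mathbb R^d$ and $a:\mathbb T^d\to\mathbb R$ be measurable, write $M_S=\frac{M+M^T}{2}$ for the symmetric part of a matrix $M$, and consider the formal operator $$Lv=-\operatorname{div}(A\,Dv-c\,v)+b^TDv-a\,v .$$ Assume the following. (1) There are $\frac12\le q<1$ and a measurable $\sigma:\mathbb T^d\to[0,\infty)$ such that $\int_{\mathbb T^d}\sigma^{\frac{q}{q-1}}\,dx<\infty$ (with $0^{\frac{q}{q-1}}=+\infty$, so that $\sigma>0$ a.e.) and, for a.e. $x\in\mathbb T^d$, $\xi^TA(x)\xi\ge\sigma(x)|\xi|^2$ for all $\xi\in\mathbb R^d$; in particular $A$ is invertible a.e. (2) There is $\tau>0$ such that, for a.e. $x\in\mathbb T^d$, $\xi^T\big((A^{-1})_S\big)^{-1}\xi\le\tau\,\xi^TA_S\,\xi$ for all $\xi\in\mathbb R^d$. (3) The function $\kappa=c^TA^{-1}c+b^TA^{-1}b+|a|$ is positive a.e., and there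 is $\beta\in[1,\infty]$ such that $\kappa\in L^\beta(\mathbb T^d)$ and $2\beta'\le(2q)^*$, where $\frac1\beta+\frac1{\beta'}=1$ and $\frac1{(2q)^*}=\frac1{2q}-\frac1d$. Let $X$ be the space of all integrable functions $u$ on $\mathbb T^d$ (modulo equality a.e.) whose distributional gradient $Du$ is an integrable function and which satisfy $$\|u\|_X^2=\int_{\mathbb T^d}\big(Du^TA\,Du+\kappa|u|^2\big)\,dx<\infty,$$ and let $X'$ be the space of all linear functionals on $X$ that are bounded for $\|\cdot\|_X$. For $\zeta\in X'$, a function $u\in X$ is called a weak solution of $Lu=\zeta$ if, for all $v\in X$, the following integral converges absolutely and $$\int_{\mathbb T^d}\big(Dv^TA\,Du-u\,c^TDv+v\,b^TDu-a\,u\,v\big)\,dx=\langle\zeta,v\rangle_{X',X}.$$ (4) Assume finally that the kernel of $L$ in $X$ is trivial: if $u\in X$ is a weak solution of $Lu=0$, then $u=0$. Then, for every $\zeta\in X'$, there is a unique weak solution $u\in X$ of $Lu=\zeta$. -/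

import Mathlib

open MeasureTheory
open scoped Matrix ENNReal

noncomputable section

/-- The flat torus `ℝ^d / ℤ^d`; its `volume` is the normalised Lebesgue measure. -/
abbrev Torus (d : ℕ) : Type := UnitAddTorus (Fin d)

namespace Torus

variable {d : ℕ}

/-- A function on the torus is smooth if its periodic lift to `ℝ^d` is `C^∞`. -/
def IsSmooth (φ : Torus d → ℝ) : Prop :=
  ContDiff ℝ (⊤ : ℕ∞) (fun y : Fin d → ℝ => φ (fun i => (y i : UnitAddCircle)))

/-- The `i`-th (classical) partial derivative of a function on the torus. -/
def partialDeriv (i : Fin d) (φ : Torus d → ℝ) (x : Torus d) : ℝ :=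
  deriv (fun t : ℝ => φ (x + Pi.single i (t : UnitAddCircle))) 0

/-- `g` is an integrable function that represents the gradient of `u` in the sense of
distributions on the torus. -/
def HasWeakGrad (u : Torus d → ℝ) (g : Torus d → Fin d → ℝ) : Prop :=
  (∀ i, Integrable (fun x => g x i)) ∧
    ∀ φ : Torus d → ℝ, IsSmooth φ → ∀ i,
      ∫ x, u x * partialDeriv i φ x = - ∫ x, g x i * φ x

open Classical in
/-- The weak gradient `Du` of an integrable function (unique up to null sets when it exists;
set to `0` when it does not). -/
def weakGrad (u : Torus d →₁[volume] ℝ) : Torus d → Fin d → ℝ :=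
  if h : ∃ g, HasWeakGrad u g then h.choose else 0

end Torus

/-- The symmetric part `(M + Mᵀ) / 2` of a square matrix. -/
def symPart {d : ℕ} (M : Matrix (Fin d) (Fin d) ℝ) : Matrix (Fin d) (Fin d) ℝ :=
  (2 : ℝ)⁻¹ • (M + Mᵀ)

/-- The Sobolev conjugate exponent `p*`, given by `1 / p* = 1 / p - 1 / d` (for `1 ≤ p < d`). -/
def sobolevConj (d : ℕ) (p : ℝ) : ℝ := (p⁻¹ - (d : ℝ)⁻¹)⁻¹

/-- Lebesgue measurable coefficients of the operator
`L v = - div (A Dv - c v) + bᵀ Dv - a v` on the torus. The matrix `A` need not be symmetric and may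
degenerate, but its quadratic form is nonnegative almost everywhere. -/
structure Coefficients (d : ℕ) where
  A : Torus d → Matrix (Fin d) (Fin d) ℝ
  b : Torus d → Fin d → ℝ
  c : Torus d → Fin d → ℝ
  a : Torus d → ℝ
  aemeasurable_A : ∀ i j, AEMeasurable (fun x => A x i j)
  aemeasurable_b : ∀ i, AEMeasurable (fun x => b x i)
  aemeasurable_c : ∀ i, AEMeasurable (fun x => c x i)
  aemeasurable_a : AEMeasurable a
  nonneg_A : ∀ᵐ x, ∀ ξ : Fin d → ℝ, 0 ≤ ξ ⬝ᵥ (A x *ᵥ ξ)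

namespace Coefficients

variable {d : ℕ} (P : Coefficients d)

/-- The weight `κ = cᵀ A⁻¹ c + bᵀ A⁻¹ b + |a|`. -/
def kappa (x : Torus d) : ℝ :=
  P.c x ⬝ᵥ ((P.A x)⁻¹ *ᵥ P.c x) + P.b x ⬝ᵥ ((P.A x)⁻¹ *ᵥ P.b x) + |P.a x|

theorem aestronglyMeasurable_quad {g : Torus d → Fin d → ℝ}
    (hg : ∀ i, AEMeasurable (fun x => g x i)) :
    AEStronglyMeasurable (fun x => g x ⬝ᵥ (P.A x *ᵥ g x)) := by
  refine AEMeasurable.aestronglyMeasurable ?_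
  simp only [dotProduct, Matrix.mulVec]
  refine Finset.aemeasurable_fun_sum _ fun i _ => (hg i).mul ?_
  exact Finset.aemeasurable_fun_sum _ fun j _ => (P.aemeasurable_A i j).mul (hg j)

theorem aemeasurable_kappa : AEMeasurable P.kappa := by
  have hdet : AEMeasurable (fun x => (P.A x).det) := by
    simp only [Matrix.det_apply]
    refine Finset.aemeasurable_fun_sum _ fun s _ => AEMeasurable.const_smul ?_ _
    exact Finset.aemeasurable_fun_prod _ fun i _ => P.aemeasurable_A _ _
  have hadj : ∀ i j, AEMeasurable (fun x => (P.A x).adjugate i j) := by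
    intro i j
    simp only [Matrix.adjugate_apply, Matrix.det_apply]
    refine Finset.aemeasurable_fun_sum _ fun s _ => AEMeasurable.const_smul ?_ _
    refine Finset.aemeasurable_fun_prod _ fun k _ => ?_
    by_cases h : s k = j
    · simp only [h, Matrix.updateRow_self]
      exact aemeasurable_const
    · simp only [Matrix.updateRow_ne h]
      exact P.aemeasurable_A _ _
  have hinv : ∀ i j, AEMeasurable (fun x => (P.A x)⁻¹ i j) := by
    intro i j
    simp only [Matrix.inv_def, Ring.inverse_eq_inv', Matrix.smul_apply, smul_eq_mul]
    exact hdet.inv.mul (hadj i j)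
  have hq : ∀ w : Torus d → Fin d → ℝ, (∀ i, AEMeasurable (fun x => w x i)) →
      AEMeasurable (fun x => w x ⬝ᵥ ((P.A x)⁻¹ *ᵥ w x)) := by
    intro w hw
    simp only [dotProduct, Matrix.mulVec]
    refine Finset.aemeasurable_fun_sum _ fun i _ => (hw i).mul ?_
    exact Finset.aemeasurable_fun_sum _ fun j _ => (hinv i j).mul (hw j)
  exact ((hq _ P.aemeasurable_c).add (hq _ P.aemeasurable_b)).add
    (continuous_abs.measurable.comp_aemeasurable P.aemeasurable_a)

/-- The weighted energy space `X`: all integrable functions `u` (modulo equality almost everywhere)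
whose distributional gradient is a function `Du` with `∫ Duᵀ A Du < ∞` and `∫ κ |u|² < ∞`. -/
def energySpace : Submodule ℝ (Torus d →₁[volume] ℝ) where
  carrier := {u | ∃ g, Torus.HasWeakGrad u g ∧
    Integrable (fun x => g x ⬝ᵥ (P.A x *ᵥ g x)) ∧ Integrable (fun x => P.kappa x * (u x) ^ 2)}
  zero_mem' := by
    have h0 := Lp.coeFn_zero ℝ 1 (volume : Measure (Torus d))
    refine ⟨0, ⟨fun i => by simp, fun φ _ i => ?_⟩, by simp, ?_⟩
    · rw [integral_eq_zero_of_ae]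
      · simp
      · filter_upwards [h0] with x hx
        rw [hx]
        simp
    · refine (integrable_zero (Torus d) ℝ volume).congr ?_
      filter_upwards [h0] with x hx
      rw [hx]
      simp
  add_mem' := by
    rintro u v ⟨g, ⟨hg, hgu⟩, hgA, hgk⟩ ⟨h, ⟨hh, hhv⟩, hhA, hhk⟩
    have hadd := Lp.coeFn_add u v
    refine ⟨fun x => g x + h x, ⟨fun i => (hg i).add (hh i), fun φ hφ i => ?_⟩, ?_, ?_⟩
    · have hper : Continuous φ ∧ Continuous (Torus.partialDeriv i φ) := by
        have hq : IsOpenQuotientMap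
            (fun (y : Fin d → ℝ) (i : Fin d) => (y i : UnitAddCircle)) :=
          IsOpenQuotientMap.piMap fun _ => QuotientAddGroup.isOpenQuotientMap_mk
        refine ⟨hq.isQuotientMap.continuous_iff.2 hφ.continuous,
          hq.isQuotientMap.continuous_iff.2 ?_⟩
        have hd := hφ.differentiable (by simp)
        have hc := (hφ.continuous_fderiv (by simp)).clm_apply
          (continuous_const (y := (Pi.single i (1 : ℝ) : Fin d → ℝ)))
        refine hc.congr fun y => ?_
        have h1 : HasDerivAt (fun t : ℝ => y + t • (Pi.single i (1 : ℝ) : Fin d → ℝ))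
            (Pi.single i (1 : ℝ)) 0 := by
          simpa using ((hasDerivAt_id (0 : ℝ)).smul_const
            (Pi.single i (1 : ℝ) : Fin d → ℝ)).const_add y
        have h2 := (hd (y + (0 : ℝ) • (Pi.single i (1 : ℝ) : Fin d → ℝ))).hasFDerivAt.comp_hasDerivAt
          (0 : ℝ) h1
        simp only [Function.comp_def, Torus.partialDeriv]
        rw [zero_smul, add_zero] at h2
        rw [← h2.deriv]
        congr 1
        funext t
        simp only [Function.comp_def]
        congr 1
        funext j
        by_cases hj : j = i
        · subst hj; simp
        · simp [hj]
      have hb : ∀ (f ψ : Torus d → ℝ), Integrable f → Continuous ψ →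
          Integrable (fun x => f x * ψ x) := by
        intro f ψ hf hψ
        obtain ⟨C, hC⟩ := isCompact_univ.exists_bound_of_continuousOn hψ.continuousOn
        exact hf.mul_bdd hψ.aestronglyMeasurable
          (Filter.Eventually.of_forall fun x => hC x trivial)
      have e1 : ∫ x, (u + v : Torus d →₁[volume] ℝ) x * Torus.partialDeriv i φ x
          = ∫ x, (u x * Torus.partialDeriv i φ x + v x * Torus.partialDeriv i φ x) := by
        refine integral_congr_ae ?_
        filter_upwards [hadd] with x hx
        rw [hx, Pi.add_apply, add_mul]
      have e2 : ∫ x, (g x + h x) i * φ x = ∫ x, (g x i * φ x + h x i * φ x) := by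
        simp only [Pi.add_apply, add_mul]
      rw [e1, e2, integral_add (hb _ _ (L1.integrable_coeFn u) hper.2)
        (hb _ _ (L1.integrable_coeFn v) hper.2),
        integral_add (hb _ _ (hg i) hper.1) (hb _ _ (hh i) hper.1), hgu φ hφ i, hhv φ hφ i]
      ring
    · refine ((hgA.add hhA).const_mul 2).mono' (P.aestronglyMeasurable_quad fun i =>
        ((hg i).add (hh i)).aemeasurable) ?_
      filter_upwards [P.nonneg_A] with x hx
      have h1 := hx (g x + h x)
      have h2 := hx (g x - h x)
      rw [Real.norm_of_nonneg h1]
      simp only [Matrix.mulVec_add, Matrix.mulVec_sub, dotProduct_add, add_dotProduct,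
        dotProduct_sub, sub_dotProduct, Pi.add_apply] at h2 ⊢
      linarith
    · refine ((hgk.norm.add hhk.norm).const_mul 2).mono'
        (P.aemeasurable_kappa.mul ((Lp.aestronglyMeasurable _).aemeasurable.pow_const 2)
          ).aestronglyMeasurable ?_
      filter_upwards [hadd] with x hx
      simp only [hx, Pi.add_apply, norm_mul, Real.norm_eq_abs, abs_pow, sq_abs]
      nlinarith [mul_nonneg (abs_nonneg (P.kappa x)) (sq_nonneg (u x - v x))]
  smul_mem' := by
    rintro r u ⟨g, ⟨hg, hgu⟩, hgA, hgk⟩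
    have hsm := Lp.coeFn_smul r u
    refine ⟨fun x => r • g x, ⟨fun i => (hg i).const_mul r, fun φ hφ i => ?_⟩, ?_, ?_⟩
    · have e1 : ∫ x, (r • u : Torus d →₁[volume] ℝ) x * Torus.partialDeriv i φ x
          = ∫ x, r * (u x * Torus.partialDeriv i φ x) := by
        refine integral_congr_ae ?_
        filter_upwards [hsm] with x hx
        rw [hx, Pi.smul_apply, smul_eq_mul, mul_assoc]
      have e2 : ∫ x, (r • g x) i * φ x = ∫ x, r * (g x i * φ x) := by
        simp only [Pi.smul_apply, smul_eq_mul, mul_assoc]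
      rw [e1, e2, integral_const_mul, integral_const_mul, hgu φ hφ i]
      ring
    · refine (hgA.const_mul (r ^ 2)).congr (Filter.Eventually.of_forall fun x => ?_)
      simp only [Matrix.mulVec_smul, dotProduct_smul, smul_dotProduct, smul_eq_mul]
      ring
    · refine (hgk.const_mul (r ^ 2)).congr ?_
      filter_upwards [hsm] with x hx
      simp only [hx, Pi.smul_apply, smul_eq_mul]
      ring

/-- The norm `‖u‖_X = (∫ (Duᵀ A Du + κ |u|²))^{1/2}`. -/
def energyNorm (u : P.energySpace) : ℝ :=
  Real.sqrt (∫ x, (Torus.weakGrad u.1 x ⬝ᵥ (P.A x *ᵥ Torus.weakGrad u.1 x)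
    + P.kappa x * (u.1 x) ^ 2))

/-- A linear functional on `X` belongs to the dual `X'` if it is bounded for `‖·‖_X`. -/
def IsBoundedFunctional (ζ : P.energySpace →ₗ[ℝ] ℝ) : Prop :=
  ∃ C : ℝ, ∀ v : P.energySpace, |ζ v| ≤ C * P.energyNorm v

/-- The integrand `Dvᵀ (A Du - c u) + v bᵀ Du - a u v` of the weak form of `L u` tested with `v`. -/
def weakIntegrand (u v : P.energySpace) (x : Torus d) : ℝ :=
  Torus.weakGrad v.1 x ⬝ᵥ (P.A x *ᵥ Torus.weakGrad u.1 x)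
    - u.1 x * (P.c x ⬝ᵥ Torus.weakGrad v.1 x)
    + v.1 x * (P.b x ⬝ᵥ Torus.weakGrad u.1 x)
    - P.a x * u.1 x * v.1 x

/-- `u ∈ X` is a weak solution of `L u = ζ`: for all `v ∈ X`, the weak form is a convergent integral
and it equals `⟨ζ, v⟩`. -/
def IsWeakSolution (ζ : P.energySpace →ₗ[ℝ] ℝ) (u : P.energySpace) : Prop :=
  ∀ v : P.energySpace, Integrable (P.weakIntegrand u v) ∧ ∫ x, P.weakIntegrand u v x = ζ v

end Coefficients

end

/-! The weak form `B` of `L` is bounded on the Hilbert space `X` and coercive up to a finite rank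
form. A finite rank perturbation of an invertible operator is surjective as soon as it is injective,
so the trivial kernel gives solvability.

Write `Q = ∫ Duᵀ A Du` and `K = ∫ κ u²`. Cauchy–Schwarz for the symmetric part of `A⁻¹`, together
with the comparability hypothesis, yields `(η·ξ)² ≤ τ (η·A⁻¹η)(ξ·Aξ)`
(`dotProduct_sq_le_quad_inv_mul`). Hence all terms of the weak form are bounded pointwise by the
energy density, and Young's inequality gives Gårding's inequality `B(u,u) ≥ Q/2 - (2τ+1) K`
(`le_weakForm_self`).

The term `K` is handled without a compact embedding theorem. On a small cube `T`, Hölder's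
inequality against `σ` and the Sobolev–Poincaré inequality with exponent `2q` bound `∫_T κ |u -
ū_T|²` by a constant times `(∫_T σ^{q/(q-1)})^{(1-q)/q} ∫_T Duᵀ A Du`. The constant does not depend
on the cube, and the first factor is small on small cubes because the integral of `σ^{q/(q-1)}` is
absolutely continuous. Smallness thus comes from the weight and not from a gap between exponents, so
the endpoint `2β' = (2q)*` is covered. Summing over a fine partition, `K` is dominated by a small
multiple of `Q` plus the finite rank form `∑_T ū_T ∫_T κ u` (`exists_partition`,
`exists_tiles_coercive`).

It remains to see that `X` is complete (`exists_limit`). The energy controls the `L¹` norms of `u`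
and `Du`; the mean value of `u` is controlled because `κ > 0` almost everywhere. Energy-Cauchy
sequences therefore converge in `L¹` with their gradients, and Fatou's lemma upgrades this to
convergence in energy. The Sobolev–Poincaré inequality is proved for `C¹` functions on cubes and
reaches weakly differentiable functions on the torus by mollification. -/

noncomputable section

/-! ### Quadratic forms of nonsymmetric matrices. -/

section QuadraticForms

variable {d : ℕ} {M : Matrix (Fin d) (Fin d) ℝ}

theorem dotProduct_symPart_mulVec (M : Matrix (Fin d) (Fin d) ℝ) (ξ : Fin d → ℝ) :
    ξ ⬝ᵥ (symPart M *ᵥ ξ) = ξ ⬝ᵥ (M *ᵥ ξ) := by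
  have h : ξ ⬝ᵥ (Mᵀ *ᵥ ξ) = ξ ⬝ᵥ (M *ᵥ ξ) := by
    rw [Matrix.mulVec_transpose, dotProduct_comm, ← Matrix.dotProduct_mulVec]
  rw [symPart, Matrix.smul_mulVec, Matrix.add_mulVec, dotProduct_smul, dotProduct_add, h,
    smul_eq_mul]
  ring

theorem isUnit_det_of_quad_pos (hM : ∀ ξ : Fin d → ℝ, ξ ≠ 0 → 0 < ξ ⬝ᵥ (M *ᵥ ξ)) :
    IsUnit M.det := by
  rw [isUnit_iff_ne_zero]
  intro h
  obtain ⟨v, hv, hv0⟩ := Matrix.exists_mulVec_eq_zero_iff.2 h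
  have := hM v hv
  simp [hv0] at this

theorem quad_inv_eq (hM : ∀ ξ : Fin d → ℝ, ξ ≠ 0 → 0 < ξ ⬝ᵥ (M *ᵥ ξ)) (η : Fin d → ℝ) :
    η ⬝ᵥ (M⁻¹ *ᵥ η) = (M⁻¹ *ᵥ η) ⬝ᵥ (M *ᵥ (M⁻¹ *ᵥ η)) := by
  rw [Matrix.mulVec_mulVec, Matrix.mul_nonsing_inv _ (isUnit_det_of_quad_pos hM),
    Matrix.one_mulVec, dotProduct_comm]

theorem quad_inv_pos (hM : ∀ ξ : Fin d → ℝ, ξ ≠ 0 → 0 < ξ ⬝ᵥ (M *ᵥ ξ)) (η : Fin d → ℝ)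
    (hη : η ≠ 0) : 0 < η ⬝ᵥ (M⁻¹ *ᵥ η) := by
  rw [quad_inv_eq hM]
  refine hM _ fun h => hη ?_
  have := congrArg (fun v => M *ᵥ v) h
  simpa [Matrix.mulVec_mulVec, Matrix.mul_nonsing_inv _ (isUnit_det_of_quad_pos hM)] using this

theorem quad_inv_nonneg (hM : ∀ ξ : Fin d → ℝ, ξ ≠ 0 → 0 < ξ ⬝ᵥ (M *ᵥ ξ)) (η : Fin d → ℝ) :
    0 ≤ η ⬝ᵥ (M⁻¹ *ᵥ η) := by
  by_cases hη : η = 0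
  · simp [hη]
  · exact (quad_inv_pos hM η hη).le

theorem symm_form_cauchy_schwarz {S : Matrix (Fin d) (Fin d) ℝ} (hS : Sᵀ = S)
    (hpos : ∀ ξ : Fin d → ℝ, 0 ≤ ξ ⬝ᵥ (S *ᵥ ξ)) (η ζ : Fin d → ℝ) :
    (η ⬝ᵥ (S *ᵥ ζ)) ^ 2 ≤ (η ⬝ᵥ (S *ᵥ η)) * (ζ ⬝ᵥ (S *ᵥ ζ)) := by
  have hsym : ζ ⬝ᵥ (S *ᵥ η) = η ⬝ᵥ (S *ᵥ ζ) := by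
    rw [Matrix.dotProduct_mulVec, ← Matrix.mulVec_transpose, hS, dotProduct_comm]
  have h : ∀ t : ℝ, 0 ≤ (ζ ⬝ᵥ (S *ᵥ ζ)) * (t * t) + (2 * (η ⬝ᵥ (S *ᵥ ζ))) * t
      + η ⬝ᵥ (S *ᵥ η) := by
    intro t
    have := hpos (η + t • ζ)
    simp only [Matrix.mulVec_add, Matrix.mulVec_smul, dotProduct_add, add_dotProduct,
      dotProduct_smul, smul_dotProduct, smul_eq_mul, hsym] at this
    linarith
  have := discrim_le_zero h
  rw [discrim] at this
  nlinarith

/-- Cauchy–Schwarz for `S = symPart M⁻¹`, applied to `η` and `S⁻¹ ξ`, gives `(η·ξ)² ≤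
(η·Sη)(ξ·S⁻¹ξ)`; the hypothesis on `τ` replaces `S⁻¹` by `τ M`. This is what controls `b` and `c` by
`κ`. -/
theorem dotProduct_sq_le_quad_inv_mul (hM : ∀ ξ : Fin d → ℝ, ξ ≠ 0 → 0 < ξ ⬝ᵥ (M *ᵥ ξ)) {τ : ℝ}
    (hτ : ∀ ξ : Fin d → ℝ,
      ξ ⬝ᵥ ((symPart M⁻¹)⁻¹ *ᵥ ξ) ≤ τ * (ξ ⬝ᵥ (symPart M *ᵥ ξ))) (η ξ : Fin d → ℝ) :
    (η ⬝ᵥ ξ) ^ 2 ≤ (η ⬝ᵥ (M⁻¹ *ᵥ η)) * (τ * (ξ ⬝ᵥ (M *ᵥ ξ))) := by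
  set S := symPart M⁻¹ with hS
  have hSpos : ∀ ξ : Fin d → ℝ, ξ ≠ 0 → 0 < ξ ⬝ᵥ (S *ᵥ ξ) := fun ξ hξ => by
    rw [hS, dotProduct_symPart_mulVec]
    exact quad_inv_pos hM ξ hξ
  have hSu := isUnit_det_of_quad_pos hSpos
  have hST : Sᵀ = S := by
    rw [hS, symPart, Matrix.transpose_smul, Matrix.transpose_add, Matrix.transpose_transpose,
      add_comm]
  have hSnn : ∀ ξ : Fin d → ℝ, 0 ≤ ξ ⬝ᵥ (S *ᵥ ξ) := fun ξ => by
    by_cases h : ξ = 0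
    · simp [h]
    · exact (hSpos ξ h).le
  have h1 := symm_form_cauchy_schwarz hST hSnn η (S⁻¹ *ᵥ ξ)
  have e : S *ᵥ (S⁻¹ *ᵥ ξ) = ξ := by
    rw [Matrix.mulVec_mulVec, Matrix.mul_nonsing_inv _ hSu, Matrix.one_mulVec]
  rw [e] at h1
  have e2 : η ⬝ᵥ (S *ᵥ η) = η ⬝ᵥ (M⁻¹ *ᵥ η) := by rw [hS, dotProduct_symPart_mulVec]
  rw [e2, dotProduct_comm (S⁻¹ *ᵥ ξ)] at h1
  refine h1.trans (mul_le_mul_of_nonneg_left ?_ (quad_inv_nonneg hM η))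
  have := hτ ξ
  rwa [dotProduct_symPart_mulVec] at this

/-- A Cauchy–Schwarz inequality for a nonsymmetric `M`, with loss `τ`: it is the preceding estimate
with `M ξ` in place of `η`, since the form of `M⁻¹` at `M ξ` is the form of `M` at `ξ`. -/
theorem form_sq_le_quad_mul_quad (hM : ∀ ξ : Fin d → ℝ, ξ ≠ 0 → 0 < ξ ⬝ᵥ (M *ᵥ ξ)) {τ : ℝ}
    (hτ : ∀ ξ : Fin d → ℝ,
      ξ ⬝ᵥ ((symPart M⁻¹)⁻¹ *ᵥ ξ) ≤ τ * (ξ ⬝ᵥ (symPart M *ᵥ ξ))) (η ξ : Fin d → ℝ) :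
    (η ⬝ᵥ (M *ᵥ ξ)) ^ 2 ≤ (ξ ⬝ᵥ (M *ᵥ ξ)) * (τ * (η ⬝ᵥ (M *ᵥ η))) := by
  have h := dotProduct_sq_le_quad_inv_mul hM hτ (M *ᵥ ξ) η
  rw [dotProduct_comm (M *ᵥ ξ) η, Matrix.mulVec_mulVec,
    Matrix.nonsing_inv_mul _ (isUnit_det_of_quad_pos hM), Matrix.one_mulVec,
    dotProduct_comm (M *ᵥ ξ) ξ] at h
  exact h

end QuadraticForms

/-! ### Lax–Milgram with a finite rank perturbation. -/

section FunctionalAnalysis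

variable {V : Type*} [NormedAddCommGroup V] [InnerProductSpace ℝ V] [CompleteSpace V]

/-- A finite rank perturbation of the identity that is injective is surjective. -/
theorem surjective_id_sub_of_injective_of_finite_range {E : Type*} [AddCommGroup E] [Module ℝ E]
    (R : E →ₗ[ℝ] E) [FiniteDimensional ℝ (LinearMap.range R)]
    (hinj : ∀ x, x - R x = 0 → x = 0) (y : E) : ∃ x, x - R x = y := by
  -- The map `1 - R` preserves the range of `R`, where injectivity implies surjectivity. A solution
  -- `z` there of `z - R z = R y` makes `y + z` a preimage of `y`.
  let T : LinearMap.range R →ₗ[ℝ] LinearMap.range R :=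
    LinearMap.id - (R.restrict (p := LinearMap.range R) (q := LinearMap.range R)
      fun x _ => ⟨x, rfl⟩)
  have hT : ∀ z, ((T z : LinearMap.range R) : E) = z - R z := fun z => rfl
  have hTi : Function.Injective T := by
    rw [injective_iff_map_eq_zero]
    intro z hz
    have := congrArg (Subtype.val) hz
    rw [hT] at this
    exact Subtype.ext (hinj z this)
  obtain ⟨z, hz⟩ := LinearMap.injective_iff_surjective.1 hTi ⟨R y, y, rfl⟩
  have hz' : (z : E) - R z = R y := by rw [← hT, hz]
  refine ⟨y + z, ?_⟩
  rw [map_add, ← hz']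
  abel

/-- A bounded bilinear form that is a finite rank perturbation of a coercive one and has trivial
kernel is solvable for every right-hand side. -/
theorem exists_unique_of_coercive_sub_finiteRank (B : V →L[ℝ] V →L[ℝ] ℝ) {ι : Type*} [Fintype ι]
    (l m : ι → V →L[ℝ] ℝ) {c : ℝ} (hc : 0 < c)
    (hcoer : ∀ u, c * ‖u‖ * ‖u‖ ≤ B u u + ∑ j, l j u * m j u)
    (hinj : ∀ u, (∀ v, B u v = 0) → u = 0) (ζ : V →L[ℝ] ℝ) :
    ∃! u, ∀ v, B u v = ζ v := by
  let F : V →L[ℝ] V →L[ℝ] ℝ := ∑ j, (l j).smulRight (m j)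
  have hF : ∀ u v, F u v = ∑ j, l j u * m j v := fun u v => by
    simp [F]
  have hco : IsCoercive (B + F) := ⟨c, hc, fun u => by
    rw [add_apply, add_apply, hF]; exact hcoer u⟩
  let S := hco.continuousLinearEquivOfBilin
  have hS : ∀ u v, inner ℝ (S u) v = B u v + F u v := fun u v =>
    hco.continuousLinearEquivOfBilin_apply u v
  let g : ι → V := fun j => S.symm ((InnerProductSpace.toDual ℝ V).symm (m j))
  let R : V →ₗ[ℝ] V := ∑ j, (l j : V →ₗ[ℝ] ℝ).smulRight (g j)
  have hR : ∀ u, R u = ∑ j, l j u • g j := fun u => by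
    simp [R, LinearMap.sum_apply]
  have hSR : ∀ u v, inner ℝ (S (R u)) v = F u v := fun u v => by
    simp only [hR, map_sum, map_smul, g, ContinuousLinearEquiv.apply_symm_apply, sum_inner,
      real_inner_smul_left, InnerProductSpace.toDual_symm_apply, hF]
  -- `S` is the Lax–Milgram isomorphism of the coercive form `B + F`, and `R = S⁻¹F` has finite
  -- rank, so `B` is represented by `S (1 - R)`.
  have key : ∀ u v, inner ℝ (S (u - R u)) v = B u v := fun u v => by
    rw [map_sub, inner_sub_left, hS, hSR]; ring
  have hrange : LinearMap.range R ≤ Submodule.span ℝ (Set.range g) := by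
    rintro _ ⟨u, rfl⟩
    rw [hR]
    exact Submodule.sum_mem _ fun j _ => Submodule.smul_mem _ _ (Submodule.subset_span ⟨j, rfl⟩)
  have : FiniteDimensional ℝ (Submodule.span ℝ (Set.range g)) :=
    FiniteDimensional.span_of_finite ℝ (Set.finite_range g)
  have : FiniteDimensional ℝ (LinearMap.range R) := Submodule.finiteDimensional_of_le hrange
  obtain ⟨u, hu⟩ := surjective_id_sub_of_injective_of_finite_range R
    (fun x hx => hinj x fun v => by rw [← key, hx, map_zero, inner_zero_left])
    (S.symm ((InnerProductSpace.toDual ℝ V).symm ζ))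
  refine ⟨u, fun v => ?_, fun w hw => ?_⟩
  · rw [← key, hu, ContinuousLinearEquiv.apply_symm_apply, InnerProductSpace.toDual_symm_apply]
  · refine sub_eq_zero.1 (hinj _ fun v => ?_)
    rw [map_sub, sub_apply, hw v, ← key u v, hu,
      ContinuousLinearEquiv.apply_symm_apply, InnerProductSpace.toDual_symm_apply, sub_self]

end FunctionalAnalysis

end

noncomputable section

/-! ### Jensen's inequality and the Sobolev inequality on cubes. -/

section LIntegral

/-- Jensen's inequality for powers with respect to a probability measure. -/
theorem lintegral_rpow_le_of_isProbabilityMeasure {α : Type*} [MeasurableSpace α] {ν : Measure α}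
    [IsProbabilityMeasure ν] {h : α → ℝ≥0∞} (hh : AEMeasurable h ν) {p : ℝ} (hp : 1 ≤ p) :
    (∫⁻ x, h x ∂ν) ^ p ≤ ∫⁻ x, h x ^ p ∂ν := by
  rcases hp.eq_or_lt with rfl | hp1
  · simp
  have hpq := Real.HolderConjugate.conjExponent hp1
  have := ENNReal.lintegral_mul_le_Lp_mul_Lq ν hpq hh (aemeasurable_const (b := (1 : ℝ≥0∞)))
  simp only [Pi.mul_apply, mul_one, ENNReal.one_rpow, lintegral_one, measure_univ] at this
  calc (∫⁻ x, h x ∂ν) ^ p ≤ ((∫⁻ x, h x ^ p ∂ν) ^ (1 / p)) ^ p :=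
        ENNReal.rpow_le_rpow this (by linarith)
    _ = _ := by rw [← ENNReal.rpow_mul, one_div_mul_cancel (by linarith), ENNReal.rpow_one]

end LIntegral

section OneDimensional

theorem enorm_sub_le_lintegral_deriv {φ φ' : ℝ → ℝ} {a b : ℝ}
    (hφ : ∀ x, HasDerivAt φ (φ' x) x) (hc : Continuous φ') {s t : ℝ} (hs : s ∈ Set.Ioc a b)
    (ht : t ∈ Set.Ioc a b) :
    ‖φ t - φ s‖ₑ ≤ ∫⁻ x in Set.Ioc a b, ‖φ' x‖ₑ := by
  have h1 : ∫ x in s..t, φ' x = φ t - φ s :=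
    intervalIntegral.integral_eq_sub_of_hasDerivAt (fun x _ => hφ x) (hc.intervalIntegrable _ _)
  have h2 : ‖φ t - φ s‖ₑ = ‖∫ x in Set.uIoc s t, φ' x‖ₑ := by
    rw [← h1, enorm_eq_iff_norm_eq]
    exact intervalIntegral.norm_intervalIntegral_eq _ _ _ _
  rw [h2]
  refine (enorm_integral_le_lintegral_enorm _).trans (lintegral_mono_set ?_)
  intro x hx
  rw [Set.mem_uIoc] at hx
  rcases hx with hx | hx
  · exact ⟨hs.1.trans hx.1, hx.2.trans ht.2⟩
  · exact ⟨ht.1.trans hx.1, hx.2.trans hs.2⟩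

/-- No boundary condition is available, so `|φ t| ≤ |φ s| + ∫ |φ'|` is averaged over `s`; this
produces the zeroth-order term with weight `l⁻¹`. -/
theorem enorm_le_lintegral_add_deriv {φ φ' : ℝ → ℝ} {a l : ℝ} (hl : 0 < l)
    (hφ : ∀ x, HasDerivAt φ (φ' x) x) (hc : Continuous φ') {t : ℝ}
    (ht : t ∈ Set.Ioc a (a + l)) :
    ‖φ t‖ₑ ≤ ∫⁻ x in Set.Ioc a (a + l), ((ENNReal.ofReal l)⁻¹ * ‖φ x‖ₑ + ‖φ' x‖ₑ) := by
  have hl0 : ENNReal.ofReal l ≠ 0 := by simpa using hl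
  have hφc : Continuous φ := continuous_iff_continuousAt.2 fun x => (hφ x).continuousAt
  have hD := fun s hs => enorm_sub_le_lintegral_deriv hφ hc (s := s) hs ht
  set D := ∫⁻ x in Set.Ioc a (a + l), ‖φ' x‖ₑ
  have h : ∀ s ∈ Set.Ioc a (a + l), ‖φ t‖ₑ ≤ ‖φ s‖ₑ + D := fun s hs => by
    calc ‖φ t‖ₑ = ‖φ s + (φ t - φ s)‖ₑ := by congr 1; ring
      _ ≤ ‖φ s‖ₑ + ‖φ t - φ s‖ₑ := enorm_add_le _ _
      _ ≤ _ := by gcongr; exact hD s hs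
  have h2 := setLIntegral_mono' (μ := volume) measurableSet_Ioc h
  rw [setLIntegral_const, lintegral_add_left (by fun_prop), setLIntegral_const, Real.volume_Ioc,
    add_sub_cancel_left] at h2
  rw [lintegral_add_left (by fun_prop), lintegral_const_mul _ (by fun_prop)]
  have h3 : ‖φ t‖ₑ = (ENNReal.ofReal l)⁻¹ * (‖φ t‖ₑ * ENNReal.ofReal l) := by
    rw [mul_comm, mul_assoc, ENNReal.mul_inv_cancel hl0 ENNReal.ofReal_ne_top, mul_one]
  rw [h3]
  refine (mul_le_mul_right h2 _).trans (le_of_eq ?_)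
  rw [mul_add]
  congr 1
  rw [mul_comm, mul_assoc, ENNReal.mul_inv_cancel hl0 ENNReal.ofReal_ne_top, mul_one]

end OneDimensional

section Cube

variable {d : ℕ}

/-- The half-open cube with corner `a` and side length `l`. -/
def cube (a : Fin d → ℝ) (l : ℝ) : Set (Fin d → ℝ) :=
  Set.univ.pi fun i => Set.Ioc (a i) (a i + l)

theorem measurableSet_cube (a : Fin d → ℝ) (l : ℝ) : MeasurableSet (cube a l) :=
  MeasurableSet.univ_pi fun _ => measurableSet_Ioc

theorem convex_cube (a : Fin d → ℝ) (l : ℝ) : Convex ℝ (cube a l) :=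
  convex_pi fun _ _ => convex_Ioc _ _

theorem volume_restrict_cube (a : Fin d → ℝ) (l : ℝ) :
    volume.restrict (cube a l)
      = Measure.pi fun i => (volume : Measure ℝ).restrict (Set.Ioc (a i) (a i + l)) := by
  rw [cube, volume_pi, Measure.restrict_pi_pi]

theorem volume_cube (a : Fin d → ℝ) (l : ℝ) :
    volume (cube a l) = ENNReal.ofReal l ^ d := by
  simp [cube, volume_pi, Measure.pi_pi]

theorem norm_sub_le_of_mem_cube {a : Fin d → ℝ} {l : ℝ} (hl : 0 ≤ l) {x y : Fin d → ℝ}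
    (hx : x ∈ cube a l) (hy : y ∈ cube a l) : ‖x - y‖ ≤ l := by
  rw [pi_norm_le_iff_of_nonneg hl]
  intro i
  have h1 := hx i trivial
  have h2 := hy i trivial
  rw [Pi.sub_apply, Real.norm_eq_abs, abs_le]
  constructor <;> linarith [h1.1, h1.2, h2.1, h2.2]

/-- The Gagliardo–Nirenberg–Sobolev inequality on a cube for the exponent `1`. -/
theorem lintegral_rpow_le_cube (hd : 2 ≤ d) {a : Fin d → ℝ} {l : ℝ} (hl : 0 < l)
    {h : (Fin d → ℝ) → ℝ} (hh : ContDiff ℝ 1 h) :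
    ∫⁻ x in cube a l, ‖h x‖ₑ ^ ((d : ℝ) / (d - 1)) ≤
      (∫⁻ x in cube a l, ((ENNReal.ofReal l)⁻¹ * ‖h x‖ₑ + ‖fderiv ℝ h x‖ₑ))
        ^ ((d : ℝ) / (d - 1)) := by
  have hd' : (2 : ℝ) ≤ d := by exact_mod_cast hd
  have hconj : Real.HolderConjugate (Fintype.card (Fin d)) ((d : ℝ) / (d - 1)) := by
    rw [Fintype.card_fin]
    exact Real.HolderConjugate.conjExponent (by linarith)
  have hDc : Continuous (fderiv ℝ h) := hh.continuous_fderiv (by simp)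
  have hhc := hh.continuous
  have hm : Measurable fun x : Fin d → ℝ =>
      ((ENNReal.ofReal l)⁻¹ * ‖h x‖ₑ + ‖fderiv ℝ h x‖ₑ) := by fun_prop
  -- Gagliardo's argument: `|h|^{d/(d-1)}` is a product of `d` factors `|h|^{1/(d-1)}`, and the
  -- `i`-th factor is bounded through an integral along the line in direction `i`. The grid-lines
  -- lemma integrates the product of such line integrals.
  have hgrid := lintegral_prod_lintegral_pow_le
    (fun i => (volume : Measure ℝ).restrict (Set.Ioc (a i) (a i + l))) hconj hm
  rw [← volume_restrict_cube, Fintype.card_fin] at hgrid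
  refine le_trans (setLIntegral_mono' (measurableSet_cube a l) fun x hx => ?_) hgrid
  have hexp : (d : ℝ) / (d - 1) = (1 / ((d : ℝ) - 1)) * (d : ℕ) := by ring
  rw [hexp, ENNReal.rpow_mul_natCast]
  calc (‖h x‖ₑ ^ (1 / ((d : ℝ) - 1))) ^ d = ∏ _i : Fin d, ‖h x‖ₑ ^ (1 / ((d : ℝ) - 1)) := by
        simp
    _ ≤ _ := ?_
  refine Finset.prod_le_prod' fun i _ => ?_
  refine ENNReal.rpow_le_rpow ?_ (by
    have : (0 : ℝ) < d - 1 := by linarith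
    positivity)
  have hup : ∀ t : ℝ, HasDerivAt (fun t => Function.update x i t) (Pi.single i (1 : ℝ)) t :=
    fun t => hasDerivAt_update x i t
  have hder : ∀ t : ℝ, HasDerivAt (fun t => h (Function.update x i t))
      (fderiv ℝ h (Function.update x i t) (Pi.single i (1 : ℝ))) t := fun t =>
    ((hh.differentiable (by simp)) _).hasFDerivAt.comp_hasDerivAt t (hup t)
  have hcont : Continuous fun t : ℝ =>
      fderiv ℝ h (Function.update x i t) (Pi.single i (1 : ℝ)) := by
    have : Continuous fun t : ℝ => Function.update x i t :=
      continuous_const.update i continuous_id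
    exact (hDc.comp this).clm_apply continuous_const
  have hmain := enorm_le_lintegral_add_deriv hl hder hcont (hx i trivial)
  rw [Function.update_eq_self] at hmain
  refine hmain.trans (lintegral_mono fun t => ?_)
  refine add_le_add le_rfl ?_
  refine (ContinuousLinearMap.le_opENorm _ _).trans ?_
  have : ‖(Pi.single i (1 : ℝ) : Fin d → ℝ)‖ₑ = 1 := by
    rw [← ofReal_norm, Pi.norm_single]; simp
  rw [this, mul_one]

/-- The inequality with exponent `1` is applied to `|w|^γ`. This function is `C¹` only for `γ > 1`,
so `γ = 1` is treated apart. -/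
theorem lintegral_rpow_le_cube_of_pow (hd : 2 ≤ d) {a : Fin d → ℝ} {l : ℝ} (hl : 0 < l)
    {w : (Fin d → ℝ) → ℝ} (hw : ContDiff ℝ 1 w) {γ : ℝ} (hγ : 1 ≤ γ) :
    ∫⁻ x in cube a l, ‖w x‖ₑ ^ (γ * ((d : ℝ) / (d - 1))) ≤
      (ENNReal.ofReal γ * ∫⁻ x in cube a l, ‖w x‖ₑ ^ (γ - 1) *
        ((ENNReal.ofReal l)⁻¹ * ‖w x‖ₑ + ‖fderiv ℝ w x‖ₑ)) ^ ((d : ℝ) / (d - 1)) := by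
  rcases hγ.eq_or_lt with rfl | hγ1
  · simpa using lintegral_rpow_le_cube hd hl hw
  have hγ0 : 0 < γ := by linarith
  have hw' : ContDiff ℝ 1 fun x => ‖w x‖ ^ γ := (contDiff_norm_rpow hγ1).comp hw
  have hen : ∀ x, ‖(‖w x‖ ^ γ)‖ₑ = ‖w x‖ₑ ^ γ := fun x => by
    rw [Real.enorm_rpow_of_nonneg (norm_nonneg _) hγ0.le, enorm_norm]
  have hfd : ∀ x, ‖fderiv ℝ (fun x => ‖w x‖ ^ γ) x‖ₑ
      ≤ ENNReal.ofReal γ * ‖w x‖ₑ ^ (γ - 1) * ‖fderiv ℝ w x‖ₑ := fun x => by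
    have h1 : HasFDerivAt (fun x => ‖w x‖ ^ γ) ((γ * |w x| ^ (γ - 2) * w x) • fderiv ℝ w x) x := by
      have := (hasDerivAt_abs_rpow (w x) hγ1).comp_hasFDerivAt x
        ((hw.differentiable (by simp)) x).hasFDerivAt
      simpa [Function.comp_def] using this
    rw [h1.fderiv, enorm_smul]
    gcongr
    have h2 : ‖γ * |w x| ^ (γ - 2) * w x‖ = γ * |w x| ^ (γ - 1) := by
      rw [norm_mul, norm_mul, Real.norm_eq_abs, Real.norm_eq_abs, Real.norm_eq_abs,
        abs_of_pos hγ0, abs_of_nonneg (Real.rpow_nonneg (abs_nonneg _) _), mul_assoc]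
      congr 1
      by_cases h0 : w x = 0
      · simp [h0, Real.zero_rpow (by linarith : γ - 1 ≠ 0)]
      · have : 0 < |w x| := abs_pos.2 h0
        nth_rewrite 2 [← Real.rpow_one |w x|]
        rw [← Real.rpow_add this]
        congr 1; ring
    rw [← ofReal_norm, h2, ENNReal.ofReal_mul hγ0.le, ← ofReal_norm, Real.norm_eq_abs,
      ENNReal.ofReal_rpow_of_nonneg (abs_nonneg _) (by linarith)]
  have hmain := lintegral_rpow_le_cube hd (a := a) hl hw'
  simp only [hen, ← ENNReal.rpow_mul] at hmain
  refine hmain.trans (ENNReal.rpow_le_rpow ?_ ?_)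
  · have hwc := hw.continuous
    have hDc : Continuous (fderiv ℝ w) := hw.continuous_fderiv (by simp)
    rw [← lintegral_const_mul _ (by fun_prop)]
    refine lintegral_mono fun x => ?_
    have e : ‖w x‖ₑ ^ γ = ‖w x‖ₑ ^ (γ - 1) * ‖w x‖ₑ := by
      nth_rewrite 3 [← ENNReal.rpow_one ‖w x‖ₑ]
      rw [← ENNReal.rpow_add_of_nonneg _ _ (by linarith) zero_le_one]
      congr 1; ring
    rw [mul_add, mul_add, ← mul_assoc (ENNReal.ofReal γ) _ (‖fderiv ℝ w x‖ₑ)]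
    refine add_le_add ?_ (hfd x)
    have h1γ : 1 ≤ ENNReal.ofReal γ := by simpa using hγ
    rw [e]
    calc _ = 1 * (‖w x‖ₑ ^ (γ - 1) * ((ENNReal.ofReal l)⁻¹ * ‖w x‖ₑ)) := by ring
      _ ≤ _ := by gcongr
  · have hd' : (2 : ℝ) ≤ d := by exact_mod_cast hd
    have : (0 : ℝ) < d - 1 := by linarith
    positivity

end Cube
end

noncomputable section

section Sobolev

variable {d : ℕ}

theorem lintegral_rpow_enorm_cube_lt_top {a : Fin d → ℝ} {l : ℝ} {w : (Fin d → ℝ) → ℝ}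
    (hw : Continuous w) {s : ℝ} (hs : 0 ≤ s) : ∫⁻ x in cube a l, ‖w x‖ₑ ^ s < ∞ := by
  have hK : IsCompact (Set.univ.pi fun i => Set.Icc (a i) (a i + l)) :=
    isCompact_univ_pi fun _ => isCompact_Icc
  obtain ⟨C, hC⟩ := hK.exists_bound_of_continuousOn hw.continuousOn
  have hsub : cube a l ⊆ Set.univ.pi fun i => Set.Icc (a i) (a i + l) :=
    Set.pi_mono fun _ _ => Set.Ioc_subset_Icc_self
  refine lt_of_le_of_lt (setLIntegral_mono' (g := fun _ => ENNReal.ofReal C ^ s)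
    (measurableSet_cube a l) fun x hx => ?_) ?_
  · refine ENNReal.rpow_le_rpow ?_ hs
    rw [← ofReal_norm]
    exact ENNReal.ofReal_le_ofReal (hC x (hsub hx))
  · rw [setLIntegral_const, volume_cube]
    exact ENNReal.mul_lt_top (ENNReal.rpow_lt_top_of_nonneg hs ENNReal.ofReal_ne_top)
      (ENNReal.pow_lt_top ENNReal.ofReal_lt_top)

/-- The Sobolev inequality on a cube; `γ = p (d - 1) / (d - p)` and `p* = p d / (d - p)`. -/
theorem sobolev_cube (hd : 2 ≤ d) {a : Fin d → ℝ} {l : ℝ} (hl : 0 < l)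
    {w : (Fin d → ℝ) → ℝ} (hw : ContDiff ℝ 1 w) {p : ℝ} (hp : 1 ≤ p) (hpd : p < d) :
    (∫⁻ x in cube a l, ‖w x‖ₑ ^ (sobolevConj d p)) ^ (1 / sobolevConj d p) ≤
      ENNReal.ofReal (p * (d - 1) / (d - p)) * (∫⁻ x in cube a l,
        ((ENNReal.ofReal l)⁻¹ * ‖w x‖ₑ + ‖fderiv ℝ w x‖ₑ) ^ p) ^ (1 / p) := by
  have hd' : (2 : ℝ) ≤ d := by exact_mod_cast hd
  have hd0 : (0 : ℝ) < d := by linarith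
  have hd1 : (0 : ℝ) < d - 1 := by linarith
  have hp0 : 0 < p := by linarith
  have hdp : 0 < (d : ℝ) - p := by linarith
  have hS : sobolevConj d p = p * d / (d - p) := by
    rw [sobolevConj]; field_simp
  have hS0 : 0 < sobolevConj d p := by rw [hS]; positivity
  set S := sobolevConj d p with hSdef
  set γ := p * (d - 1) / (d - p) with hγdef
  have hγ1 : 1 ≤ γ := by rw [hγdef, le_div_iff₀ hdp]; nlinarith
  have hγS : γ * ((d : ℝ) / (d - 1)) = S := by rw [hS, hγdef]; field_simp
  have h0 := lintegral_rpow_le_cube_of_pow hd (a := a) hl hw hγ1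
  rw [hγS] at h0
  have hwc := hw.continuous
  have hDc : Continuous (fderiv ℝ w) := hw.continuous_fderiv (by simp)
  set F : (Fin d → ℝ) → ℝ≥0∞ := fun x => (ENNReal.ofReal l)⁻¹ * ‖w x‖ₑ + ‖fderiv ℝ w x‖ₑ with hF
  have hFm : Measurable F := by fun_prop
  set J := ∫⁻ x in cube a l, ‖w x‖ₑ ^ S with hJ
  -- Finiteness of `J` permits cancelling the power of `J` that Hölder's inequality leaves on the
  -- right-hand side.
  have hJtop : J ≠ ∞ := (lintegral_rpow_enorm_cube_lt_top hwc hS0.le).ne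
  have h1 : J ^ (((d : ℝ) - 1) / d) ≤ ENNReal.ofReal γ *
      ∫⁻ x in cube a l, ‖w x‖ₑ ^ (γ - 1) * F x := by
    have := ENNReal.rpow_le_rpow h0 (by positivity : 0 ≤ ((d : ℝ) - 1) / d)
    rwa [← ENNReal.rpow_mul, show ((d : ℝ) / (d - 1)) * (((d : ℝ) - 1) / d) = 1 by field_simp,
      ENNReal.rpow_one] at this
  rcases hp.eq_or_lt with h | hp1
  · have hγe : γ = 1 := by rw [hγdef, ← h]; field_simp
    have hSe : 1 / S = ((d : ℝ) - 1) / d := by rw [hS, ← h]; field_simp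
    rw [hSe]
    refine h1.trans (le_of_eq ?_)
    simp [hγe, ← h]
    rfl
  have hconj := Real.HolderConjugate.conjExponent hp1
  -- The exponent `γ` is the one for which `(γ - 1) p' = p*`, so the same integral `J` reappears.
  have h2 : ∫⁻ x in cube a l, ‖w x‖ₑ ^ (γ - 1) * F x ≤
      J ^ (1 / p.conjExponent) * (∫⁻ x in cube a l, F x ^ p) ^ (1 / p) := by
    have := ENNReal.lintegral_mul_le_Lp_mul_Lq (volume.restrict (cube a l)) hconj.symm
      (f := fun x => ‖w x‖ₑ ^ (γ - 1)) (g := F) (by fun_prop) hFm.aemeasurable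
    refine this.trans (le_of_eq ?_)
    congr 2
    refine lintegral_congr fun x => ?_
    rw [← ENNReal.rpow_mul]
    congr 1
    have hp1' : p - 1 ≠ 0 := by linarith
    rw [hS, hγdef, Real.conjExponent]
    field_simp
    ring
  have h3 : J ^ (1 / S) * J ^ (1 / p.conjExponent) ≤
      (ENNReal.ofReal γ * (∫⁻ x in cube a l, F x ^ p) ^ (1 / p)) * J ^ (1 / p.conjExponent) := by
    have e : 1 / S + 1 / p.conjExponent = ((d : ℝ) - 1) / d := by
      have hp1' : p - 1 ≠ 0 := by linarith
      rw [hS, Real.conjExponent]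
      field_simp
      ring
    have hpc := hconj.symm.pos
    rw [← ENNReal.rpow_add_of_nonneg _ _ (by positivity) (by positivity), e]
    refine h1.trans ?_
    calc _ ≤ ENNReal.ofReal γ * (J ^ (1 / p.conjExponent) *
          (∫⁻ x in cube a l, F x ^ p) ^ (1 / p)) := by gcongr
      _ = _ := by ring
  by_cases hJ0 : J = 0
  · rw [hJ0, ENNReal.zero_rpow_of_pos (by positivity)]
    exact zero_le
  · have hpc := hconj.symm.pos
    refine (ENNReal.mul_le_mul_iff_left ?_ ?_).1 h3
    · exact (ENNReal.rpow_pos (pos_iff_ne_zero.2 hJ0) hJtop).ne'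
    · exact ENNReal.rpow_ne_top_of_nonneg (by positivity) hJtop

end Sobolev

/-! ### The Poincaré and Sobolev–Poincaré inequalities on cubes. -/

section Poincare

variable {d : ℕ}

/-- The dilation `y ↦ (1 - s) z + s y` maps the convex set `Q` into itself and has Jacobian `s^d ≥
2^{-d}`. -/
theorem setLIntegral_comp_segment_le {Q : Set (Fin d → ℝ)} (hQ : Convex ℝ Q)
    (hQm : MeasurableSet Q) {H : (Fin d → ℝ) → ℝ≥0∞} (hH : Measurable H) {z : Fin d → ℝ}
    (hz : z ∈ Q) {s : ℝ} (hs : 1 / 2 ≤ s) (hs1 : s ≤ 1) :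
    ∫⁻ y in Q, H ((1 - s) • z + s • y) ≤ 2 ^ d * ∫⁻ y in Q, H y := by
  have hs0 : 0 < s := by linarith
  have hHQ : Measurable (Q.indicator H) := hH.indicator hQm
  calc ∫⁻ y in Q, H ((1 - s) • z + s • y)
      ≤ ∫⁻ y in Q, Q.indicator H ((1 - s) • z + s • y) := by
        refine setLIntegral_mono' hQm fun y hy => ?_
        rw [Set.indicator_of_mem (hQ hz hy (by linarith) hs0.le (by ring))]
    _ ≤ ∫⁻ y, Q.indicator H ((1 - s) • z + s • y) := setLIntegral_le_lintegral _ _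
    _ = ∫⁻ y, Q.indicator H ((1 - s) • z + y) ∂(Measure.map (s • ·) volume) := by
        rw [lintegral_map (by fun_prop) (by fun_prop)]
    _ = ENNReal.ofReal |(s ^ d)⁻¹| * ∫⁻ y, Q.indicator H ((1 - s) • z + y) := by
        rw [Measure.map_addHaar_smul _ hs0.ne', lintegral_smul_measure, Module.finrank_fin_fun,
          smul_eq_mul]
    _ = ENNReal.ofReal |(s ^ d)⁻¹| * ∫⁻ y, Q.indicator H y := by
        rw [lintegral_add_left_eq_self]
    _ ≤ 2 ^ d * ∫⁻ y in Q, H y := by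
        rw [lintegral_indicator hQm]
        gcongr
        rw [abs_of_pos (by positivity)]
        have : (s ^ d)⁻¹ ≤ 2 ^ d := by
          rw [← inv_pow]
          refine pow_le_pow_left₀ (by positivity) ?_ d
          rw [inv_le_comm₀ hs0 (by norm_num)]
          linarith
        refine (ENNReal.ofReal_le_ofReal this).trans (le_of_eq ?_)
        rw [ENNReal.ofReal_pow (by norm_num)]
        simp

/-- The Jacobian degenerates at one end of the segment. Hence `y` is the variable of substitution
for `t ≥ 1/2` and `x` for `t ≤ 1/2`, which keeps the constant `2^d`. -/
theorem lintegral_segment_le {Q : Set (Fin d → ℝ)} (hQc : Convex ℝ Q)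
    (hQm : MeasurableSet Q) {H : (Fin d → ℝ) → ℝ≥0∞} (hH : Measurable H) :
    ∫⁻ x in Q, ∫⁻ y in Q, ∫⁻ t in Set.Ioc (0 : ℝ) 1, H ((1 - t) • x + t • y) ≤
      volume Q * (2 ^ d * ∫⁻ y in Q, H y) := by
  have hswap : ∫⁻ x in Q, ∫⁻ y in Q, ∫⁻ t in Set.Ioc (0 : ℝ) 1, H ((1 - t) • x + t • y) =
      ∫⁻ t in Set.Ioc (0 : ℝ) 1, ∫⁻ x in Q, ∫⁻ y in Q, H ((1 - t) • x + t • y) := by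
    have h1 : ∀ x, ∫⁻ y in Q, ∫⁻ t in Set.Ioc (0 : ℝ) 1, H ((1 - t) • x + t • y) =
        ∫⁻ t in Set.Ioc (0 : ℝ) 1, ∫⁻ y in Q, H ((1 - t) • x + t • y) := fun x =>
      lintegral_lintegral_swap (by fun_prop)
    simp_rw [h1]
    refine lintegral_lintegral_swap ?_
    refine Measurable.aemeasurable ?_
    refine Measurable.lintegral_prod_right (f := fun (q : (Fin d → ℝ) × ℝ) (y : Fin d → ℝ) =>
      H ((1 - q.2) • q.1 + q.2 • y)) ?_
    fun_prop
  rw [hswap]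
  have hbound : ∀ t ∈ Set.Ioc (0 : ℝ) 1, ∫⁻ x in Q, ∫⁻ y in Q, H ((1 - t) • x + t • y) ≤
      volume Q * (2 ^ d * ∫⁻ y in Q, H y) := by
    intro t ht
    rcases le_total (1 / 2) t with h | h
    · calc _ ≤ ∫⁻ _x in Q, (2 ^ d * ∫⁻ y in Q, H y) :=
            setLIntegral_mono' hQm fun x hx =>
              setLIntegral_comp_segment_le hQc hQm hH hx h ht.2
        _ = _ := by rw [setLIntegral_const, mul_comm]
    · rw [lintegral_lintegral_swap (by fun_prop)]
      calc _ ≤ ∫⁻ _y in Q, (2 ^ d * ∫⁻ y in Q, H y) := by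
            refine setLIntegral_mono' hQm fun y hy => ?_
            have := setLIntegral_comp_segment_le hQc hQm hH hy (s := 1 - t) (by linarith)
              (by linarith [ht.1])
            refine (le_of_eq ?_).trans this
            refine lintegral_congr fun x => ?_
            rw [sub_sub_cancel, add_comm]
        _ = _ := by rw [setLIntegral_const, mul_comm]
  calc _ ≤ ∫⁻ _t in Set.Ioc (0 : ℝ) 1, volume Q * (2 ^ d * ∫⁻ y in Q, H y) :=
        setLIntegral_mono' measurableSet_Ioc hbound
    _ = _ := by rw [setLIntegral_const]; simp

theorem enorm_sub_le_lintegral_segment {f : (Fin d → ℝ) → ℝ} (hf : ContDiff ℝ 1 f)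
    (x y : Fin d → ℝ) :
    ‖f y - f x‖ₑ ≤ ∫⁻ t in Set.Ioc (0 : ℝ) 1, ‖fderiv ℝ f ((1 - t) • x + t • y)‖ₑ * ‖y - x‖ₑ := by
  have hline : ∀ t : ℝ, HasDerivAt (fun t : ℝ => (1 - t) • x + t • y) (y - x) t := fun t => by
    have h1 := ((hasDerivAt_id t).const_sub 1).smul_const x
    have h2 := (hasDerivAt_id t).smul_const y
    have := h1.add h2
    simp only [neg_smul, one_smul] at this
    rw [neg_add_eq_sub] at this
    exact this
  have hder : ∀ t : ℝ, HasDerivAt (fun t : ℝ => f ((1 - t) • x + t • y))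
      (fderiv ℝ f ((1 - t) • x + t • y) (y - x)) t := fun t =>
    ((hf.differentiable (by simp)) _).hasFDerivAt.comp_hasDerivAt t (hline t)
  have hDc : Continuous (fderiv ℝ f) := hf.continuous_fderiv (by simp)
  have hc : Continuous fun t : ℝ => fderiv ℝ f ((1 - t) • x + t • y) (y - x) := by fun_prop
  have h1 : ∫ t in (0 : ℝ)..1, fderiv ℝ f ((1 - t) • x + t • y) (y - x) = f y - f x := by
    rw [intervalIntegral.integral_eq_sub_of_hasDerivAt (fun t _ => hder t)
      (hc.intervalIntegrable _ _)]
    simp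
  rw [← h1, intervalIntegral.integral_of_le zero_le_one]
  refine (enorm_integral_le_lintegral_enorm _).trans (lintegral_mono fun t => ?_)
  exact ContinuousLinearMap.le_opENorm _ _

theorem rpow_enorm_sub_average_le {Q : Set (Fin d → ℝ)} {f : (Fin d → ℝ) → ℝ}
    (hf : Measurable f) (hvol0 : volume Q ≠ 0) (hvolt : volume Q ≠ ∞) (hint : IntegrableOn f Q)
    {p : ℝ} (hp : 1 ≤ p) (x : Fin d → ℝ) :
    ‖f x - ⨍ y in Q, f y‖ₑ ^ p ≤ (volume Q)⁻¹ * ∫⁻ y in Q, ‖f x - f y‖ₑ ^ p := by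
  have hprob : IsProbabilityMeasure ((volume Q)⁻¹ • volume.restrict Q) := ⟨by
    simp [ENNReal.inv_mul_cancel hvol0 hvolt]⟩
  have e : f x - ⨍ y in Q, f y = ∫ y, (f x - f y) ∂((volume Q)⁻¹ • volume.restrict Q) := by
    rw [integral_sub (integrable_const _)
      (hint.integrable.smul_measure (ENNReal.inv_ne_top.2 hvol0)), integral_const,
      probReal_univ, one_smul, average, Measure.restrict_apply_univ]
  rw [e]
  refine (ENNReal.rpow_le_rpow (enorm_integral_le_lintegral_enorm _) (by linarith)).trans ?_
  refine (lintegral_rpow_le_of_isProbabilityMeasure (by fun_prop) hp).trans (le_of_eq ?_)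
  rw [lintegral_smul_measure, smul_eq_mul]

/-- The `L^p` Poincaré inequality on a cube. -/
theorem poincare_cube {a : Fin d → ℝ} {l : ℝ} (hl : 0 < l)
    {f : (Fin d → ℝ) → ℝ} (hf : ContDiff ℝ 1 f) {p : ℝ} (hp : 1 ≤ p) :
    ∫⁻ x in cube a l, ‖f x - ⨍ y in cube a l, f y‖ₑ ^ p ≤
      2 ^ d * ENNReal.ofReal l ^ p * ∫⁻ x in cube a l, ‖fderiv ℝ f x‖ₑ ^ p := by
  have hp0 : 0 < p := by linarith
  have hfc := hf.continuous
  have hDc : Continuous (fderiv ℝ f) := hf.continuous_fderiv (by simp)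
  set Q := cube a l with hQ
  have hQm : MeasurableSet Q := measurableSet_cube a l
  have hQc : Convex ℝ Q := convex_cube a l
  have hvol : volume Q = ENNReal.ofReal l ^ d := volume_cube a l
  have hvol0 : volume Q ≠ 0 := by
    rw [hvol]; exact pow_ne_zero _ (by simpa using hl)
  have hvolt : volume Q ≠ ∞ := by
    rw [hvol]; exact ENNReal.pow_ne_top ENNReal.ofReal_ne_top
  set H : (Fin d → ℝ) → ℝ≥0∞ := fun x => ‖fderiv ℝ f x‖ₑ ^ p with hHdef
  have hH : Measurable H := by fun_prop
  have : IsProbabilityMeasure (volume.restrict (Set.Ioc (0 : ℝ) 1)) := ⟨by simp⟩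
  have step1 : ∀ x ∈ Q, ∀ y ∈ Q, ‖f x - f y‖ₑ ^ p ≤
      ENNReal.ofReal l ^ p * ∫⁻ t in Set.Ioc (0 : ℝ) 1, H ((1 - t) • x + t • y) := by
    intro x hx y hy
    have h1 := enorm_sub_le_lintegral_segment hf x y
    have h2 : ‖f x - f y‖ₑ ≤ ENNReal.ofReal l *
        ∫⁻ t in Set.Ioc (0 : ℝ) 1, ‖fderiv ℝ f ((1 - t) • x + t • y)‖ₑ := by
      rw [← enorm_neg, neg_sub, ← lintegral_const_mul _ (by fun_prop)]
      refine h1.trans (lintegral_mono fun t => ?_)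
      rw [mul_comm]
      gcongr
      rw [← ofReal_norm]
      exact ENNReal.ofReal_le_ofReal (norm_sub_le_of_mem_cube hl.le hy hx)
    refine (ENNReal.rpow_le_rpow h2 hp0.le).trans ?_
    rw [ENNReal.mul_rpow_of_nonneg _ _ hp0.le]
    gcongr
    exact lintegral_rpow_le_of_isProbabilityMeasure (by fun_prop) hp
  have hint : IntegrableOn f Q := by
    have hK : IsCompact (Set.univ.pi fun i => Set.Icc (a i) (a i + l)) :=
      isCompact_univ_pi fun _ => isCompact_Icc
    exact (hfc.continuousOn.integrableOn_compact hK).mono_set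
      (Set.pi_mono fun _ _ => Set.Ioc_subset_Icc_self)
  have step2 := fun x => rpow_enorm_sub_average_le hfc.measurable hvol0 hvolt hint hp x
  have step3 := lintegral_segment_le hQc hQm hH
  calc ∫⁻ x in Q, ‖f x - ⨍ y in Q, f y‖ₑ ^ p
      ≤ ∫⁻ x in Q, (volume Q)⁻¹ * ∫⁻ y in Q, (ENNReal.ofReal l ^ p *
          ∫⁻ t in Set.Ioc (0 : ℝ) 1, H ((1 - t) • x + t • y)) := by
        refine setLIntegral_mono' hQm fun x hx => (step2 x).trans ?_
        gcongr 1
        exact setLIntegral_mono' hQm fun y hy => step1 x hx y hy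
    _ = (volume Q)⁻¹ * (ENNReal.ofReal l ^ p * ∫⁻ x in Q, ∫⁻ y in Q,
          ∫⁻ t in Set.Ioc (0 : ℝ) 1, H ((1 - t) • x + t • y)) := by
        have hlp : ENNReal.ofReal l ^ p ≠ ∞ :=
          ENNReal.rpow_ne_top_of_nonneg hp0.le ENNReal.ofReal_ne_top
        rw [lintegral_const_mul' _ _ (ENNReal.inv_ne_top.2 hvol0)]
        simp_rw [lintegral_const_mul' _ _ hlp]
    _ ≤ (volume Q)⁻¹ * (ENNReal.ofReal l ^ p * (volume Q * (2 ^ d * ∫⁻ y in Q, H y))) := by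
        gcongr
    _ = ((volume Q)⁻¹ * volume Q) * (2 ^ d * ENNReal.ofReal l ^ p * ∫⁻ x in Q, H x) := by ring
    _ = _ := by rw [ENNReal.inv_mul_cancel hvol0 hvolt, one_mul]

/-- The constant in the Sobolev–Poincaré inequality on cubes. -/
def sobolevPoincareConst (d : ℕ) (p : ℝ) : ℝ≥0∞ :=
  ENNReal.ofReal (p * (d - 1) / (d - p)) * ((2 ^ d) ^ (1 / p) + 1)

theorem sobolevPoincareConst_ne_top (d : ℕ) {p : ℝ} (hp : 0 ≤ p) :
    sobolevPoincareConst d p ≠ ∞ := by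
  refine ENNReal.mul_ne_top ENNReal.ofReal_ne_top (ENNReal.add_ne_top.2 ⟨?_, by simp⟩)
  exact ENNReal.rpow_ne_top_of_nonneg (by positivity) (by simp)

/-- The Sobolev–Poincaré inequality on a cube, with a constant independent of the cube. -/
theorem sobolev_poincare_cube (hd : 2 ≤ d) {a : Fin d → ℝ} {l : ℝ} (hl : 0 < l)
    {f : (Fin d → ℝ) → ℝ} (hf : ContDiff ℝ 1 f) {p : ℝ} (hp : 1 ≤ p) (hpd : p < d) :
    (∫⁻ x in cube a l, ‖f x - ⨍ y in cube a l, f y‖ₑ ^ (sobolevConj d p))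
        ^ (1 / sobolevConj d p) ≤
      sobolevPoincareConst d p * (∫⁻ x in cube a l, ‖fderiv ℝ f x‖ₑ ^ p) ^ (1 / p) := by
  have hp0 : 0 < p := by linarith
  have hl0 : ENNReal.ofReal l ≠ 0 := by simpa using hl
  set m := ⨍ y in cube a l, f y with hm
  have hw : ContDiff ℝ 1 fun x => f x - m := hf.sub contDiff_const
  have hfc := hf.continuous
  have hDc : Continuous (fderiv ℝ f) := hf.continuous_fderiv (by simp)
  refine (sobolev_cube hd hl hw hp hpd).trans ?_
  rw [sobolevPoincareConst, mul_assoc]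
  gcongr
  simp only [fderiv_sub_const]
  refine (ENNReal.lintegral_Lp_add_le (μ := volume.restrict (cube a l))
    (f := fun x => (ENNReal.ofReal l)⁻¹ * ‖f x - m‖ₑ) (g := fun x => ‖fderiv ℝ f x‖ₑ)
    (by fun_prop) (by fun_prop) hp).trans ?_
  rw [add_mul, one_mul]
  gcongr
  simp only [ENNReal.mul_rpow_of_nonneg _ _ hp0.le]
  rw [lintegral_const_mul _ (by fun_prop), ← ENNReal.mul_rpow_of_nonneg _ _ (by positivity)]
  refine ENNReal.rpow_le_rpow ?_ (by positivity)
  -- The factor `l^p` from Poincaré cancels the weight `l^{-p}` of the zeroth-order term; this makes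
  -- the constant independent of the cube.
  calc _ ≤ (ENNReal.ofReal l)⁻¹ ^ p * (2 ^ d * ENNReal.ofReal l ^ p *
        ∫⁻ x in cube a l, ‖fderiv ℝ f x‖ₑ ^ p) := by
        gcongr
        exact poincare_cube hl hf hp
    _ = ((ENNReal.ofReal l)⁻¹ * ENNReal.ofReal l) ^ p * (2 ^ d *
        ∫⁻ x in cube a l, ‖fderiv ℝ f x‖ₑ ^ p) := by
        rw [ENNReal.mul_rpow_of_nonneg _ _ hp0.le]; ring
    _ = _ := by
        rw [ENNReal.inv_mul_cancel hl0 ENNReal.ofReal_ne_top, ENNReal.one_rpow, one_mul]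

end Poincare
end

noncomputable section

/-! ### Smooth functions, convolution and a mollifier on the torus. -/

namespace Torus

variable {d : ℕ}

instance isProbabilityMeasure_volume : IsProbabilityMeasure (volume : Measure (Torus d)) :=
  ⟨by simp [volume_pi, Measure.pi_univ]⟩

instance isAddHaarMeasure_volume : (volume : Measure (Torus d)).IsAddHaarMeasure :=
  inferInstanceAs (Measure.pi fun _ : Fin d => (volume : Measure UnitAddCircle)).IsAddHaarMeasure

/-- The covering map `ℝ^d → 𝕋^d`. -/
def proj (y : Fin d → ℝ) : Torus d := fun i => (y i : UnitAddCircle)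

theorem proj_surjective : Function.Surjective (proj : (Fin d → ℝ) → Torus d) := fun x => by
  choose y hy using fun i => QuotientAddGroup.mk_surjective (x i)
  exact ⟨y, funext hy⟩

theorem isOpenQuotientMap_proj : IsOpenQuotientMap (proj : (Fin d → ℝ) → Torus d) :=
  IsOpenQuotientMap.piMap fun _ => QuotientAddGroup.isOpenQuotientMap_mk

theorem continuous_proj : Continuous (proj : (Fin d → ℝ) → Torus d) :=
  isOpenQuotientMap_proj.continuous

theorem IsSmooth.contDiff {φ : Torus d → ℝ} (hφ : IsSmooth φ) :
    ContDiff ℝ (⊤ : ℕ∞) (fun y => φ (proj y)) := hφ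

theorem IsSmooth.continuous {φ : Torus d → ℝ} (hφ : IsSmooth φ) : Continuous φ :=
  isOpenQuotientMap_proj.isQuotientMap.continuous_iff.2 hφ.contDiff.continuous

theorem IsSmooth.fderiv_apply_single {φ : Torus d → ℝ} (hφ : IsSmooth φ) (i : Fin d)
    (y : Fin d → ℝ) :
    fderiv ℝ (fun y => φ (proj y)) y (Pi.single i 1) = partialDeriv i φ (proj y) := by
  have hd := hφ.contDiff.differentiable (by simp)
  have h1 : HasDerivAt (fun t : ℝ => y + t • (Pi.single i (1 : ℝ) : Fin d → ℝ))
      (Pi.single i (1 : ℝ)) 0 := by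
    simpa using ((hasDerivAt_id (0 : ℝ)).smul_const
      (Pi.single i (1 : ℝ) : Fin d → ℝ)).const_add y
  have h2 := (hd (y + (0 : ℝ) • (Pi.single i (1 : ℝ) : Fin d → ℝ))).hasFDerivAt.comp_hasDerivAt
    (0 : ℝ) h1
  rw [zero_smul, add_zero] at h2
  rw [← h2.deriv, partialDeriv]
  congr 1
  funext t
  simp only [Function.comp_def]
  congr 1
  funext j
  by_cases hj : j = i
  · subst hj; simp [proj]
  · simp [hj, proj]

theorem IsSmooth.continuous_partialDeriv {φ : Torus d → ℝ} (hφ : IsSmooth φ) (i : Fin d) :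
    Continuous (partialDeriv i φ) := by
  refine isOpenQuotientMap_proj.isQuotientMap.continuous_iff.2 ?_
  have hc := (hφ.contDiff.continuous_fderiv (by simp)).clm_apply
    (continuous_const (y := (Pi.single i (1 : ℝ) : Fin d → ℝ)))
  exact hc.congr fun y => hφ.fderiv_apply_single i y

/-- The linear functional on `ℝ^d` with the given coefficients. -/
def coeffFunctional (v : Fin d → ℝ) : (Fin d → ℝ) →L[ℝ] ℝ :=
  ∑ i, v i • ContinuousLinearMap.proj (R := ℝ) (φ := fun _ : Fin d => ℝ) i

/-- `Fin d → ℝ` carries the sup norm, so functionals are measured in the `ℓ¹` norm of their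
coefficients. Gradients are therefore measured by `∑ i, ‖g x i‖` throughout. -/
theorem norm_coeffFunctional_le (v : Fin d → ℝ) : ‖coeffFunctional v‖ ≤ ∑ i, ‖v i‖ := by
  refine ContinuousLinearMap.opNorm_le_bound _ (Finset.sum_nonneg fun i _ => norm_nonneg _)
    fun x => ?_
  simp only [coeffFunctional, _root_.sum_apply, _root_.smul_apply,
    ContinuousLinearMap.proj_apply, Finset.sum_mul]
  refine (norm_sum_le _ _).trans (Finset.sum_le_sum fun i _ => ?_)
  rw [norm_smul]
  exact mul_le_mul_of_nonneg_left (norm_le_pi_norm x i) (norm_nonneg _)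

theorem enorm_coeffFunctional_le (v : Fin d → ℝ) : ‖coeffFunctional v‖ₑ ≤ ‖∑ i, ‖v i‖‖ₑ := by
  rw [← ofReal_norm, ← ofReal_norm]
  exact ENNReal.ofReal_le_ofReal ((norm_coeffFunctional_le v).trans (le_abs_self _))

/-- `coeffFunctional` as a continuous linear map. -/
def coeffFunctionalL (d : ℕ) : (Fin d → ℝ) →L[ℝ] (Fin d → ℝ) →L[ℝ] ℝ :=
  LinearMap.mkContinuous
    { toFun := coeffFunctional
      map_add' := fun v w => by
        simp only [coeffFunctional, Pi.add_apply, add_smul, Finset.sum_add_distrib]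
      map_smul' := fun r v => by
        simp only [coeffFunctional, Pi.smul_apply, smul_assoc, Finset.smul_sum, RingHom.id_apply] }
    d fun v => by
      refine (norm_coeffFunctional_le v).trans ((Finset.sum_le_sum fun i _ =>
        norm_le_pi_norm v i).trans (le_of_eq ?_))
      simp

theorem coeffFunctionalL_apply (v : Fin d → ℝ) : coeffFunctionalL d v = coeffFunctional v := rfl

theorem integrable_coeffFunctional {α : Type*} [MeasurableSpace α] {μ : Measure α}
    {v : α → Fin d → ℝ} (hv : ∀ i, Integrable (fun z => v z i) μ) :
    Integrable (fun z => coeffFunctional (v z)) μ :=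
  (coeffFunctionalL d).integrable_comp (Integrable.of_eval hv)

theorem integral_coeffFunctional {α : Type*} [MeasurableSpace α] {μ : Measure α}
    {v : α → Fin d → ℝ} (hv : ∀ i, Integrable (fun z => v z i) μ) :
    ∫ z, coeffFunctional (v z) ∂μ = coeffFunctional fun i => ∫ z, v z i ∂μ := by
  have h := (coeffFunctionalL d).integral_comp_comm (Integrable.of_eval hv)
  simp only [coeffFunctionalL_apply] at h
  rw [h]
  congr 1
  funext i
  exact eval_integral hv i

theorem smul_coeffFunctional (r : ℝ) (v : Fin d → ℝ) :
    r • coeffFunctional v = coeffFunctional fun i => v i * r := by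
  rw [coeffFunctional, coeffFunctional, Finset.smul_sum]
  refine Finset.sum_congr rfl fun i _ => ?_
  rw [smul_smul, mul_comm]

theorem IsSmooth.hasFDerivAt {φ : Torus d → ℝ} (hφ : IsSmooth φ) (y : Fin d → ℝ) :
    HasFDerivAt (fun y => φ (proj y)) (coeffFunctional fun i => partialDeriv i φ (proj y)) y := by
  have h := (hφ.contDiff.differentiable (by simp) y).hasFDerivAt
  refine h.congr_fderiv ?_
  ext w
  conv_lhs => rw [← Finset.univ_sum_single w]
  rw [map_sum]
  simp only [coeffFunctional, _root_.sum_apply, _root_.smul_apply,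
    ContinuousLinearMap.proj_apply, ← hφ.fderiv_apply_single]
  refine Finset.sum_congr rfl fun i _ => ?_
  have : (Pi.single i (w i) : Fin d → ℝ) = w i • Pi.single i (1 : ℝ) := by
    rw [← Pi.single_smul, smul_eq_mul, mul_one]
  rw [this, map_smul, smul_eq_mul, smul_eq_mul, mul_comm]

theorem IsSmooth.comp_const_sub {φ : Torus d → ℝ} (hφ : IsSmooth φ) (x : Torus d) :
    IsSmooth fun y => φ (x - y) := by
  obtain ⟨z, rfl⟩ := proj_surjective x
  exact hφ.contDiff.comp (contDiff_const.sub contDiff_id : ContDiff ℝ _ fun y => z - y)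

theorem partialDeriv_comp_const_sub (φ : Torus d → ℝ) (i : Fin d) (x y : Torus d) :
    partialDeriv i (fun y => φ (x - y)) y = - partialDeriv i φ (x - y) := by
  have h := deriv_comp_neg (fun t : ℝ => φ (x - y + Pi.single i (t : UnitAddCircle))) 0
  rw [neg_zero] at h
  rw [partialDeriv, partialDeriv, ← h]
  congr 1
  funext t
  congr 1
  rw [AddCircle.coe_neg, Pi.single_neg]
  abel

/-- Convolution on the torus. -/
def conv (φ u : Torus d → ℝ) (x : Torus d) : ℝ := ∫ y, φ (x - y) * u y

theorem integrable_mul_of_continuous {φ u : Torus d → ℝ} (hφ : Continuous φ) (hu : Integrable u) :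
    Integrable fun y => φ y * u y := by
  obtain ⟨C, hC⟩ := isCompact_univ.exists_bound_of_continuousOn hφ.continuousOn
  exact hu.bdd_mul hφ.aestronglyMeasurable (Filter.Eventually.of_forall fun x => hC x trivial)

theorem integrable_conv {φ u : Torus d → ℝ} (hφ : Continuous φ) (hu : Integrable u)
    (x : Torus d) : Integrable fun y => φ (x - y) * u y :=
  integrable_mul_of_continuous (by fun_prop) hu

theorem continuous_conv {φ u : Torus d → ℝ} (hφ : Continuous φ) (hu : Integrable u) :
    Continuous (conv φ u) := by
  obtain ⟨C, hC⟩ := isCompact_univ.exists_bound_of_continuousOn hφ.continuousOn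
  refine continuous_of_dominated (bound := fun y => C * ‖u y‖)
    (fun x => (integrable_conv hφ hu x).aestronglyMeasurable)
    (fun x => Filter.Eventually.of_forall fun y => ?_) (hu.norm.const_mul C)
    (Filter.Eventually.of_forall fun y => by fun_prop)
  rw [norm_mul]
  exact mul_le_mul_of_nonneg_right (hC _ trivial) (norm_nonneg _)

/-- The test function is `y ↦ φ (x - y)`; the sign of its derivative cancels the sign in the
definition of the weak gradient. Thus the gradient of a mollified function is the mollified weak
gradient. -/
theorem HasWeakGrad.conv_partialDeriv {u : Torus d → ℝ} {g : Torus d → Fin d → ℝ}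
    (h : HasWeakGrad u g) {φ : Torus d → ℝ} (hφ : IsSmooth φ) (i : Fin d) (x : Torus d) :
    conv (partialDeriv i φ) u x = conv φ (fun y => g y i) x := by
  have := h.2 _ (hφ.comp_const_sub x) i
  simp only [partialDeriv_comp_const_sub, mul_neg, integral_neg, neg_inj] at this
  simp only [conv]
  simpa only [mul_comm] using this

theorem hasFDerivAt_conv {u : Torus d → ℝ} (hu : Integrable u) {φ : Torus d → ℝ}
    (hφ : IsSmooth φ) (y : Fin d → ℝ) :
    HasFDerivAt (fun y => conv φ u (proj y))
      (coeffFunctional fun i => conv (partialDeriv i φ) u (proj y)) y := by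
  have hc := fun i => hφ.continuous_partialDeriv i
  choose C hC using fun i => isCompact_univ.exists_bound_of_continuousOn (hc i).continuousOn
  have hpt : ∀ z : Torus d, ∀ y : Fin d → ℝ, HasFDerivAt (fun y => φ (proj y - z) * u z)
      (u z • coeffFunctional fun i => partialDeriv i φ (proj y - z)) y := by
    intro z y
    obtain ⟨z', rfl⟩ := proj_surjective z
    have h1 := (hφ.hasFDerivAt (y - z')).comp y ((hasFDerivAt_id y).sub_const z')
    rw [ContinuousLinearMap.comp_id] at h1
    exact h1.mul_const (u (proj z'))
  have hint : ∀ i, Integrable fun z => partialDeriv i φ (proj y - z) * u z :=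
    fun i => integrable_conv (hc i) hu _
  simp only [smul_coeffFunctional] at hpt
  have main := hasFDerivAt_integral_of_dominated_of_fderiv_le (μ := (volume : Measure (Torus d)))
    (F := fun y z => φ (proj y - z) * u z) (x₀ := y) (s := Set.univ)
    (F' := fun y z => coeffFunctional fun i => partialDeriv i φ (proj y - z) * u z)
    (bound := fun z => (∑ i, C i) * ‖u z‖) Filter.univ_mem
    (Filter.Eventually.of_forall fun y =>
      (integrable_conv hφ.continuous hu (proj y)).aestronglyMeasurable)
    (integrable_conv hφ.continuous hu (proj y))
    (integrable_coeffFunctional hint).aestronglyMeasurable ?_ (hu.norm.const_mul _)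
    (Filter.Eventually.of_forall fun z y _ => hpt z y)
  · exact main.congr_fderiv (integral_coeffFunctional hint)
  · refine Filter.Eventually.of_forall fun z y _ => (norm_coeffFunctional_le _).trans ?_
    rw [Finset.sum_mul]
    refine Finset.sum_le_sum fun i _ => ?_
    rw [norm_mul]
    exact mul_le_mul_of_nonneg_right (hC i _ trivial) (norm_nonneg _)

theorem HasWeakGrad.hasFDerivAt_conv {u : Torus d → ℝ} {g : Torus d → Fin d → ℝ}
    (h : HasWeakGrad u g) (hu : Integrable u) {φ : Torus d → ℝ} (hφ : IsSmooth φ)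
    (y : Fin d → ℝ) :
    HasFDerivAt (fun y => conv φ u (proj y))
      (coeffFunctional fun i => conv φ (fun x => g x i) (proj y)) y := by
  simpa only [h.conv_partialDeriv hφ] using Torus.hasFDerivAt_conv hu hφ y

theorem HasWeakGrad.contDiff_conv {u : Torus d → ℝ} {g : Torus d → Fin d → ℝ}
    (h : HasWeakGrad u g) (hu : Integrable u) {φ : Torus d → ℝ} (hφ : IsSmooth φ) :
    ContDiff ℝ 1 fun y => conv φ u (proj y) := by
  rw [contDiff_one_iff_fderiv]
  refine ⟨fun y => (h.hasFDerivAt_conv hu hφ y).differentiableAt, ?_⟩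
  have : fderiv ℝ (fun y => conv φ u (proj y)) =
      fun y => coeffFunctional fun i => conv φ (fun x => g x i) (proj y) :=
    funext fun y => (h.hasFDerivAt_conv hu hφ y).fderiv
  rw [this]
  have hc : ∀ i, Continuous fun y => conv φ (fun x => g x i) (proj y) := fun i =>
    (continuous_conv hφ.continuous (h.1 i)).comp continuous_proj
  exact continuous_finsetSum _ fun i _ => (hc i).smul continuous_const

/-- The trigonometric polynomial whose normalised powers form the mollifier. -/
def peak (x : Torus d) : ℝ := ∏ i, (1 + (fourier 1 (x i) : ℂ).re) / 2

theorem isSmooth_peak_pow (n : ℕ) : IsSmooth fun x : Torus d => peak x ^ n := by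
  refine ContDiff.pow ?_ n
  refine contDiff_prod fun i _ => ?_
  have : ∀ y : Fin d → ℝ, (fourier 1 ((y i : ℝ) : UnitAddCircle) : ℂ).re
      = Real.cos (2 * Real.pi * y i) := fun y => by
    rw [fourier_coe_apply]
    rw [show (2 * (Real.pi : ℂ) * Complex.I * ((1 : ℤ) : ℂ) * (y i : ℂ) / ((1 : ℝ) : ℂ))
      = ((2 * Real.pi * y i : ℝ) : ℂ) * Complex.I by push_cast; ring,
      Complex.exp_ofReal_mul_I_re]
  simp only [this]
  fun_prop

theorem continuous_peak : Continuous (peak : Torus d → ℝ) := by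
  simpa using (isSmooth_peak_pow (d := d) 1).continuous

theorem norm_fourier_eq_one (x : UnitAddCircle) : ‖(fourier 1 x : ℂ)‖ = 1 := by
  rw [fourier_one]; exact Circle.norm_coe _

theorem peak_factor_nonneg (x : UnitAddCircle) : 0 ≤ (1 + (fourier 1 x : ℂ).re) / 2 := by
  have := (abs_le.1 (Complex.abs_re_le_norm (fourier 1 x : ℂ))).1
  rw [norm_fourier_eq_one] at this
  linarith

theorem peak_factor_le_one (x : UnitAddCircle) : (1 + (fourier 1 x : ℂ).re) / 2 ≤ 1 := by
  have := (abs_le.1 (Complex.abs_re_le_norm (fourier 1 x : ℂ))).2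
  rw [norm_fourier_eq_one] at this
  linarith

/-- Real part `1` on the unit circle forces the value `1`, and the first Fourier character is
injective. -/
theorem peak_factor_lt_one {x : UnitAddCircle} (hx : x ≠ 0) :
    (1 + (fourier 1 x : ℂ).re) / 2 < 1 := by
  refine lt_of_le_of_ne (peak_factor_le_one x) fun h => hx ?_
  have hre : (fourier 1 x : ℂ).re = 1 := by linarith
  have hn := norm_fourier_eq_one x
  have h2 : (fourier 1 x : ℂ).im = 0 := by
    have h3 := Complex.sq_norm (fourier 1 x : ℂ)
    rw [hn, Complex.normSq_apply, hre] at h3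
    have : (fourier 1 x : ℂ).im * (fourier 1 x : ℂ).im = 0 := by linarith
    exact mul_self_eq_zero.1 this
  have h1 : (fourier 1 x : ℂ) = 1 := Complex.ext (by simpa using hre) (by simpa using h2)
  rw [fourier_one] at h1
  have h4 : AddCircle.toCircle x = AddCircle.toCircle (0 : UnitAddCircle) := by
    rw [AddCircle.toCircle_zero]
    exact Subtype.ext h1
  exact AddCircle.injective_toCircle one_ne_zero h4

theorem peak_nonneg (x : Torus d) : 0 ≤ peak x :=
  Finset.prod_nonneg fun _ _ => peak_factor_nonneg _

theorem peak_zero : peak (0 : Torus d) = 1 := by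
  refine Finset.prod_eq_one fun i _ => ?_
  rw [Pi.zero_apply, fourier_eval_zero]
  norm_num

theorem peak_lt_one {x : Torus d} (hx : x ≠ 0) : peak x < 1 := by
  obtain ⟨i, hi⟩ := Function.ne_iff.1 hx
  rw [peak, ← Finset.mul_prod_erase _ _ (Finset.mem_univ i)]
  refine lt_of_le_of_lt ?_ (peak_factor_lt_one hi)
  refine mul_le_of_le_one_right (peak_factor_nonneg _) ?_
  exact Finset.prod_le_one (fun _ _ => peak_factor_nonneg _) fun _ _ => peak_factor_le_one _

theorem integral_peak_pow_pos (n : ℕ) : 0 < ∫ x : Torus d, peak x ^ n := by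
  refine (continuous_peak.pow n).integral_pos_of_hasCompactSupport_nonneg_nonzero (x := 0)
    (HasCompactSupport.of_compactSpace _) (fun x => pow_nonneg (peak_nonneg x) n) ?_
  simp [peak_zero]

/-- A smooth approximate identity on the torus. -/
def mollifier (n : ℕ) (x : Torus d) : ℝ := (∫ x : Torus d, peak x ^ n)⁻¹ * peak x ^ n

theorem isSmooth_mollifier (n : ℕ) : IsSmooth (mollifier n : Torus d → ℝ) :=
  contDiff_const.mul (isSmooth_peak_pow n)

theorem mollifier_nonneg (n : ℕ) (x : Torus d) : 0 ≤ mollifier n x :=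
  mul_nonneg (inv_nonneg.2 (integral_peak_pow_pos n).le) (pow_nonneg (peak_nonneg x) n)

theorem integral_mollifier (n : ℕ) : ∫ x : Torus d, mollifier n x = 1 := by
  simp only [mollifier]
  rw [integral_const_mul, inv_mul_cancel₀ (integral_peak_pow_pos n).ne']

/-- `peak` is nonnegative with a unique maximum at `0`, so its normalised powers concentrate there.
-/
theorem tendsto_integral_mollifier_mul {F : Torus d → ℝ} (hF : Continuous F) :
    Filter.Tendsto (fun n => ∫ x, mollifier n x * F x) Filter.atTop (nhds (F 0)) := by
  have := tendsto_setIntegral_pow_smul_of_unique_maximum_of_isCompact_of_continuousOn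
    (μ := (volume : Measure (Torus d))) (x₀ := (0 : Torus d)) isCompact_univ
    (c := peak) continuous_peak.continuousOn (fun y _ hy => by rw [peak_zero]; exact peak_lt_one hy)
    (fun x _ => peak_nonneg x) (by rw [peak_zero]; exact one_pos) (by simp) hF.continuousOn
  simp only [setIntegral_univ, smul_eq_mul] at this
  refine this.congr fun n => ?_
  rw [← integral_const_mul]
  simp only [mollifier, mul_assoc]

end Torus
end

noncomputable section

/-! ### Convergence of mollifications in `L¹` and uniqueness of weak gradients. -/

namespace Torus

variable {d : ℕ}

instance isNegInvariant_volume : (volume : Measure (Torus d)).IsNegInvariant :=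
  Measure.IsAddHaarMeasure.isNegInvariant_of_regular _

/-- Translation acts continuously on `L¹`. The function is stated as one of the shift `h` so that
the approximate identity can be tested against it; it vanishes at `h = 0`. -/
theorem continuous_integral_translate_sub {u : Torus d → ℝ} (hu : Integrable u) :
    Continuous fun h : Torus d => ∫ x, ‖u (x - h) - u x‖ := by
  let U : Lp ℝ 1 (volume : Measure (Torus d)) := hu.toL1 u
  let T : Torus d → C(Torus d, Torus d) := fun h => ⟨fun x => x - h, by fun_prop⟩
  have hT : Continuous T := ContinuousMap.continuous_of_continuous_uncurry _ (by
    change Continuous fun q : Torus d × Torus d => q.2 - q.1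
    fun_prop)
  have hmp : ∀ h, MeasurePreserving (T h) (volume : Measure (Torus d)) volume := fun h =>
    measurePreserving_sub_right volume h
  have hc : Continuous fun h => Lp.compMeasurePreserving (T h) (hmp h) U :=
    continuous_const.compMeasurePreservingLp hT hmp ENNReal.one_ne_top
  refine (hc.sub continuous_const).norm.congr (f := fun h =>
    ‖Lp.compMeasurePreserving (T h) (hmp h) U - U‖) fun h => ?_
  rw [L1.norm_eq_integral_norm]
  refine integral_congr_ae ?_
  have hU : U =ᵐ[volume] u := hu.coeFn_toL1
  filter_upwards [Lp.coeFn_sub (Lp.compMeasurePreserving (T h) (hmp h) U) U,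
    Lp.coeFn_compMeasurePreserving U (hmp h), hU, (hmp h).quasiMeasurePreserving.ae hU]
    with x h1 h2 h3 h4
  rw [h1, Pi.sub_apply, h2, Function.comp_apply, h3, h4]
  rfl

theorem conv_eq_integral_translate (φ u : Torus d → ℝ) (x : Torus d) :
    conv φ u x = ∫ h, φ h * u (x - h) := by
  rw [conv, ← integral_sub_left_eq_self (fun h => φ h * u (x - h)) volume x]
  simp only [sub_sub_cancel]

theorem integrable_translate {u : Torus d → ℝ} (hu : Integrable u) (x : Torus d) :
    Integrable fun h => u (x - h) := hu.comp_sub_left x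

/-- As `φ` has mass one, `conv φ u - u` is the `φ`-average of the differences `u (· - h) - u`;
Tonelli's theorem does the rest. -/
theorem lintegral_conv_sub_le {φ u : Torus d → ℝ} (hφ : Continuous φ) (h0 : ∀ x, 0 ≤ φ x)
    (h1 : ∫ x, φ x = 1) (hu : Integrable u) :
    ∫⁻ x, ‖conv φ u x - u x‖ₑ ≤ ENNReal.ofReal (∫ h, φ h * ∫ x, ‖u (x - h) - u x‖) := by
  have hF := continuous_integral_translate_sub hu
  have hφi : Integrable φ := hφ.integrable_of_hasCompactSupport (HasCompactSupport.of_compactSpace _)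
  have hpt : ∀ x, ‖conv φ u x - u x‖ₑ ≤ ∫⁻ h, ENNReal.ofReal (φ h) * ‖u (x - h) - u x‖ₑ := by
    intro x
    have e : conv φ u x - u x = ∫ h, φ h * (u (x - h) - u x) := by
      simp only [mul_sub]
      rw [integral_sub (integrable_mul_of_continuous hφ (integrable_translate hu x))
        (hφi.mul_const _), integral_mul_const, h1, one_mul, conv_eq_integral_translate]
    rw [e]
    refine (enorm_integral_le_lintegral_enorm _).trans (lintegral_mono fun h => ?_)
    rw [enorm_mul, Real.enorm_of_nonneg (h0 h)]
  refine (lintegral_mono hpt).trans ?_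
  have hm : AEMeasurable (fun q : Torus d × Torus d => u (q.1 - q.2) - u q.1)
      ((volume : Measure (Torus d)).prod volume) :=
    (hu.aestronglyMeasurable.aemeasurable.comp_quasiMeasurePreserving
      (quasiMeasurePreserving_sub_of_right_invariant volume volume)).sub
      hu.aestronglyMeasurable.aemeasurable.comp_fst
  have hm2 : AEMeasurable (fun q : Torus d × Torus d => ENNReal.ofReal (φ q.2) *
      ‖u (q.1 - q.2) - u q.1‖ₑ) ((volume : Measure (Torus d)).prod volume) :=
    ((hφ.measurable.comp measurable_snd).ennreal_ofReal.aemeasurable).mul hm.enorm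
  rw [lintegral_lintegral_swap hm2]
  have hFi : ∀ h, ∫⁻ x, ENNReal.ofReal (φ h) * ‖u (x - h) - u x‖ₑ =
      ENNReal.ofReal (φ h * ∫ x, ‖u (x - h) - u x‖) := by
    intro h
    have hi : Integrable fun x => u (x - h) - u x := (hu.comp_sub_right h).sub hu
    rw [lintegral_const_mul' _ _ ENNReal.ofReal_ne_top, ENNReal.ofReal_mul (h0 h),
      ofReal_integral_norm_eq_lintegral_enorm hi]
  simp only [hFi]
  rw [← ofReal_integral_eq_lintegral_ofReal]
  · exact (hφ.mul hF).integrable_of_hasCompactSupport (HasCompactSupport.of_compactSpace _)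
  · exact Filter.Eventually.of_forall fun h =>
      mul_nonneg (h0 h) (integral_nonneg fun x => norm_nonneg _)

theorem tendsto_lintegral_conv_mollifier {u : Torus d → ℝ} (hu : Integrable u) :
    Filter.Tendsto (fun n => ∫⁻ x, ‖conv (mollifier n) u x - u x‖ₑ) Filter.atTop (nhds 0) := by
  have h := tendsto_integral_mollifier_mul (continuous_integral_translate_sub hu)
  have h2 : (∫ x, ‖u (x - 0) - u x‖) = 0 := by simp
  rw [h2] at h
  have h3 := ENNReal.tendsto_ofReal h
  rw [ENNReal.ofReal_zero] at h3
  exact tendsto_of_tendsto_of_tendsto_of_le_of_le tendsto_const_nhds h3 (fun _ => zero_le)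
    fun n => lintegral_conv_sub_le (isSmooth_mollifier n).continuous (mollifier_nonneg n)
      (integral_mollifier n) hu

theorem ae_eq_of_conv_mollifier_eq {f g : Torus d → ℝ} (hf : Integrable f) (hg : Integrable g)
    (h : ∀ n x, conv (mollifier n) f x = conv (mollifier n) g x) : f =ᵐ[volume] g := by
  have hle : ∀ n, ∫⁻ x, ‖f x - g x‖ₑ ≤
      (∫⁻ x, ‖conv (mollifier n) f x - f x‖ₑ) + ∫⁻ x, ‖conv (mollifier n) g x - g x‖ₑ := by
    intro n
    have hc := (continuous_conv (isSmooth_mollifier n).continuous hf).aemeasurable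
      (μ := (volume : Measure (Torus d)))
    have hm : AEMeasurable (fun x => ‖conv (mollifier n) f x - f x‖ₑ) volume :=
      (hc.sub hf.aestronglyMeasurable.aemeasurable).enorm
    rw [← lintegral_add_left' hm]
    refine lintegral_mono fun x => ?_
    have e : f x - g x = -(conv (mollifier n) f x - f x) + (conv (mollifier n) g x - g x) := by
      rw [h n x]; ring
    rw [e]
    refine (enorm_add_le _ _).trans ?_
    rw [enorm_neg]
  have hlim := (tendsto_lintegral_conv_mollifier hf).add (tendsto_lintegral_conv_mollifier hg)
  rw [add_zero] at hlim
  have hz : ∫⁻ x, ‖f x - g x‖ₑ = 0 :=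
    le_antisymm (ge_of_tendsto' hlim hle) zero_le
  have hm : AEMeasurable (fun x => ‖f x - g x‖ₑ) volume :=
    (hf.sub hg).aestronglyMeasurable.aemeasurable.enorm
  rw [lintegral_eq_zero_iff' hm] at hz
  filter_upwards [hz] with x hx
  have := enorm_eq_zero.1 hx
  linarith

/-- Weak gradients are unique up to null sets. -/
theorem HasWeakGrad.ae_eq {u : Torus d → ℝ} {g g' : Torus d → Fin d → ℝ}
    (h : HasWeakGrad u g) (h' : HasWeakGrad u g') : g =ᵐ[volume] g' := by
  have : ∀ i, (fun x => g x i) =ᵐ[volume] fun x => g' x i := fun i =>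
    ae_eq_of_conv_mollifier_eq (h.1 i) (h'.1 i) fun n x => by
      rw [← h.conv_partialDeriv (isSmooth_mollifier n),
        ← h'.conv_partialDeriv (isSmooth_mollifier n)]
  filter_upwards [ae_all_iff.2 this] with x hx
  exact funext hx

theorem lintegral_mollifier_sub (n : ℕ) (x : Torus d) :
    ∫⁻ y, ENNReal.ofReal (mollifier n (x - y)) = 1 := by
  have hc := (isSmooth_mollifier (d := d) n).continuous
  have hi : Integrable (mollifier n : Torus d → ℝ) :=
    hc.integrable_of_hasCompactSupport (HasCompactSupport.of_compactSpace _)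
  rw [lintegral_sub_left_eq_self (fun y => ENNReal.ofReal (mollifier n y)) x,
    ← ofReal_integral_eq_lintegral_ofReal hi
      (Filter.Eventually.of_forall fun y => mollifier_nonneg n y), integral_mollifier,
    ENNReal.ofReal_one]

/-- Jensen's inequality for the probability measure with density `mollifier n (x - ·)`. It moves the
power inside the convolution, so that only `L¹` convergence of mollifications is needed later. -/
theorem rpow_enorm_conv_mollifier_le {G : Torus d → ℝ} (hG : Integrable G) {p : ℝ} (hp : 1 ≤ p)
    (hGp : Integrable fun x => ‖G x‖ ^ p) (n : ℕ) (x : Torus d) :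
    ‖conv (mollifier n) G x‖ₑ ^ p ≤ ‖conv (mollifier n) (fun x => ‖G x‖ ^ p) x‖ₑ := by
  have hp0 : 0 ≤ p := by linarith
  have hc := (isSmooth_mollifier (d := d) n).continuous
  have hmm : Measurable fun y => ENNReal.ofReal (mollifier n (x - y)) := by fun_prop
  set ν := (volume : Measure (Torus d)).withDensity fun y => ENNReal.ofReal (mollifier n (x - y))
    with hν
  have : IsProbabilityMeasure ν := ⟨by
    rw [hν, withDensity_apply _ MeasurableSet.univ, Measure.restrict_univ,
      lintegral_mollifier_sub]⟩
  have hGm : AEMeasurable (fun y => ‖G y‖ₑ) volume := hG.aestronglyMeasurable.aemeasurable.enorm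
  have hGν : AEMeasurable (fun y => ‖G y‖ₑ) ν :=
    hGm.mono_ac (withDensity_absolutelyContinuous _ _)
  calc ‖conv (mollifier n) G x‖ₑ ^ p
      ≤ (∫⁻ y, ‖G y‖ₑ ∂ν) ^ p := by
        refine ENNReal.rpow_le_rpow ?_ hp0
        refine (enorm_integral_le_lintegral_enorm _).trans (le_of_eq ?_)
        rw [hν, lintegral_withDensity_eq_lintegral_mul₀ hmm.aemeasurable hGm]
        refine lintegral_congr fun y => ?_
        rw [enorm_mul, Real.enorm_of_nonneg (mollifier_nonneg n _), Pi.mul_apply]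
    _ ≤ ∫⁻ y, ‖G y‖ₑ ^ p ∂ν := lintegral_rpow_le_of_isProbabilityMeasure hGν hp
    _ = ∫⁻ y, ENNReal.ofReal (mollifier n (x - y) * ‖G y‖ ^ p) := by
        rw [hν, lintegral_withDensity_eq_lintegral_mul₀ hmm.aemeasurable (hGm.pow_const p)]
        refine lintegral_congr fun y => ?_
        rw [Pi.mul_apply, ENNReal.ofReal_mul (mollifier_nonneg n _), ← ofReal_norm,
          ENNReal.ofReal_rpow_of_nonneg (norm_nonneg _) hp0]
    _ = _ := by
        have hnn : ∀ y, 0 ≤ mollifier n (x - y) * ‖G y‖ ^ p := fun y =>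
          mul_nonneg (mollifier_nonneg n _) (Real.rpow_nonneg (norm_nonneg _) _)
        rw [← ofReal_integral_eq_lintegral_ofReal (integrable_conv hc hGp x)
          (Filter.Eventually.of_forall hnn), conv, Real.enorm_of_nonneg (integral_nonneg hnn)]

theorem norm_conv_mollifier_le (G : Torus d → ℝ) (n : ℕ) (x : Torus d) :
    ‖conv (mollifier n) G x‖ ≤ conv (mollifier n) (fun x => ‖G x‖) x := by
  refine (norm_integral_le_integral_norm _).trans (le_of_eq ?_)
  refine integral_congr_ae (Filter.Eventually.of_forall fun y => ?_)
  simp [abs_of_nonneg (mollifier_nonneg n (x - y))]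

theorem sum_norm_conv_mollifier_le {g : Torus d → Fin d → ℝ}
    (hg : ∀ i, Integrable fun x => g x i) (n : ℕ) (x : Torus d) :
    ∑ i, ‖conv (mollifier n) (fun x => g x i) x‖ ≤
      conv (mollifier n) (fun x => ∑ i, ‖g x i‖) x := by
  refine (Finset.sum_le_sum fun i _ => norm_conv_mollifier_le _ n x).trans (le_of_eq ?_)
  simp only [conv, Finset.mul_sum]
  rw [integral_finsetSum]
  exact fun i _ => integrable_conv (isSmooth_mollifier n).continuous (hg i).norm x

/-- The covering map preserves the measure on a unit cube. -/
theorem measurePreserving_proj_unit (a : Fin d → ℝ) :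
    MeasurePreserving (proj : (Fin d → ℝ) → Torus d) (volume.restrict (cube a 1)) volume := by
  rw [volume_restrict_cube, volume_pi]
  exact measurePreserving_pi _ _ fun i => UnitAddCircle.measurePreserving_mk (a i)

end Torus
end

noncomputable section

/-! ### Tiles of the torus and the Sobolev–Poincaré inequality for weak gradients. -/

namespace Torus

variable {d : ℕ}

/-- The representative in `(0, 1]^d` of a point of the torus. -/
def rep (x : Torus d) : Fin d → ℝ := fun i => (AddCircle.equivIoc 1 0 (x i) : ℝ)

theorem measurable_rep : Measurable (rep : Torus d → Fin d → ℝ) :=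
  measurable_pi_iff.2 fun i => (measurable_subtype_coe.comp
    (AddCircle.measurableEquivIoc 1 0).measurable).comp (measurable_pi_apply i)

theorem rep_mem (x : Torus d) : rep x ∈ cube (0 : Fin d → ℝ) 1 := fun i _ =>
  (AddCircle.equivIoc 1 0 (x i)).2

theorem rep_proj {y : Fin d → ℝ} (hy : y ∈ cube (0 : Fin d → ℝ) 1) : rep (proj y) = y := by
  funext i
  exact congrArg Subtype.val ((AddCircle.equivIoc (1 : ℝ) 0).apply_symm_apply ⟨y i, hy i trivial⟩)

/-- The subset of the torus that corresponds to a cube contained in `(0, 1]^d`. -/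
def tile (a : Fin d → ℝ) (l : ℝ) : Set (Torus d) := rep ⁻¹' cube a l

theorem measurableSet_tile (a : Fin d → ℝ) (l : ℝ) : MeasurableSet (tile a l) :=
  measurable_rep (measurableSet_cube a l)

theorem measurePreserving_proj {a : Fin d → ℝ} {l : ℝ} (h : cube a l ⊆ cube 0 1) :
    MeasurePreserving (proj : (Fin d → ℝ) → Torus d) (volume.restrict (cube a l))
      (volume.restrict (tile a l)) := by
  have h1 := (measurePreserving_proj_unit (0 : Fin d → ℝ)).restrict_preimage
    (measurableSet_tile a l)
  rw [Measure.restrict_restrict (continuous_proj.measurable (measurableSet_tile a l))] at h1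
  have he : cube a l = proj ⁻¹' tile a l ∩ cube 0 1 := by
    ext y
    constructor
    · intro hy
      refine ⟨?_, h hy⟩
      rw [Set.mem_preimage, tile, Set.mem_preimage, rep_proj (h hy)]
      exact hy
    · rintro ⟨hy, hy1⟩
      rwa [Set.mem_preimage, tile, Set.mem_preimage, rep_proj hy1] at hy
  rwa [← he] at h1

theorem volume_tile {a : Fin d → ℝ} {l : ℝ} (h : cube a l ⊆ cube 0 1) :
    volume (tile a l) = ENNReal.ofReal l ^ d := by
  have := (measurePreserving_proj h).measure_preimage (s := Set.univ) MeasurableSet.univ.nullMeasurableSet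
  rw [Set.preimage_univ, Measure.restrict_apply_univ, Measure.restrict_apply_univ] at this
  rw [← this, volume_cube]

theorem setAverage_comp_proj {a : Fin d → ℝ} {l : ℝ} (h : cube a l ⊆ cube 0 1)
    {v : Torus d → ℝ} (hv : Continuous v) :
    ⨍ y in cube a l, v (proj y) = ⨍ x in tile a l, v x := by
  have hmp := measurePreserving_proj h
  have h1 : ∫ x in tile a l, v x = ∫ y in cube a l, v (proj y) := by
    rw [← hmp.map_eq, integral_map continuous_proj.aemeasurable hv.aestronglyMeasurable]
  rw [setAverage_eq, setAverage_eq, h1, measureReal_def, measureReal_def, volume_tile h,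
    volume_cube]

/-- Convolution uses values from outside the tile, so the gradient integral over the tile alone is
not an upper bound. The additional term is an `L¹` mollification error over the whole torus and
vanishes in the limit. -/
theorem sobolev_poincare_tile_mollified (hd : 2 ≤ d) {a : Fin d → ℝ} {l : ℝ} (hl : 0 < l)
    (h : cube a l ⊆ cube 0 1) {u : Torus d → ℝ} {g : Torus d → Fin d → ℝ} (hu : Integrable u)
    (hg : HasWeakGrad u g) {p : ℝ} (hp : 1 ≤ p) (hpd : p < d)
    (hgp : Integrable fun x => (∑ i, ‖g x i‖) ^ p) (n : ℕ) :
    (∫⁻ x in tile a l, ‖conv (mollifier n) u x - ⨍ y in tile a l, conv (mollifier n) u y‖ₑ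
        ^ (sobolevConj d p)) ^ (1 / sobolevConj d p) ≤
      sobolevPoincareConst d p * ((∫⁻ x in tile a l, ‖(∑ i, ‖g x i‖) ^ p‖ₑ) +
        ∫⁻ x, ‖conv (mollifier n) (fun x => (∑ i, ‖g x i‖) ^ p) x
          - (∑ i, ‖g x i‖) ^ p‖ₑ) ^ (1 / p) := by
  have hp0 : 0 < p := by linarith
  have hmp := measurePreserving_proj h
  have hK := isSmooth_mollifier (d := d) n
  have hv := continuous_conv hK.continuous hu
  have hvi := fun i => continuous_conv hK.continuous (hg.1 i)
  have hm1 : Measurable fun x => ‖conv (mollifier n) u x -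
      ⨍ y in tile a l, conv (mollifier n) u y‖ₑ ^ (sobolevConj d p) := by fun_prop
  rw [← hmp.lintegral_comp hm1, ← setAverage_comp_proj h hv]
  refine (sobolev_poincare_cube hd hl (hg.contDiff_conv hu hK) hp hpd).trans ?_
  gcongr
  have hG1 : Integrable fun x => ∑ i, ‖g x i‖ := integrable_finsetSum _ fun i _ => (hg.1 i).norm
  have hnn : ∀ x, 0 ≤ ∑ i, ‖g x i‖ := fun x => Finset.sum_nonneg fun i _ => norm_nonneg _
  have hgp' : Integrable fun x => ‖∑ i, ‖g x i‖‖ ^ p := by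
    simpa only [Real.norm_of_nonneg (hnn _)] using hgp
  have hcG := continuous_conv hK.continuous hgp
  calc ∫⁻ y in cube a l, ‖fderiv ℝ (fun y => conv (mollifier n) u (proj y)) y‖ₑ ^ p
      ≤ ∫⁻ y in cube a l, ‖conv (mollifier n) (fun x => (∑ i, ‖g x i‖) ^ p) (proj y)‖ₑ := by
        refine lintegral_mono fun y => ?_
        rw [(hg.hasFDerivAt_conv hu hK y).fderiv]
        refine le_trans (ENNReal.rpow_le_rpow ?_ hp0.le)
          ((rpow_enorm_conv_mollifier_le hG1 hp hgp' n (proj y)).trans (le_of_eq ?_))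
        · refine (enorm_coeffFunctional_le _).trans ?_
          rw [← ofReal_norm, ← ofReal_norm]
          refine ENNReal.ofReal_le_ofReal ?_
          rw [Real.norm_of_nonneg (Finset.sum_nonneg fun i _ => norm_nonneg _)]
          exact (sum_norm_conv_mollifier_le hg.1 n (proj y)).trans (le_abs_self _)
        · simp only [Real.norm_of_nonneg (hnn _)]
    _ = ∫⁻ x in tile a l, ‖conv (mollifier n) (fun x => (∑ i, ‖g x i‖) ^ p) x‖ₑ :=
        hmp.lintegral_comp hcG.measurable.enorm
    _ ≤ ∫⁻ x in tile a l, (‖(∑ i, ‖g x i‖) ^ p‖ₑ + ‖conv (mollifier n)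
          (fun x => (∑ i, ‖g x i‖) ^ p) x - (∑ i, ‖g x i‖) ^ p‖ₑ) := by
        refine lintegral_mono fun x => ?_
        refine le_trans (le_of_eq ?_) (enorm_add_le _ _)
        congr 1
        ring
    _ = (∫⁻ x in tile a l, ‖(∑ i, ‖g x i‖) ^ p‖ₑ) + ∫⁻ x in tile a l, ‖conv (mollifier n)
          (fun x => (∑ i, ‖g x i‖) ^ p) x - (∑ i, ‖g x i‖) ^ p‖ₑ :=
        lintegral_add_left' hgp.aestronglyMeasurable.aemeasurable.enorm.restrict _
    _ ≤ _ := by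
        exact add_le_add le_rfl (setLIntegral_le_lintegral _ _)

/-- The Sobolev–Poincaré inequality for weakly differentiable functions on a tile. -/
theorem HasWeakGrad.sobolev_poincare_tile (hd : 2 ≤ d) {a : Fin d → ℝ} {l : ℝ} (hl : 0 < l)
    (h : cube a l ⊆ cube 0 1) {u : Torus d → ℝ} {g : Torus d → Fin d → ℝ} (hu : Integrable u)
    (hg : HasWeakGrad u g) {p : ℝ} (hp : 1 ≤ p) (hpd : p < d)
    (hgp : Integrable fun x => (∑ i, ‖g x i‖) ^ p) :
    (∫⁻ x in tile a l, ‖u x - ⨍ y in tile a l, u y‖ₑ ^ (sobolevConj d p))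
        ^ (1 / sobolevConj d p) ≤
      sobolevPoincareConst d p * (∫⁻ x in tile a l, ‖(∑ i, ‖g x i‖) ^ p‖ₑ) ^ (1 / p) := by
  have hp0 : 0 < p := by linarith
  have hS0 : 0 < sobolevConj d p := inv_pos.2 (sub_pos.2 (inv_strictAnti₀ hp0 hpd))
  set v : ℕ → Torus d → ℝ := fun n => conv (mollifier n) u with hvdef
  have hvc : ∀ n, Continuous (v n) := fun n =>
    continuous_conv (isSmooth_mollifier n).continuous hu
  have hvi : ∀ n, Integrable (v n) := fun n =>
    (hvc n).integrable_of_hasCompactSupport (HasCompactSupport.of_compactSpace _)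
  have hL1 := tendsto_lintegral_conv_mollifier hu
  have hL1' : Filter.Tendsto (fun n => eLpNorm (v n - u) 1 volume) Filter.atTop (nhds 0) := by
    simpa only [eLpNorm_one_eq_lintegral_enorm, Pi.sub_apply] using hL1
  obtain ⟨ns, hns, hae⟩ := (tendstoInMeasure_of_tendsto_eLpNorm one_ne_zero
    (fun n => (hvi n).aestronglyMeasurable) hu.aestronglyMeasurable hL1').exists_seq_tendsto_ae
  have havg : Filter.Tendsto (fun n => ⨍ y in tile a l, v n y) Filter.atTop
      (nhds (⨍ y in tile a l, u y)) := by
    simp only [setAverage_eq]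
    exact (tendsto_setIntegral_of_L1 u hu.aestronglyMeasurable (Filter.Eventually.of_forall hvi)
      hL1 (tile a l)).const_smul _
  have havg' := havg.comp hns.tendsto_atTop
  have hRHS : Filter.Tendsto (fun k => sobolevPoincareConst d p *
      ((∫⁻ x in tile a l, ‖(∑ i, ‖g x i‖) ^ p‖ₑ) +
        ∫⁻ x, ‖conv (mollifier (ns k)) (fun x => (∑ i, ‖g x i‖) ^ p) x
          - (∑ i, ‖g x i‖) ^ p‖ₑ) ^ (1 / p)) Filter.atTop (nhds (sobolevPoincareConst d p *
            (∫⁻ x in tile a l, ‖(∑ i, ‖g x i‖) ^ p‖ₑ) ^ (1 / p))) := by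
    refine ENNReal.Tendsto.const_mul ?_ (Or.inr (sobolevPoincareConst_ne_top d hp0.le))
    refine (ENNReal.continuous_rpow_const.tendsto _).comp ?_
    have := ((tendsto_lintegral_conv_mollifier hgp).comp hns.tendsto_atTop).const_add
      (∫⁻ x in tile a l, ‖(∑ i, ‖g x i‖) ^ p‖ₑ)
    rw [add_zero] at this
    exact this
  set S := sobolevConj d p with hS
  set R : ℝ≥0∞ := sobolevPoincareConst d p *
    (∫⁻ x in tile a l, ‖(∑ i, ‖g x i‖) ^ p‖ₑ) ^ (1 / p) with hR
  have hmono : ∀ k, ∫⁻ x in tile a l, ‖v (ns k) x - ⨍ y in tile a l, v (ns k) y‖ₑ ^ S ≤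
      (sobolevPoincareConst d p * ((∫⁻ x in tile a l, ‖(∑ i, ‖g x i‖) ^ p‖ₑ) +
        ∫⁻ x, ‖conv (mollifier (ns k)) (fun x => (∑ i, ‖g x i‖) ^ p) x
          - (∑ i, ‖g x i‖) ^ p‖ₑ) ^ (1 / p)) ^ S := fun k => by
    have := ENNReal.rpow_le_rpow
      (sobolev_poincare_tile_mollified hd hl h hu hg hp hpd hgp (ns k)) hS0.le
    rwa [← ENNReal.rpow_mul, one_div_mul_cancel hS0.ne', ENNReal.rpow_one] at this
  -- Along a subsequence the mollifications converge almost everywhere and their averages converge,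
  -- so Fatou's lemma passes the mollified inequality to `u`.
  have hfatou : ∫⁻ x in tile a l, ‖u x - ⨍ y in tile a l, u y‖ₑ ^ S ≤ R ^ S := by
    calc ∫⁻ x in tile a l, ‖u x - ⨍ y in tile a l, u y‖ₑ ^ S
        = ∫⁻ x in tile a l, Filter.liminf
            (fun k => ‖v (ns k) x - ⨍ y in tile a l, v (ns k) y‖ₑ ^ S) Filter.atTop := by
          refine lintegral_congr_ae ?_
          filter_upwards [ae_restrict_of_ae hae] with x hx
          refine (Filter.Tendsto.liminf_eq ?_).symm
          exact (ENNReal.continuous_rpow_const.tendsto _).comp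
            ((continuous_enorm.tendsto _).comp (hx.sub havg'))
      _ ≤ Filter.liminf (fun k => ∫⁻ x in tile a l,
            ‖v (ns k) x - ⨍ y in tile a l, v (ns k) y‖ₑ ^ S) Filter.atTop :=
          lintegral_liminf_le fun k => by
            have := hvc (ns k)
            fun_prop
      _ ≤ Filter.liminf (fun k => (sobolevPoincareConst d p *
            ((∫⁻ x in tile a l, ‖(∑ i, ‖g x i‖) ^ p‖ₑ) +
              ∫⁻ x, ‖conv (mollifier (ns k)) (fun x => (∑ i, ‖g x i‖) ^ p) x
                - (∑ i, ‖g x i‖) ^ p‖ₑ) ^ (1 / p)) ^ S) Filter.atTop :=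
          Filter.liminf_le_liminf (Filter.Eventually.of_forall hmono)
      _ = R ^ S := ((ENNReal.continuous_rpow_const.tendsto _).comp hRHS).liminf_eq
  have := ENNReal.rpow_le_rpow hfatou (by positivity : 0 ≤ 1 / S)
  rwa [← ENNReal.rpow_mul, mul_one_div_cancel hS0.ne', ENNReal.rpow_one] at this

/-- The corner of a tile of the regular partition into `N ^ d` tiles. -/
def corner {N : ℕ} (k : Fin d → Fin N) : Fin d → ℝ := fun i => (k i : ℝ) / N

theorem cube_corner_subset {N : ℕ} (hN : 0 < N) (k : Fin d → Fin N) :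
    cube (corner k) (1 / N : ℝ) ⊆ cube 0 1 := by
  have hN' : (0 : ℝ) < N := by exact_mod_cast hN
  intro y hy i _
  have h1 := hy i trivial
  simp only [corner] at h1
  have h2 : ((k i : ℕ) : ℝ) + 1 ≤ N := by exact_mod_cast (k i).2
  refine ⟨lt_of_le_of_lt (by simp; positivity) h1.1, h1.2.trans ?_⟩
  rw [← add_div, Pi.zero_apply, zero_add, div_le_one hN']
  exact h2

theorem iUnion_tile {N : ℕ} (hN : 0 < N) :
    ⋃ k : Fin d → Fin N, tile (corner k) (1 / N : ℝ) = Set.univ := by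
  have hN' : (0 : ℝ) < N := by exact_mod_cast hN
  refine Set.eq_univ_of_forall fun x => Set.mem_iUnion.2 ?_
  have hx := rep_mem x
  have hk : ∀ i, ∃ j : Fin N, (j : ℝ) < N * rep x i ∧ N * rep x i ≤ j + 1 := by
    intro i
    have h1 := hx i trivial
    simp only [Pi.zero_apply, zero_add] at h1
    have h2 : 0 < N * rep x i := mul_pos hN' h1.1
    have h3 : 0 < ⌈N * rep x i⌉₊ := Nat.ceil_pos.2 h2
    have h4 : ⌈N * rep x i⌉₊ ≤ N := Nat.ceil_le.2 (by nlinarith [h1.2])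
    -- Cubes are open on the left and closed on the right, so the index is the ceiling minus one and
    -- not the floor.
    refine ⟨⟨⌈N * rep x i⌉₊ - 1, by omega⟩, ?_, ?_⟩
    · exact Nat.lt_ceil.1 (by simp only; omega)
    · have := Nat.le_ceil (N * rep x i)
      refine this.trans ?_
      have : (⌈N * rep x i⌉₊ - 1) + 1 = ⌈N * rep x i⌉₊ := by omega
      exact_mod_cast this.ge
  choose k hk1 hk2 using hk
  refine ⟨k, fun i _ => ⟨?_, ?_⟩⟩
  · rw [corner, div_lt_iff₀ hN', mul_comm]; exact hk1 i
  · rw [corner, ← add_div, le_div_iff₀ hN', mul_comm]; exact hk2 i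

theorem pairwise_disjoint_tile {N : ℕ} (hN : 0 < N) :
    Pairwise (Function.onFun Disjoint fun k : Fin d → Fin N => tile (corner k) (1 / N : ℝ)) := by
  have hN' : (0 : ℝ) < N := by exact_mod_cast hN
  intro k k' hkk
  refine Set.disjoint_left.2 fun x hx hx' => hkk ?_
  funext i
  have h1 := hx i trivial
  have h2 := hx' i trivial
  simp only [corner, ← add_div, Set.mem_Ioc, div_lt_iff₀ hN', le_div_iff₀ hN'] at h1 h2
  have h3 : ((k i : ℕ) : ℝ) < (k' i : ℕ) + 1 := by linarith
  have h4 : ((k' i : ℕ) : ℝ) < (k i : ℕ) + 1 := by linarith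
  have h3' : (k i : ℕ) < (k' i : ℕ) + 1 := by exact_mod_cast h3
  have h4' : (k' i : ℕ) < (k i : ℕ) + 1 := by exact_mod_cast h4
  exact Fin.ext (by omega)

theorem sum_setLIntegral_tile {N : ℕ} (hN : 0 < N) (F : Torus d → ℝ≥0∞) :
    ∑ k : Fin d → Fin N, ∫⁻ x in tile (corner k) (1 / N : ℝ), F x = ∫⁻ x, F x := by
  rw [← setLIntegral_univ, ← iUnion_tile hN,
    lintegral_iUnion (fun k => measurableSet_tile _ _) (pairwise_disjoint_tile hN), tsum_fintype]

end Torus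
end

noncomputable section

/-! ### Weighted Sobolev–Poincaré inequality and approximation by piecewise averages. -/

namespace Coefficients

variable {d : ℕ}

/-- The structural assumptions on the coefficients: weighted ellipticity, comparability of the
symmetric parts of `A` and `A⁻¹`, positivity and integrability of `κ`. -/
structure Admissible (P : Coefficients d) (σ : Torus d → ℝ) (q τ : ℝ) (β : ℝ≥0∞) : Prop where
  two_le : 2 ≤ d
  aemeasurable_weight : AEMeasurable σ
  weight_nonneg : ∀ x, 0 ≤ σ x
  half_le : 1 / 2 ≤ q
  lt_one : q < 1
  lintegral_weight : ∫⁻ x, ENNReal.ofReal (σ x) ^ (q / (q - 1)) < ∞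
  elliptic : ∀ᵐ x, ∀ ξ : Fin d → ℝ, σ x * (ξ ⬝ᵥ ξ) ≤ ξ ⬝ᵥ (P.A x *ᵥ ξ)
  tau_pos : 0 < τ
  comparable : ∀ᵐ x, ∀ ξ : Fin d → ℝ,
    ξ ⬝ᵥ ((symPart (P.A x)⁻¹)⁻¹ *ᵥ ξ) ≤ τ * (ξ ⬝ᵥ (symPart (P.A x) *ᵥ ξ))
  kappa_pos : ∀ᵐ x, 0 < P.kappa x
  one_le : 1 ≤ β
  kappa_memLp : MemLp P.kappa β
  exponent_le : 2 * β.conjExponent ≤ ENNReal.ofReal (sobolevConj d (2 * q))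

/-- The quadratic energy density `gᵀ A g + κ u²`. -/
def energyDensity (P : Coefficients d) (u : Torus d → ℝ) (g : Torus d → Fin d → ℝ)
    (x : Torus d) : ℝ :=
  g x ⬝ᵥ (P.A x *ᵥ g x) + P.kappa x * u x ^ 2

namespace Admissible

variable {P : Coefficients d} {σ : Torus d → ℝ} {q τ : ℝ} {β : ℝ≥0∞}

/-- The exponent `q / (q - 1)` is negative, so a zero of `σ` contributes the value `∞` to a finite
integral. -/
theorem weight_pos (h : P.Admissible σ q τ β) : ∀ᵐ x, 0 < σ x := by
  have hq := h.half_le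
  have hq1 := h.lt_one
  have hm : AEMeasurable (fun x => ENNReal.ofReal (σ x) ^ (q / (q - 1))) :=
    h.aemeasurable_weight.ennreal_ofReal.pow_const _
  filter_upwards [ae_lt_top' hm h.lintegral_weight.ne] with x hx
  refine lt_of_le_of_ne (h.weight_nonneg x) fun h0 => ?_
  rw [← h0, ENNReal.ofReal_zero, ENNReal.zero_rpow_of_neg
    (div_neg_of_pos_of_neg (by linarith) (by linarith))] at hx
  exact lt_irrefl _ hx

theorem quad_pos (h : P.Admissible σ q τ β) :
    ∀ᵐ x, ∀ ξ : Fin d → ℝ, ξ ≠ 0 → 0 < ξ ⬝ᵥ (P.A x *ᵥ ξ) := by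
  filter_upwards [h.weight_pos, h.elliptic] with x h1 h2 ξ hξ
  refine lt_of_lt_of_le (mul_pos h1 ?_) (h2 ξ)
  refine lt_of_le_of_ne (Finset.sum_nonneg fun i _ => mul_self_nonneg _) fun h0 => hξ ?_
  exact dotProduct_self_eq_zero.1 h0.symm

theorem energyDensity_nonneg (h : P.Admissible σ q τ β) (u : Torus d → ℝ)
    (g : Torus d → Fin d → ℝ) : ∀ᵐ x, 0 ≤ P.energyDensity u g x := by
  filter_upwards [P.nonneg_A, h.kappa_pos] with x h1 h2
  exact add_nonneg (h1 _) (mul_nonneg h2.le (sq_nonneg _))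

theorem one_le_exponent (h : P.Admissible σ q τ β) : 1 ≤ 2 * q := by linarith [h.half_le]

theorem exponent_lt (h : P.Admissible σ q τ β) : 2 * q < d := by
  have : (2 : ℝ) ≤ d := by exact_mod_cast h.two_le
  linarith [h.lt_one]

theorem sobolevConj_pos (h : P.Admissible σ q τ β) : 0 < sobolevConj d (2 * q) :=
  inv_pos.2 (sub_pos.2 (inv_strictAnti₀ (by linarith [h.half_le]) h.exponent_lt))

theorem one_le_sobolevConj (h : P.Admissible σ q τ β) : 1 ≤ sobolevConj d (2 * q) := by
  have h1 : (2 * q)⁻¹ ≤ 1 := inv_le_one_of_one_le₀ h.one_le_exponent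
  have h2 : 0 ≤ (d : ℝ)⁻¹ := by positivity
  have h3 := inv_pos.1 h.sobolevConj_pos
  exact (one_le_inv₀ h3).2 (by linarith)

/-- Hölder's inequality with the degenerate weight. -/
theorem setLIntegral_grad_rpow_le (h : P.Admissible σ q τ β) {g : Torus d → Fin d → ℝ}
    (hg : ∀ i, AEMeasurable fun x => g x i) (E : Set (Torus d)) :
    (∫⁻ x in E, ‖(∑ i, ‖g x i‖) ^ (2 * q)‖ₑ) ^ (1 / q) ≤
      (d * ∫⁻ x in E, ENNReal.ofReal (g x ⬝ᵥ (P.A x *ᵥ g x))) *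
        (∫⁻ x in E, ENNReal.ofReal (σ x) ^ (q / (q - 1))) ^ ((1 - q) / q) := by
  have hq0 : 0 < q := by linarith [h.half_le]
  have hq1 : 0 < 1 - q := by linarith [h.lt_one]
  -- The splitting is `|g|^{2q} = (σ |g|²)^q σ^{-q}`: the power `1/q` of the first factor is
  -- controlled by the quadratic form, and the power `1/(1-q)` of the second is `σ^{q/(q-1)}`.
  have hconj : Real.HolderConjugate (1 / q) (1 / (1 - q)) := by
    rw [Real.holderConjugate_iff]
    refine ⟨by rw [lt_div_iff₀ hq0]; linarith [h.lt_one], ?_⟩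
    rw [one_div, one_div, inv_inv, inv_inv]
    ring
  have hGm : AEMeasurable (fun x => ∑ i, ‖g x i‖) :=
    Finset.aemeasurable_fun_sum _ fun i _ => (hg i).norm
  have hf : AEMeasurable (fun x => ENNReal.ofReal (σ x * (∑ i, ‖g x i‖) ^ 2) ^ q)
      (volume.restrict E) :=
    ((h.aemeasurable_weight.mul (hGm.pow_const 2)).ennreal_ofReal.pow_const q).restrict
  have hw : AEMeasurable (fun x => ENNReal.ofReal (σ x) ^ (-q)) (volume.restrict E) :=
    (h.aemeasurable_weight.ennreal_ofReal.pow_const _).restrict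
  have hH := ENNReal.lintegral_mul_le_Lp_mul_Lq (volume.restrict E) hconj hf hw
  have hnn : ∀ x, 0 ≤ ∑ i, ‖g x i‖ := fun x => Finset.sum_nonneg fun i _ => norm_nonneg _
  have e1 : ∫⁻ x in E, ‖(∑ i, ‖g x i‖) ^ (2 * q)‖ₑ = ∫⁻ x in E,
      ((fun x => ENNReal.ofReal (σ x * (∑ i, ‖g x i‖) ^ 2) ^ q) *
        fun x => ENNReal.ofReal (σ x) ^ (-q)) x := by
    refine lintegral_congr_ae (ae_restrict_of_ae ?_)
    filter_upwards [h.weight_pos] with x hx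
    have h0 : ENNReal.ofReal (σ x) ≠ 0 := by simpa using hx
    rw [Pi.mul_apply, ENNReal.ofReal_mul hx.le, ENNReal.mul_rpow_of_nonneg _ _ hq0.le,
      mul_right_comm, ← ENNReal.rpow_add _ _ h0 ENNReal.ofReal_ne_top, add_neg_cancel,
      ENNReal.rpow_zero, one_mul, Real.enorm_of_nonneg (Real.rpow_nonneg (hnn x) _),
      ENNReal.ofReal_rpow_of_nonneg (sq_nonneg _) hq0.le, ← Real.rpow_natCast_mul (hnn x)]
    norm_num
  have e2 : ∀ x, (ENNReal.ofReal (σ x * (∑ i, ‖g x i‖) ^ 2) ^ q) ^ (1 / q) =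
      ENNReal.ofReal (σ x * (∑ i, ‖g x i‖) ^ 2) := fun x => by
    rw [← ENNReal.rpow_mul, mul_one_div_cancel hq0.ne', ENNReal.rpow_one]
  have e3 : ∀ x, (ENNReal.ofReal (σ x) ^ (-q)) ^ (1 / (1 - q)) =
      ENNReal.ofReal (σ x) ^ (q / (q - 1)) := fun x => by
    rw [← ENNReal.rpow_mul]
    congr 1
    have : q - 1 ≠ 0 := by linarith
    field_simp
    ring
  simp only [e2, e3] at hH
  rw [one_div_one_div, one_div_one_div] at hH
  rw [e1]
  refine (ENNReal.rpow_le_rpow hH (by positivity : 0 ≤ 1 / q)).trans ?_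
  rw [ENNReal.mul_rpow_of_nonneg _ _ (by positivity), ← ENNReal.rpow_mul, ← ENNReal.rpow_mul,
    mul_one_div_cancel hq0.ne', ENNReal.rpow_one, mul_one_div]
  gcongr
  rw [← lintegral_const_mul' _ _ (ENNReal.natCast_ne_top d)]
  refine lintegral_mono_ae (ae_restrict_of_ae ?_)
  filter_upwards [h.elliptic] with x hx
  rw [← ENNReal.ofReal_natCast, ← ENNReal.ofReal_mul (by positivity)]
  refine ENNReal.ofReal_le_ofReal ?_
  -- The factor `d` is the price of comparing the `ℓ¹` norm with the Euclidean norm in the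
  -- ellipticity hypothesis.
  have hcs : (∑ i, ‖g x i‖) ^ 2 ≤ d * (g x ⬝ᵥ g x) := by
    have := sq_sum_le_card_mul_sum_sq (s := Finset.univ) (f := fun i => ‖g x i‖)
    simpa [dotProduct, pow_two] using this
  calc σ x * (∑ i, ‖g x i‖) ^ 2 ≤ σ x * (d * (g x ⬝ᵥ g x)) :=
        mul_le_mul_of_nonneg_left hcs (h.weight_nonneg x)
    _ = d * (σ x * (g x ⬝ᵥ g x)) := by ring
    _ ≤ _ := mul_le_mul_of_nonneg_left (hx _) (by positivity)

theorem integrable_grad_rpow (h : P.Admissible σ q τ β) {g : Torus d → Fin d → ℝ}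
    (hg : ∀ i, AEMeasurable fun x => g x i)
    (hgA : Integrable fun x => g x ⬝ᵥ (P.A x *ᵥ g x)) :
    Integrable fun x => (∑ i, ‖g x i‖) ^ (2 * q) := by
  have hq0 : 0 < q := by linarith [h.half_le]
  have hq1 : 0 < 1 - q := by linarith [h.lt_one]
  have hGm : AEMeasurable (fun x => ∑ i, ‖g x i‖) :=
    Finset.aemeasurable_fun_sum _ fun i _ => (hg i).norm
  refine ⟨(hGm.pow_const _).aestronglyMeasurable, ?_⟩
  have := h.setLIntegral_grad_rpow_le hg Set.univ
  simp only [setLIntegral_univ] at this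
  have h2 := lt_of_le_of_lt this (ENNReal.mul_lt_top
    (ENNReal.mul_lt_top (ENNReal.natCast_lt_top d) hgA.lintegral_lt_top)
    (ENNReal.rpow_lt_top_of_nonneg (by positivity) h.lintegral_weight.ne))
  exact (ENNReal.rpow_lt_top_iff_of_pos (by positivity)).1 h2

/-- The weighted Sobolev–Poincaré inequality on a tile. -/
theorem sobolev_poincare_tile (h : P.Admissible σ q τ β) {a : Fin d → ℝ} {l : ℝ} (hl : 0 < l)
    (hsub : cube a l ⊆ cube 0 1) {u : Torus d → ℝ} {g : Torus d → Fin d → ℝ} (hu : Integrable u)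
    (hg : Torus.HasWeakGrad u g) (hgA : Integrable fun x => g x ⬝ᵥ (P.A x *ᵥ g x)) :
    ((∫⁻ x in Torus.tile a l, ‖u x - ⨍ y in Torus.tile a l, u y‖ₑ ^ (sobolevConj d (2 * q)))
        ^ (1 / sobolevConj d (2 * q))) ^ 2 ≤
      sobolevPoincareConst d (2 * q) ^ 2 * ((d * ∫⁻ x in Torus.tile a l,
        ENNReal.ofReal (g x ⬝ᵥ (P.A x *ᵥ g x))) *
        (∫⁻ x in Torus.tile a l, ENNReal.ofReal (σ x) ^ (q / (q - 1))) ^ ((1 - q) / q)) := by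
  have hq0 : 0 < q := by linarith [h.half_le]
  have hgm : ∀ i, AEMeasurable fun x => g x i := fun i => (hg.1 i).aestronglyMeasurable.aemeasurable
  have h1 := hg.sobolev_poincare_tile h.two_le hl hsub hu h.one_le_exponent h.exponent_lt
    (h.integrable_grad_rpow hgm hgA)
  refine (pow_le_pow_left₀ zero_le h1 2).trans ?_
  rw [mul_pow]
  gcongr
  -- Squaring turns the exponent `1/(2q)` into `1/q`, for which the weighted Hölder inequality is
  -- linear in the energy.
  refine le_trans (le_of_eq ?_) (h.setLIntegral_grad_rpow_le hgm _)
  rw [← ENNReal.rpow_natCast, ← ENNReal.rpow_mul]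
  congr 1
  push_cast
  field_simp

end Admissible

/-- Hölder's inequality for the weight `κ ∈ L^β` on a set of measure at most one. -/
theorem lintegral_mul_sq_le {α : Type*} [MeasurableSpace α] {μ : Measure α} (hμ : μ Set.univ ≤ 1)
    {κ w : α → ℝ} (hκ : AEStronglyMeasurable κ μ) (hw : AEStronglyMeasurable w μ) {β : ℝ≥0∞}
    (hβ : 1 ≤ β) {s : ℝ} (hs : 0 < s) (hβs : 2 * β.conjExponent ≤ ENNReal.ofReal s) :
    ∫⁻ x, ‖κ x * w x ^ 2‖ₑ ∂μ ≤
      eLpNorm κ β μ * ((∫⁻ x, ‖w x‖ₑ ^ s ∂μ) ^ (1 / s)) ^ 2 := by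
  have : β.HolderConjugate β.conjExponent := ENNReal.HolderConjugate.conjExponent hβ
  have h1 := eLpNorm_smul_le_mul_eLpNorm (p := β) (q := β.conjExponent) (r := 1)
    (f := fun x => ‖w x‖ ^ (2 : ℝ)) (φ := κ)
    ((hw.norm.aemeasurable.pow_const _).aestronglyMeasurable) hκ
  have h2 : eLpNorm (κ • fun x => ‖w x‖ ^ (2 : ℝ)) 1 μ = ∫⁻ x, ‖κ x * w x ^ 2‖ₑ ∂μ := by
    rw [eLpNorm_one_eq_lintegral_enorm]
    refine lintegral_congr fun x => ?_
    simp [smul_eq_mul]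
  rw [h2, eLpNorm_norm_rpow w two_pos] at h1
  refine h1.trans ?_
  gcongr
  have h3 : β.conjExponent * ENNReal.ofReal 2 ≤ ENNReal.ofReal s := by
    rw [mul_comm]; simpa using hβs
  have hs0 : ENNReal.ofReal s ≠ 0 := by simpa using hs
  -- On a space of measure at most one the `L^{2β'}` norm is at most the `L^s` norm, because `2β' ≤
  -- s`.
  have h4 : eLpNorm w (β.conjExponent * ENNReal.ofReal 2) μ ≤ (∫⁻ x, ‖w x‖ₑ ^ s ∂μ) ^ (1 / s) := by
    refine (eLpNorm_le_eLpNorm_mul_rpow_measure_univ h3 hw).trans ?_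
    rw [eLpNorm_eq_lintegral_rpow_enorm_toReal hs0 ENNReal.ofReal_ne_top,
      ENNReal.toReal_ofReal hs.le]
    refine mul_le_of_le_one_right zero_le (ENNReal.rpow_le_one hμ ?_)
    rw [sub_nonneg]
    have h5 : 1 ≤ β.conjExponent := by rw [ENNReal.conjExponent]; exact le_self_add
    have h6 : 0 < (β.conjExponent * ENNReal.ofReal 2).toReal := by
      refine ENNReal.toReal_pos ?_ (ne_top_of_le_ne_top ENNReal.ofReal_ne_top h3)
      refine mul_ne_zero (by positivity) (by simp)
    refine one_div_le_one_div_of_le h6 ?_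
    have := ENNReal.toReal_mono ENNReal.ofReal_ne_top h3
    rwa [ENNReal.toReal_ofReal hs.le] at this
  calc _ ≤ ((∫⁻ x, ‖w x‖ₑ ^ s ∂μ) ^ (1 / s)) ^ (2 : ℝ) := ENNReal.rpow_le_rpow h4 (by norm_num)
    _ = _ := by rw [← ENNReal.rpow_natCast]; norm_num

namespace Admissible

variable {P : Coefficients d} {σ : Torus d → ℝ} {q τ : ℝ} {β : ℝ≥0∞}

/-- The part of the approximation error on a single tile. -/
theorem setLIntegral_kappa_sub_average_le (h : P.Admissible σ q τ β) {a : Fin d → ℝ} {l : ℝ}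
    (hl : 0 < l) (hsub : cube a l ⊆ cube 0 1) {u : Torus d → ℝ} {g : Torus d → Fin d → ℝ}
    (hu : Integrable u) (hg : Torus.HasWeakGrad u g)
    (hgA : Integrable fun x => g x ⬝ᵥ (P.A x *ᵥ g x)) :
    ∫⁻ x in Torus.tile a l, ‖P.kappa x * (u x - ⨍ y in Torus.tile a l, u y) ^ 2‖ₑ ≤
      eLpNorm P.kappa β volume * (sobolevPoincareConst d (2 * q) ^ 2 *
        ((d * ∫⁻ x in Torus.tile a l, ENNReal.ofReal (g x ⬝ᵥ (P.A x *ᵥ g x))) *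
        (∫⁻ x in Torus.tile a l, ENNReal.ofReal (σ x) ^ (q / (q - 1))) ^ ((1 - q) / q))) := by
  refine (lintegral_mul_sq_le (by simpa using prob_le_one)
    P.aemeasurable_kappa.aestronglyMeasurable.restrict
    (hu.aestronglyMeasurable.sub aestronglyMeasurable_const).restrict h.one_le h.sobolevConj_pos
    h.exponent_le).trans ?_
  refine mul_le_mul' (eLpNorm_mono_measure _ Measure.restrict_le_self) ?_
  exact h.sobolev_poincare_tile hl hsub hu hg hgA

/-- Piecewise averages on a fine partition approximate functions of bounded energy in `L²(κ)`. -/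
theorem exists_partition (h : P.Admissible σ q τ β) {ε : ℝ≥0∞} (hε : ε ≠ 0) :
    ∃ N : ℕ, 0 < N ∧ ∀ (u : Torus d → ℝ) (g : Torus d → Fin d → ℝ), Integrable u →
      Torus.HasWeakGrad u g → (Integrable fun x => g x ⬝ᵥ (P.A x *ᵥ g x)) →
      ∑ k : Fin d → Fin N, ∫⁻ x in Torus.tile (Torus.corner k) (1 / N : ℝ), ‖P.kappa x *
        (u x - ⨍ y in Torus.tile (Torus.corner k) (1 / N : ℝ), u y) ^ 2‖ₑ ≤
      ε * ∫⁻ x, ENNReal.ofReal (g x ⬝ᵥ (P.A x *ᵥ g x)) := by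
  have hq0 : 0 < q := by linarith [h.half_le]
  have hq1 : 0 < 1 - q := by linarith [h.lt_one]
  set K := eLpNorm P.kappa β volume * (sobolevPoincareConst d (2 * q) ^ 2 * d) with hK
  have hKt : K ≠ ∞ := ENNReal.mul_ne_top h.kappa_memLp.2.ne (ENNReal.mul_ne_top
    (ENNReal.pow_ne_top (sobolevPoincareConst_ne_top d (by linarith))) (ENNReal.natCast_ne_top d))
  obtain ⟨δ₁, hδ₁, hδε⟩ : ∃ δ₁ : ℝ≥0∞, δ₁ ≠ 0 ∧ K * δ₁ ^ ((1 - q) / q) ≤ ε := by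
    have ht : Filter.Tendsto (fun t : ℝ≥0∞ => K * t ^ ((1 - q) / q)) (nhds 0) (nhds 0) := by
      have := ENNReal.Tendsto.const_mul (a := K)
        ((ENNReal.continuous_rpow_const (y := (1 - q) / q)).tendsto 0) (Or.inr hKt)
      rwa [ENNReal.zero_rpow_of_pos (by positivity), mul_zero] at this
    have hev := ht.eventually (gt_mem_nhds (pos_iff_ne_zero.2 hε))
    obtain ⟨b, hb, hbs⟩ := (ENNReal.nhds_zero_basis_Iic.eventually_iff).1 hev
    exact ⟨b, hb.ne', (hbs (Set.mem_Iic.2 le_rfl)).le⟩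
  -- Absolute continuity of the integral of `σ^{q/(q-1)}`: every tile of measure below `δ` carries
  -- weight integral below `δ₁`, uniformly in the position of the tile and independently of `u`.
  obtain ⟨δ, hδ, hs⟩ := exists_pos_setLIntegral_lt_of_measure_lt h.lintegral_weight.ne hδ₁
  obtain ⟨N, hN, hNδ⟩ : ∃ N : ℕ, 0 < N ∧ ENNReal.ofReal (1 / N : ℝ) ^ d < δ := by
    have ht : Filter.Tendsto (fun n : ℕ => ENNReal.ofReal (1 / ((n : ℝ) + 1)) ^ d) Filter.atTop
        (nhds 0) := by
      have h1 := ENNReal.tendsto_ofReal tendsto_one_div_add_atTop_nhds_zero_nat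
      have h2 := (ENNReal.continuous_pow d).tendsto (ENNReal.ofReal 0) |>.comp h1
      have hd0 : d ≠ 0 := by have := h.two_le; omega
      simpa [hd0, Function.comp_def] using h2
    obtain ⟨n, hn⟩ := (ht.eventually (gt_mem_nhds hδ)).exists
    exact ⟨n + 1, n.succ_pos, by push_cast; exact hn⟩
  refine ⟨N, hN, fun u g hu hg hgA => ?_⟩
  have hl : (0 : ℝ) < 1 / N := by positivity
  calc _ ≤ ∑ k : Fin d → Fin N, ε * ∫⁻ x in Torus.tile (Torus.corner k) (1 / N : ℝ),
        ENNReal.ofReal (g x ⬝ᵥ (P.A x *ᵥ g x)) := by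
        refine Finset.sum_le_sum fun k _ => ?_
        have hsub := Torus.cube_corner_subset hN k
        refine (h.setLIntegral_kappa_sub_average_le hl hsub hu hg hgA).trans ?_
        have hsk := (hs (Torus.tile (Torus.corner k) (1 / N : ℝ))
          (by rw [Torus.volume_tile hsub]; exact hNδ)).le
        calc _ = (K * (∫⁻ x in Torus.tile (Torus.corner k) (1 / N : ℝ),
              ENNReal.ofReal (σ x) ^ (q / (q - 1))) ^ ((1 - q) / q)) *
              ∫⁻ x in Torus.tile (Torus.corner k) (1 / N : ℝ),
                ENNReal.ofReal (g x ⬝ᵥ (P.A x *ᵥ g x)) := by rw [hK]; ring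
          _ ≤ _ := by
            gcongr
            exact le_trans (by gcongr) hδε
    _ = _ := by rw [← Finset.mul_sum, Torus.sum_setLIntegral_tile hN]

end Admissible
end Coefficients
end

noncomputable section

/-! ### Linearity and closedness of the weak gradient; `L¹` bounds by the energy. -/

namespace Torus

variable {d : ℕ}

theorem HasWeakGrad.congr {u v : Torus d → ℝ} {g : Torus d → Fin d → ℝ} (h : HasWeakGrad u g)
    (huv : u =ᵐ[volume] v) : HasWeakGrad v g := by
  refine ⟨h.1, fun φ hφ i => ?_⟩
  rw [← h.2 φ hφ i]
  refine integral_congr_ae ?_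
  filter_upwards [huv] with x hx
  rw [hx]

theorem integrable_mul_continuous {φ u : Torus d → ℝ} (hu : Integrable u) (hφ : Continuous φ) :
    Integrable fun y => u y * φ y := by
  simpa only [mul_comm] using integrable_mul_of_continuous hφ hu

theorem HasWeakGrad.add {u v : Torus d → ℝ} {g k : Torus d → Fin d → ℝ} (hu : Integrable u)
    (hv : Integrable v) (h : HasWeakGrad u g) (h' : HasWeakGrad v k) :
    HasWeakGrad (fun x => u x + v x) fun x => g x + k x := by
  refine ⟨fun i => (h.1 i).add (h'.1 i), fun φ hφ i => ?_⟩
  have hc := hφ.continuous_partialDeriv i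
  simp only [Pi.add_apply, add_mul]
  rw [integral_add (integrable_mul_continuous hu hc) (integrable_mul_continuous hv hc),
    integral_add (integrable_mul_continuous (h.1 i) hφ.continuous)
      (integrable_mul_continuous (h'.1 i) hφ.continuous), h.2 φ hφ i, h'.2 φ hφ i]
  ring

theorem HasWeakGrad.smul {u : Torus d → ℝ} {g : Torus d → Fin d → ℝ} (r : ℝ)
    (h : HasWeakGrad u g) : HasWeakGrad (fun x => r * u x) fun x => r • g x := by
  refine ⟨fun i => (h.1 i).const_mul r, fun φ hφ i => ?_⟩
  simp only [Pi.smul_apply, smul_eq_mul, mul_assoc]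
  rw [integral_const_mul, integral_const_mul, h.2 φ hφ i]
  ring

theorem HasWeakGrad.sub {u v : Torus d → ℝ} {g k : Torus d → Fin d → ℝ} (hu : Integrable u)
    (hv : Integrable v) (h : HasWeakGrad u g) (h' : HasWeakGrad v k) :
    HasWeakGrad (fun x => u x - v x) fun x => g x - k x := by
  have := h.add hu (hv.const_mul (-1)) (h'.smul (-1))
  simpa only [neg_one_mul, neg_smul, one_smul, ← sub_eq_add_neg] using this

theorem hasWeakGrad_weakGrad {u : Torus d →₁[volume] ℝ} (h : ∃ g, HasWeakGrad u g) :
    HasWeakGrad u (weakGrad u) := by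
  rw [weakGrad, dif_pos h]
  exact h.choose_spec

theorem weakGrad_ae_eq {u : Torus d →₁[volume] ℝ} {g : Torus d → Fin d → ℝ}
    (h : HasWeakGrad u g) : weakGrad u =ᵐ[volume] g :=
  (hasWeakGrad_weakGrad ⟨g, h⟩).ae_eq h

theorem tendsto_integral_mul_of_tendsto_lintegral {F : ℕ → Torus d → ℝ} {f ψ : Torus d → ℝ}
    (hψ : Continuous ψ) (hF : ∀ n, Integrable (F n)) (hf : Integrable f)
    (h : Filter.Tendsto (fun n => ∫⁻ x, ‖F n x - f x‖ₑ) Filter.atTop (nhds 0)) :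
    Filter.Tendsto (fun n => ∫ x, F n x * ψ x) Filter.atTop (nhds (∫ x, f x * ψ x)) := by
  obtain ⟨C, hC⟩ := isCompact_univ.exists_bound_of_continuousOn hψ.continuousOn
  refine tendsto_integral_of_L1 _ (integrable_mul_continuous hf hψ).aestronglyMeasurable
    (Filter.Eventually.of_forall fun n => integrable_mul_continuous (hF n) hψ) ?_
  have h2 := ENNReal.Tendsto.const_mul (a := ENNReal.ofReal C) h (Or.inr ENNReal.ofReal_ne_top)
  rw [mul_zero] at h2
  refine tendsto_of_tendsto_of_tendsto_of_le_of_le tendsto_const_nhds h2 (fun _ => zero_le)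
    fun n => ?_
  simp only []
  rw [← lintegral_const_mul' _ _ ENNReal.ofReal_ne_top]
  refine lintegral_mono fun x => ?_
  rw [← sub_mul, enorm_mul, mul_comm]
  gcongr
  rw [← ofReal_norm]
  exact ENNReal.ofReal_le_ofReal (hC x trivial)

/-- The weak gradient is a closed operator in `L¹`: both sides of the defining identity pass to the
limit because test functions and their derivatives are bounded. -/
theorem HasWeakGrad.of_tendsto {F : ℕ → Torus d → ℝ} {f : Torus d → ℝ}
    {G : ℕ → Torus d → Fin d → ℝ} {g : Torus d → Fin d → ℝ} (h : ∀ n, HasWeakGrad (F n) (G n))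
    (hF : ∀ n, Integrable (F n)) (hf : Integrable f) (hg : ∀ i, Integrable fun x => g x i)
    (hFf : Filter.Tendsto (fun n => ∫⁻ x, ‖F n x - f x‖ₑ) Filter.atTop (nhds 0))
    (hGg : ∀ i, Filter.Tendsto (fun n => ∫⁻ x, ‖G n x i - g x i‖ₑ) Filter.atTop (nhds 0)) :
    HasWeakGrad f g := by
  refine ⟨hg, fun φ hφ i => ?_⟩
  have h1 := tendsto_integral_mul_of_tendsto_lintegral (hφ.continuous_partialDeriv i) hF hf hFf
  have h2 := tendsto_integral_mul_of_tendsto_lintegral hφ.continuous (fun n => (h n).1 i) (hg i)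
    (hGg i)
  refine tendsto_nhds_unique h1 (h2.neg.congr fun n => ?_)
  rw [(h n).2 φ hφ i]

end Torus

namespace Coefficients

variable {d : ℕ} {P : Coefficients d}

theorem hasWeakGrad (u : P.energySpace) : Torus.HasWeakGrad u.1 (Torus.weakGrad u.1) := by
  obtain ⟨g, hg, -⟩ := u.2
  exact Torus.hasWeakGrad_weakGrad ⟨g, hg⟩

theorem integrable_coeFn (u : P.energySpace) : Integrable (u.1 : Torus d → ℝ) :=
  L1.integrable_coeFn u.1

theorem integrable_quad (u : P.energySpace) :
    Integrable fun x => Torus.weakGrad u.1 x ⬝ᵥ (P.A x *ᵥ Torus.weakGrad u.1 x) := by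
  obtain ⟨g, hg, hA, -⟩ := u.2
  refine hA.congr ?_
  filter_upwards [Torus.weakGrad_ae_eq hg] with x hx
  rw [hx]

theorem integrable_kappa_sq (u : P.energySpace) :
    Integrable fun x => P.kappa x * u.1 x ^ 2 := by
  obtain ⟨g, -, -, hk⟩ := u.2
  exact hk

theorem aemeasurable_weakGrad (u : P.energySpace) (i : Fin d) :
    AEMeasurable fun x => Torus.weakGrad u.1 x i :=
  ((hasWeakGrad u).1 i).aestronglyMeasurable.aemeasurable

/-- `weakGrad` is a chosen representative, so it is additive only almost everywhere, by uniqueness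
of weak gradients. -/
theorem coeFn_add_ae (u v : P.energySpace) :
    ∀ᵐ x, (u + v).1 x = u.1 x + v.1 x ∧
      Torus.weakGrad (u + v).1 x = Torus.weakGrad u.1 x + Torus.weakGrad v.1 x := by
  have h1 : ((u + v).1 : Torus d → ℝ) =ᵐ[volume] fun x => u.1 x + v.1 x := Lp.coeFn_add u.1 v.1
  have h2 := ((hasWeakGrad u).add (integrable_coeFn u) (integrable_coeFn v)
    (hasWeakGrad v)).congr h1.symm
  filter_upwards [h1, Torus.weakGrad_ae_eq h2] with x hx hx2 using ⟨hx, hx2⟩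

theorem coeFn_smul_ae (r : ℝ) (u : P.energySpace) :
    ∀ᵐ x, (r • u).1 x = r * u.1 x ∧
      Torus.weakGrad (r • u).1 x = r • Torus.weakGrad u.1 x := by
  have h1 : ((r • u).1 : Torus d → ℝ) =ᵐ[volume] fun x => r * u.1 x := Lp.coeFn_smul r u.1
  have h2 := ((hasWeakGrad u).smul r).congr h1.symm
  filter_upwards [h1, Torus.weakGrad_ae_eq h2] with x hx hx2 using ⟨hx, hx2⟩

theorem coeFn_sub_ae (u v : P.energySpace) :
    ∀ᵐ x, (u - v).1 x = u.1 x - v.1 x ∧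
      Torus.weakGrad (u - v).1 x = Torus.weakGrad u.1 x - Torus.weakGrad v.1 x := by
  have h1 : ((u - v).1 : Torus d → ℝ) =ᵐ[volume] fun x => u.1 x - v.1 x := Lp.coeFn_sub u.1 v.1
  have h2 := ((hasWeakGrad u).sub (integrable_coeFn u) (integrable_coeFn v)
    (hasWeakGrad v)).congr h1.symm
  filter_upwards [h1, Torus.weakGrad_ae_eq h2] with x hx hx2 using ⟨hx, hx2⟩

/-- The square of the energy norm. -/
def energy (u : P.energySpace) : ℝ := ∫ x, P.energyDensity u.1 (Torus.weakGrad u.1) x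

theorem integrable_energyDensity (u : P.energySpace) :
    Integrable (P.energyDensity u.1 (Torus.weakGrad u.1)) :=
  (integrable_quad u).add (integrable_kappa_sq u)

theorem aemeasurable_energyDensity (P : Coefficients d) {u : Torus d → ℝ}
    {g : Torus d → Fin d → ℝ} (hu : AEMeasurable u) (hg : ∀ i, AEMeasurable fun x => g x i) :
    AEMeasurable (P.energyDensity u g) :=
  (P.aestronglyMeasurable_quad hg).aemeasurable.add (P.aemeasurable_kappa.mul (hu.pow_const 2))

namespace Admissible

variable {σ : Torus d → ℝ} {q τ : ℝ} {β : ℝ≥0∞}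

theorem energy_nonneg (h : P.Admissible σ q τ β) (u : P.energySpace) : 0 ≤ energy u :=
  integral_nonneg_of_ae (h.energyDensity_nonneg _ _)

theorem ofReal_energy (h : P.Admissible σ q τ β) (u : P.energySpace) :
    ENNReal.ofReal (energy u) =
      ∫⁻ x, ENNReal.ofReal (P.energyDensity u.1 (Torus.weakGrad u.1) x) :=
  ofReal_integral_eq_lintegral_ofReal (integrable_energyDensity u) (h.energyDensity_nonneg _ _)

/-- Both parts of the density are nonnegative almost everywhere, so finiteness of the sum makes each
of them integrable. -/
theorem mem_energySpace (h : P.Admissible σ q τ β) {w : Torus d →₁[volume] ℝ}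
    {g : Torus d → Fin d → ℝ} (hw : Torus.HasWeakGrad w g)
    (hfin : ∫⁻ x, ENNReal.ofReal (P.energyDensity w g x) < ∞) : w ∈ P.energySpace := by
  have hgm : ∀ i, AEMeasurable fun x => g x i := fun i => (hw.1 i).aestronglyMeasurable.aemeasurable
  have hwm : AEMeasurable (w : Torus d → ℝ) := (Lp.aestronglyMeasurable w).aemeasurable
  have hE : Integrable (P.energyDensity w g) := by
    refine ⟨(P.aemeasurable_energyDensity hwm hgm).aestronglyMeasurable, ?_⟩
    rw [hasFiniteIntegral_iff_ofReal (h.energyDensity_nonneg _ _)]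
    exact hfin
  refine ⟨g, hw, hE.mono' (P.aestronglyMeasurable_quad hgm) ?_,
    hE.mono' (P.aemeasurable_kappa.mul (hwm.pow_const 2)).aestronglyMeasurable ?_⟩
  · filter_upwards [P.nonneg_A, h.kappa_pos] with x h1 h2
    rw [Real.norm_of_nonneg (h1 _), energyDensity]
    have := mul_nonneg h2.le (sq_nonneg (w x))
    linarith
  · filter_upwards [P.nonneg_A, h.kappa_pos] with x h1 h2
    rw [Real.norm_of_nonneg (mul_nonneg h2.le (sq_nonneg (w x))), energyDensity]
    linarith [h1 (g x)]

/-- The energy controls the `L¹` norm of the gradient. -/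
theorem exists_lintegral_grad_le (h : P.Admissible σ q τ β) :
    ∃ C : ℝ≥0∞, C ≠ ∞ ∧ ∀ g : Torus d → Fin d → ℝ, (∀ i, AEMeasurable fun x => g x i) →
      ∫⁻ x, ‖∑ i, ‖g x i‖‖ₑ ≤
        C * (∫⁻ x, ENNReal.ofReal (g x ⬝ᵥ (P.A x *ᵥ g x))) ^ (1 / 2 : ℝ) := by
  have hq0 : 0 < q := by linarith [h.half_le]
  have hq1 : 0 < 1 - q := by linarith [h.lt_one]
  set W := (∫⁻ x, ENNReal.ofReal (σ x) ^ (q / (q - 1))) ^ ((1 - q) / q) with hW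
  have hWt : W ≠ ∞ := ENNReal.rpow_ne_top_of_nonneg (by positivity) h.lintegral_weight.ne
  refine ⟨(d * W) ^ (1 / 2 : ℝ), ENNReal.rpow_ne_top_of_nonneg (by norm_num)
    (ENNReal.mul_ne_top (ENNReal.natCast_ne_top d) hWt), fun g hg => ?_⟩
  have h1 := h.setLIntegral_grad_rpow_le hg Set.univ
  simp only [setLIntegral_univ] at h1
  have hGm : AEMeasurable (fun x => ‖∑ i, ‖g x i‖‖ₑ) :=
    (Finset.aemeasurable_fun_sum _ fun i _ => (hg i).norm).enorm
  have h2 := lintegral_rpow_le_of_isProbabilityMeasure hGm h.one_le_exponent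
  have h3 : ∀ x, ‖∑ i, ‖g x i‖‖ₑ ^ (2 * q) = ‖(∑ i, ‖g x i‖) ^ (2 * q)‖ₑ := fun x =>
    (Real.enorm_rpow_of_nonneg (Finset.sum_nonneg fun i _ => norm_nonneg _) (by linarith)).symm
  simp only [h3] at h2
  calc ∫⁻ x, ‖∑ i, ‖g x i‖‖ₑ
      = (((∫⁻ x, ‖∑ i, ‖g x i‖‖ₑ) ^ (2 * q)) ^ (1 / q)) ^ (1 / 2 : ℝ) := by
        rw [← ENNReal.rpow_mul, ← ENNReal.rpow_mul,
          show 2 * q * (1 / q * (1 / 2)) = 1 by field_simp, ENNReal.rpow_one]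
    _ ≤ ((d * W) * ∫⁻ x, ENNReal.ofReal (g x ⬝ᵥ (P.A x *ᵥ g x))) ^ (1 / 2 : ℝ) := by
        refine ENNReal.rpow_le_rpow ?_ (by norm_num)
        refine (ENNReal.rpow_le_rpow h2 (by positivity)).trans (h1.trans (le_of_eq ?_))
        rw [hW]; ring
    _ = _ := ENNReal.mul_rpow_of_nonneg _ _ (by norm_num)

/-- The energy controls the `L¹` distance to the mean value. -/
theorem exists_lintegral_sub_average_le (h : P.Admissible σ q τ β) :
    ∃ C : ℝ≥0∞, C ≠ ∞ ∧ ∀ (u : Torus d → ℝ) (g : Torus d → Fin d → ℝ), Integrable u →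
      Torus.HasWeakGrad u g → (Integrable fun x => g x ⬝ᵥ (P.A x *ᵥ g x)) →
      ∫⁻ x, ‖u x - ⨍ y, u y‖ₑ ≤
        C * (∫⁻ x, ENNReal.ofReal (g x ⬝ᵥ (P.A x *ᵥ g x))) ^ (1 / 2 : ℝ) := by
  have hq0 : 0 < q := by linarith [h.half_le]
  have hq1 : 0 < 1 - q := by linarith [h.lt_one]
  set W := (∫⁻ x, ENNReal.ofReal (σ x) ^ (q / (q - 1))) ^ ((1 - q) / q) with hW
  have hWt : W ≠ ∞ := ENNReal.rpow_ne_top_of_nonneg (by positivity) h.lintegral_weight.ne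
  set K := sobolevPoincareConst d (2 * q) ^ 2 * (d * W) with hK
  have hKt : K ≠ ∞ := ENNReal.mul_ne_top
    (ENNReal.pow_ne_top (sobolevPoincareConst_ne_top d (by linarith)))
    (ENNReal.mul_ne_top (ENNReal.natCast_ne_top d) hWt)
  refine ⟨K ^ (1 / 2 : ℝ), ENNReal.rpow_ne_top_of_nonneg (by norm_num) hKt,
    fun u g hu hg hgA => ?_⟩
  -- The whole torus is the tile of side one, so no separate global inequality is needed.
  have huniv : Torus.tile (0 : Fin d → ℝ) 1 = Set.univ :=
    Set.eq_univ_of_forall fun x => Torus.rep_mem x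
  have h1 := h.sobolev_poincare_tile one_pos (le_refl (cube (0 : Fin d → ℝ) 1)) hu hg hgA
  simp only [huniv, Measure.restrict_univ] at h1
  have hS := h.sobolevConj_pos
  have hm : AEMeasurable (fun x => ‖u x - ⨍ y, u y‖ₑ) :=
    (hu.aestronglyMeasurable.aemeasurable.sub_const _).enorm
  have h2 := ENNReal.rpow_le_rpow (lintegral_rpow_le_of_isProbabilityMeasure hm
    h.one_le_sobolevConj) (by positivity : 0 ≤ 1 / sobolevConj d (2 * q))
  rw [← ENNReal.rpow_mul, mul_one_div_cancel hS.ne', ENNReal.rpow_one] at h2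
  have h3 := (pow_le_pow_left₀ zero_le h2 2).trans h1
  rw [← ENNReal.mul_rpow_of_nonneg _ _ (by norm_num)]
  calc ∫⁻ x, ‖u x - ⨍ y, u y‖ₑ = ((∫⁻ x, ‖u x - ⨍ y, u y‖ₑ) ^ 2) ^ (1 / 2 : ℝ) := by
        rw [← ENNReal.rpow_natCast, ← ENNReal.rpow_mul]
        norm_num
    _ ≤ _ := by
        refine ENNReal.rpow_le_rpow (h3.trans (le_of_eq ?_)) (by norm_num)
        rw [hK, hW]; ring

/-- The energy controls the `L¹` norm. -/
theorem exists_lintegral_le (h : P.Admissible σ q τ β) :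
    ∃ C : ℝ≥0∞, C ≠ ∞ ∧ ∀ (u : Torus d → ℝ) (g : Torus d → Fin d → ℝ), Integrable u →
      Torus.HasWeakGrad u g → (Integrable fun x => g x ⬝ᵥ (P.A x *ᵥ g x)) →
      ∫⁻ x, ‖u x‖ₑ ≤ C * (∫⁻ x, ENNReal.ofReal (P.energyDensity u g x)) ^ (1 / 2 : ℝ) := by
  obtain ⟨C, hC, hCb⟩ := h.exists_lintegral_sub_average_le
  -- The truncation `ω` is bounded by `1`, satisfies `ω² ≤ κ` almost everywhere, and has positive
  -- integral because `κ > 0`. It tests the size of the mean value of `u`.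
  set ω : Torus d → ℝ≥0∞ := fun x => ENNReal.ofReal (min (P.kappa x) 1) with hω
  have hωm : AEMeasurable ω := (P.aemeasurable_kappa.min aemeasurable_const).ennreal_ofReal
  have hω1 : ∀ x, ω x ≤ 1 := fun x => ENNReal.ofReal_le_one.2 (min_le_right _ _)
  set I := ∫⁻ x, ω x with hI
  have hI0 : I ≠ 0 := by
    intro h0
    rw [hI, lintegral_eq_zero_iff' hωm] at h0
    have : ∀ᵐ x : Torus d, False := by
      filter_upwards [h0, h.kappa_pos] with x h1 h2
      have h3 : 0 < min (P.kappa x) 1 := lt_min h2 one_pos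
      exact absurd h1 (ENNReal.ofReal_pos.2 h3).ne'
    have h4 := ae_iff.1 this
    simp at h4
  have hIt : I ≠ ∞ := ne_top_of_le_ne_top ENNReal.one_ne_top
    ((lintegral_mono hω1).trans (by simp))
  refine ⟨C + I⁻¹ * (1 + C), ?_, fun u g hu hg hgA => ?_⟩
  · exact ENNReal.add_ne_top.2 ⟨hC, ENNReal.mul_ne_top (ENNReal.inv_ne_top.2 hI0)
      (ENNReal.add_ne_top.2 ⟨ENNReal.one_ne_top, hC⟩)⟩
  set m := ⨍ y, u y with hm
  set E := ∫⁻ x, ENNReal.ofReal (P.energyDensity u g x) with hE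
  have hum : AEMeasurable u := hu.aestronglyMeasurable.aemeasurable
  have hY : ∫⁻ x, ‖u x - m‖ₑ ≤ C * E ^ (1 / 2 : ℝ) := by
    refine (hCb u g hu hg hgA).trans ?_
    gcongr
    refine lintegral_mono_ae ?_
    filter_upwards [h.kappa_pos] with x hx
    refine ENNReal.ofReal_le_ofReal ?_
    rw [energyDensity]
    have := mul_nonneg hx.le (sq_nonneg (u x))
    linarith
  have hX : ∫⁻ x, ω x * ‖u x‖ₑ ≤ E ^ (1 / 2 : ℝ) := by
    have h1 := lintegral_rpow_le_of_isProbabilityMeasure (hωm.mul hum.enorm) one_le_two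
    have h2 : ∫⁻ x, (ω x * ‖u x‖ₑ) ^ (2 : ℝ) ≤ E := by
      refine lintegral_mono_ae ?_
      filter_upwards [P.nonneg_A, h.kappa_pos] with x hA hx
      have hmin : 0 ≤ min (P.kappa x) 1 := le_min hx.le zero_le_one
      rw [hω, ← ofReal_norm, ← ENNReal.ofReal_mul hmin,
        ENNReal.ofReal_rpow_of_nonneg (mul_nonneg hmin (norm_nonneg _)) (by norm_num)]
      refine ENNReal.ofReal_le_ofReal ?_
      rw [energyDensity, Real.rpow_two, mul_pow, Real.norm_eq_abs, sq_abs]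
      have h5 : min (P.kappa x) 1 ^ 2 ≤ P.kappa x := by
        have h6 := min_le_left (P.kappa x) 1
        have h7 := min_le_right (P.kappa x) 1
        nlinarith
      have := mul_le_mul_of_nonneg_right h5 (sq_nonneg (u x))
      linarith [hA (g x)]
    calc _ = ((∫⁻ x, ω x * ‖u x‖ₑ) ^ (2 : ℝ)) ^ (1 / 2 : ℝ) := by
          rw [← ENNReal.rpow_mul]; norm_num
      _ ≤ _ := ENNReal.rpow_le_rpow (h1.trans h2) (by norm_num)
  -- The inequality `|m| ≤ |u| + |u - m|` is integrated against `ω`. The first term is controlled by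
  -- `∫ κ u²` and the second by the Poincaré estimate.
  have hmI : ‖m‖ₑ * I ≤ (1 + C) * E ^ (1 / 2 : ℝ) := by
    have hms : AEMeasurable (fun x => ω x * ‖u x‖ₑ) := hωm.mul hum.enorm
    calc ‖m‖ₑ * I = ∫⁻ x, ‖m‖ₑ * ω x := by
          rw [hI, lintegral_const_mul' _ _ enorm_ne_top]
      _ ≤ ∫⁻ x, (ω x * ‖u x‖ₑ + ‖u x - m‖ₑ) := by
          refine lintegral_mono fun x => ?_
          have h1 : ‖m‖ₑ ≤ ‖u x‖ₑ + ‖u x - m‖ₑ := by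
            rw [← enorm_neg (u x - m)]
            refine le_trans (le_of_eq ?_) (enorm_add_le _ _)
            congr 1; ring
          calc ‖m‖ₑ * ω x ≤ (‖u x‖ₑ + ‖u x - m‖ₑ) * ω x := by gcongr
            _ = ω x * ‖u x‖ₑ + ‖u x - m‖ₑ * ω x := by ring
            _ ≤ _ := by
              gcongr
              exact mul_le_of_le_one_right zero_le (hω1 x)
      _ = (∫⁻ x, ω x * ‖u x‖ₑ) + ∫⁻ x, ‖u x - m‖ₑ := lintegral_add_left' hms _
      _ ≤ _ := by
          rw [add_mul, one_mul]
          exact add_le_add hX hY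
  have hm' : ‖m‖ₑ ≤ I⁻¹ * ((1 + C) * E ^ (1 / 2 : ℝ)) := by
    calc ‖m‖ₑ = I⁻¹ * (‖m‖ₑ * I) := by
          rw [mul_comm, mul_assoc, ENNReal.mul_inv_cancel hI0 hIt, mul_one]
      _ ≤ _ := by gcongr
  calc ∫⁻ x, ‖u x‖ₑ ≤ ∫⁻ x, (‖u x - m‖ₑ + ‖m‖ₑ) := by
        refine lintegral_mono fun x => ?_
        refine le_trans (le_of_eq ?_) (enorm_add_le _ _)
        congr 1; ring
    _ = (∫⁻ x, ‖u x - m‖ₑ) + ‖m‖ₑ := by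
        rw [lintegral_add_right _ measurable_const]; simp
    _ ≤ C * E ^ (1 / 2 : ℝ) + I⁻¹ * ((1 + C) * E ^ (1 / 2 : ℝ)) := add_le_add hY hm'
    _ = _ := by ring

end Admissible
end Coefficients
end

noncomputable section

/-! ### Completeness of the energy space. -/

namespace Coefficients

variable {d : ℕ} {P : Coefficients d}

namespace Admissible

variable {σ : Torus d → ℝ} {q τ : ℝ} {β : ℝ≥0∞}

theorem exists_L1_bound (h : P.Admissible σ q τ β) :
    ∃ C : ℝ≥0∞, C ≠ ∞ ∧ ∀ u : P.energySpace,
      ∫⁻ x, ‖u.1 x‖ₑ ≤ C * ENNReal.ofReal (energy u) ^ (1 / 2 : ℝ) ∧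
      ∀ i, ∫⁻ x, ‖Torus.weakGrad u.1 x i‖ₑ ≤ C * ENNReal.ofReal (energy u) ^ (1 / 2 : ℝ) := by
  obtain ⟨C₁, h1, H1⟩ := h.exists_lintegral_le
  obtain ⟨C₂, h2, H2⟩ := h.exists_lintegral_grad_le
  refine ⟨max C₁ C₂, (max_lt h1.lt_top h2.lt_top).ne, fun u => ⟨?_, fun i => ?_⟩⟩
  · refine (H1 _ _ (integrable_coeFn u) (hasWeakGrad u) (integrable_quad u)).trans ?_
    rw [h.ofReal_energy]
    gcongr
    exact le_max_left _ _
  · have h3 : ∫⁻ x, ‖Torus.weakGrad u.1 x i‖ₑ ≤ ∫⁻ x, ‖∑ i, ‖Torus.weakGrad u.1 x i‖‖ₑ := by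
      refine lintegral_mono fun x => ?_
      rw [← ofReal_norm, ← ofReal_norm]
      refine ENNReal.ofReal_le_ofReal (le_trans ?_ (le_abs_self _))
      exact Finset.single_le_sum (f := fun i => ‖Torus.weakGrad u.1 x i‖)
        (fun i _ => norm_nonneg _) (Finset.mem_univ i)
    refine (h3.trans (H2 _ (aemeasurable_weakGrad u))).trans ?_
    rw [h.ofReal_energy]
    refine mul_le_mul' (le_max_right _ _) (ENNReal.rpow_le_rpow ?_ (by norm_num))
    refine lintegral_mono_ae ?_
    filter_upwards [h.kappa_pos] with x hx
    refine ENNReal.ofReal_le_ofReal ?_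
    rw [energyDensity]
    have := mul_nonneg hx.le (sq_nonneg (u.1 x))
    linarith

/-- If the differences of functions in the energy space are Cauchy for the energy, then they are
Cauchy in `L¹` together with their gradients. -/
theorem exists_L1_limits (h : P.Admissible σ q τ β) {f : ℕ → P.energySpace}
    (hf : ∀ ε > 0, ∃ N, ∀ m ≥ N, ∀ n ≥ N, energy (f m - f n) < ε) :
    ∃ (u : Torus d →₁[volume] ℝ) (g : Torus d → Fin d → ℝ), Torus.HasWeakGrad u g ∧
      Filter.Tendsto (fun n => ∫⁻ x, ‖(f n).1 x - u x‖ₑ) Filter.atTop (nhds 0) ∧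
      ∀ i, Filter.Tendsto (fun n => ∫⁻ x, ‖Torus.weakGrad (f n).1 x i - g x i‖ₑ)
        Filter.atTop (nhds 0) := by
  obtain ⟨C, hC, hCb⟩ := h.exists_L1_bound
  have hsmall : ∀ ε : ℝ≥0∞, ε > 0 → ∃ N, ∀ m ≥ N, ∀ n ≥ N,
      C * ENNReal.ofReal (energy (f m - f n)) ^ (1 / 2 : ℝ) < ε := by
    intro ε hε
    have ht : Filter.Tendsto (fun t : ℝ => C * ENNReal.ofReal t ^ (1 / 2 : ℝ)) (nhds 0)
        (nhds 0) := by
      have h1 : Filter.Tendsto (fun t : ℝ => ENNReal.ofReal t ^ (1 / 2 : ℝ)) (nhds 0)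
          (nhds 0) := by
        have := ((ENNReal.continuous_rpow_const (y := (1 / 2 : ℝ))).comp
          ENNReal.continuous_ofReal).tendsto 0
        simpa [Function.comp_def] using this
      have := ENNReal.Tendsto.const_mul (a := C) h1 (Or.inr hC)
      rwa [mul_zero] at this
    obtain ⟨δ, hδ, hb⟩ := Metric.eventually_nhds_iff.1 (ht.eventually (gt_mem_nhds hε))
    obtain ⟨N, hN⟩ := hf δ hδ
    refine ⟨N, fun m hm n hn => hb ?_⟩
    rw [Real.dist_eq, sub_zero, abs_of_nonneg (h.energy_nonneg _)]
    exact hN m hm n hn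
  have hi := fun n => integrable_coeFn (f n)
  have hgi := fun n => (hasWeakGrad (f n)).1
  have hcu : CauchySeq fun n => (hi n).toL1 _ := by
    refine EMetric.cauchySeq_iff.2 fun ε hε => ?_
    obtain ⟨N, hN⟩ := hsmall ε hε
    refine ⟨N, fun m hm n hn => lt_of_le_of_lt ?_ (hN m hm n hn)⟩
    rw [Integrable.edist_toL1_toL1]
    refine le_trans (le_of_eq (lintegral_congr_ae ?_)) (hCb (f m - f n)).1
    filter_upwards [coeFn_sub_ae (f m) (f n)] with x hx
    rw [hx.1, edist_eq_enorm_sub]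
  have hcg : ∀ i, CauchySeq fun n => (hgi n i).toL1 _ := by
    intro i
    refine EMetric.cauchySeq_iff.2 fun ε hε => ?_
    obtain ⟨N, hN⟩ := hsmall ε hε
    refine ⟨N, fun m hm n hn => lt_of_le_of_lt ?_ (hN m hm n hn)⟩
    rw [Integrable.edist_toL1_toL1]
    refine le_trans (le_of_eq (lintegral_congr_ae ?_)) ((hCb (f m - f n)).2 i)
    filter_upwards [coeFn_sub_ae (f m) (f n)] with x hx
    rw [hx.2, edist_eq_enorm_sub, Pi.sub_apply]
  obtain ⟨u, hu⟩ := cauchySeq_tendsto_of_complete hcu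
  choose γ hγ using fun i => cauchySeq_tendsto_of_complete (hcg i)
  have hlim : ∀ (F : ℕ → Torus d → ℝ) (hF : ∀ n, Integrable (F n)) (w : Torus d →₁[volume] ℝ),
      Filter.Tendsto (fun n => (hF n).toL1 (F n)) Filter.atTop (nhds w) →
      Filter.Tendsto (fun n => ∫⁻ x, ‖F n x - w x‖ₑ) Filter.atTop (nhds 0) := by
    intro F hF w hw
    have := tendsto_iff_edist_tendsto_0.1 hw
    refine this.congr fun n => ?_
    conv_lhs => rw [← Integrable.toL1_coeFn w (L1.integrable_coeFn w)]
    rw [Integrable.edist_toL1_toL1]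
    simp only [edist_eq_enorm_sub]
  refine ⟨u, fun x i => γ i x, ?_, hlim _ hi u hu, fun i => hlim _ (fun n => hgi n i) _ (hγ i)⟩
  exact Torus.HasWeakGrad.of_tendsto (fun n => hasWeakGrad (f n)) hi (L1.integrable_coeFn u)
    (fun i => L1.integrable_coeFn (γ i)) (hlim _ hi u hu)
    fun i => hlim _ (fun n => hgi n i) _ (hγ i)

/-- The energy space is complete. -/
theorem exists_limit (h : P.Admissible σ q τ β) {f : ℕ → P.energySpace}
    (hf : ∀ ε > 0, ∃ N, ∀ m ≥ N, ∀ n ≥ N, energy (f m - f n) < ε) :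
    ∃ u : P.energySpace, ∀ ε > 0, ∃ N, ∀ n ≥ N, energy (f n - u) ≤ ε := by
  obtain ⟨u, g, hug, hu, hg⟩ := h.exists_L1_limits hf
  have hum : AEMeasurable (u : Torus d → ℝ) := (Lp.aestronglyMeasurable u).aemeasurable
  have hgm : ∀ i, AEMeasurable fun x => g x i :=
    fun i => (hug.1 i).aestronglyMeasurable.aemeasurable
  have hfm : ∀ n, AEMeasurable ((f n).1 : Torus d → ℝ) := fun n =>
    (Lp.aestronglyMeasurable _).aemeasurable
  have hDm := fun n => aemeasurable_weakGrad (f n)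
  -- a subsequence along which functions and gradients converge almost everywhere
  obtain ⟨ns, hns, hae⟩ : ∃ ns : ℕ → ℕ, StrictMono ns ∧ ∀ᵐ x,
      Filter.Tendsto (fun k => (f (ns k)).1 x) Filter.atTop (nhds (u x)) ∧
      Filter.Tendsto (fun k => Torus.weakGrad (f (ns k)).1 x) Filter.atTop (nhds (g x)) := by
    set D : ℕ → Torus d → ℝ := fun n x => ‖(f n).1 x - u x‖ +
      ∑ i, ‖Torus.weakGrad (f n).1 x i - g x i‖ with hD
    have hDmeas : ∀ n, AEMeasurable (D n) := fun n =>
      ((hfm n).sub hum).norm.add (Finset.aemeasurable_fun_sum _ fun i _ =>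
        ((hDm n i).sub (hgm i)).norm)
    have hDt : Filter.Tendsto (fun n => eLpNorm (D n - 0) 1 volume) Filter.atTop (nhds 0) := by
      have hsum := hu.add (tendsto_finsetSum Finset.univ fun i _ => hg i)
      simp only [Finset.sum_const_zero, add_zero] at hsum
      refine tendsto_of_tendsto_of_tendsto_of_le_of_le tendsto_const_nhds hsum
        (fun _ => zero_le) fun n => ?_
      simp only [sub_zero, eLpNorm_one_eq_lintegral_enorm]
      have hm1 : AEMeasurable fun x => ‖(f n).1 x - u x‖ₑ := ((hfm n).sub hum).enorm
      have hm2 : ∀ i, AEMeasurable fun x => ‖Torus.weakGrad (f n).1 x i - g x i‖ₑ :=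
        fun i => ((hDm n i).sub (hgm i)).enorm
      rw [← lintegral_finsetSum' _ fun i _ => hm2 i, ← lintegral_add_left' hm1]
      refine lintegral_mono fun x => ?_
      refine (enorm_add_le _ _).trans ?_
      rw [enorm_norm]
      gcongr
      refine (enorm_sum_le _ _).trans (le_of_eq ?_)
      simp only [enorm_norm]
    obtain ⟨ns, hns, hae⟩ := (tendstoInMeasure_of_tendsto_eLpNorm one_ne_zero
      (fun n => (hDmeas n).aestronglyMeasurable) aestronglyMeasurable_zero
      hDt).exists_seq_tendsto_ae
    refine ⟨ns, hns, ?_⟩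
    filter_upwards [hae] with x hx
    have hnn : ∀ k, 0 ≤ ∑ i, ‖Torus.weakGrad (f (ns k)).1 x i - g x i‖ := fun k =>
      Finset.sum_nonneg fun i _ => norm_nonneg _
    refine ⟨?_, tendsto_pi_nhds.2 fun i => ?_⟩
    · refine tendsto_iff_norm_sub_tendsto_zero.2 (squeeze_zero (fun k => norm_nonneg _)
        (fun k => ?_) hx)
      exact le_add_of_nonneg_right (hnn k)
    · refine tendsto_iff_norm_sub_tendsto_zero.2 (squeeze_zero (fun k => norm_nonneg _)
        (fun k => ?_) hx)
      refine le_trans ?_ (le_add_of_nonneg_left (norm_nonneg _))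
      exact Finset.single_le_sum (f := fun i => ‖Torus.weakGrad (f (ns k)).1 x i - g x i‖)
        (fun i _ => norm_nonneg _) (Finset.mem_univ i)
  -- lower semicontinuity of the energy
  have hfatou : ∀ ε > 0, ∃ N, ∀ m ≥ N, ∫⁻ x, ENNReal.ofReal (P.energyDensity
      (fun x => (f m).1 x - u x) (fun x => Torus.weakGrad (f m).1 x - g x) x)
        ≤ ENNReal.ofReal ε := by
    intro ε hε
    obtain ⟨N, hN⟩ := hf ε hε
    refine ⟨N, fun m hm => ?_⟩
    have hmeas : ∀ k, AEMeasurable fun x => ENNReal.ofReal (P.energyDensity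
        (fun x => (f m).1 x - (f (ns k)).1 x)
        (fun x => Torus.weakGrad (f m).1 x - Torus.weakGrad (f (ns k)).1 x) x) := fun k =>
      (P.aemeasurable_energyDensity ((hfm m).sub (hfm _))
        fun i => (hDm m i).sub (hDm _ i)).ennreal_ofReal
    calc _ = ∫⁻ x, Filter.liminf (fun k => ENNReal.ofReal (P.energyDensity
            (fun x => (f m).1 x - (f (ns k)).1 x)
            (fun x => Torus.weakGrad (f m).1 x - Torus.weakGrad (f (ns k)).1 x) x))
            Filter.atTop := by
          refine lintegral_congr_ae ?_
          filter_upwards [hae] with x hx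
          refine (Filter.Tendsto.liminf_eq ?_).symm
          refine ENNReal.tendsto_ofReal ?_
          have hcont : Continuous fun z : ℝ × (Fin d → ℝ) =>
              z.2 ⬝ᵥ (P.A x *ᵥ z.2) + P.kappa x * z.1 ^ 2 := by fun_prop
          exact (hcont.tendsto _).comp ((hx.1.const_sub _).prodMk_nhds (hx.2.const_sub _))
      _ ≤ Filter.liminf (fun k => ∫⁻ x, ENNReal.ofReal (P.energyDensity
            (fun x => (f m).1 x - (f (ns k)).1 x)
            (fun x => Torus.weakGrad (f m).1 x - Torus.weakGrad (f (ns k)).1 x) x))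
            Filter.atTop := lintegral_liminf_le' hmeas
      _ ≤ Filter.liminf (fun _ : ℕ => ENNReal.ofReal ε) Filter.atTop := by
          refine Filter.liminf_le_liminf ?_
          filter_upwards [Filter.eventually_ge_atTop N] with k hk
          refine le_trans (le_of_eq ?_) (ENNReal.ofReal_le_ofReal
            (hN m hm (ns k) (hk.trans (hns.id_le k))).le)
          rw [h.ofReal_energy]
          refine lintegral_congr_ae ?_
          filter_upwards [coeFn_sub_ae (f m) (f (ns k))] with x hx
          rw [energyDensity, energyDensity, hx.1, hx.2]
      _ = _ := Filter.liminf_const _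
  have hsubgrad : ∀ m, ((f m).1 - u : Torus d →₁[volume] ℝ) =ᵐ[volume]
      fun x => (f m).1 x - u x := fun m => Lp.coeFn_sub _ _
  have hgrad : ∀ m, Torus.HasWeakGrad ((f m).1 - u : Torus d →₁[volume] ℝ)
      fun x => Torus.weakGrad (f m).1 x - g x := fun m =>
    ((hasWeakGrad (f m)).sub (integrable_coeFn _) (L1.integrable_coeFn u) hug).congr
      (hsubgrad m).symm
  have heq : ∀ m, ∫⁻ x, ENNReal.ofReal (P.energyDensity ((f m).1 - u : Torus d →₁[volume] ℝ)
      (fun x => Torus.weakGrad (f m).1 x - g x) x) = ∫⁻ x, ENNReal.ofReal (P.energyDensity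
      (fun x => (f m).1 x - u x) (fun x => Torus.weakGrad (f m).1 x - g x) x) := fun m => by
    refine lintegral_congr_ae ?_
    filter_upwards [hsubgrad m] with x hx
    rw [energyDensity, energyDensity, hx]
  obtain ⟨N₀, hN₀⟩ := hfatou 1 one_pos
  have hmem : (f N₀).1 - u ∈ P.energySpace := h.mem_energySpace (hgrad N₀) (by
    rw [heq]; exact lt_of_le_of_lt (hN₀ N₀ le_rfl) ENNReal.ofReal_lt_top)
  -- Fatou's lemma bounds the energy of differences only; `u` is recovered as the difference of `f
  -- N₀` and `f N₀ - u`.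
  have hu' : u ∈ P.energySpace := by
    have := P.energySpace.sub_mem (f N₀).2 hmem
    rwa [sub_sub_cancel] at this
  refine ⟨⟨u, hu'⟩, fun ε hε => ?_⟩
  obtain ⟨N, hN⟩ := hfatou ε hε
  refine ⟨N, fun n hn => ?_⟩
  have h1 := hN n hn
  rw [← heq n] at h1
  refine (ENNReal.ofReal_le_ofReal_iff hε.le).1 (le_trans (le_of_eq ?_) h1)
  rw [h.ofReal_energy]
  refine lintegral_congr_ae ?_
  filter_upwards [Torus.weakGrad_ae_eq (hgrad n)] with x hx
  have e : ((f n - ⟨u, hu'⟩ : P.energySpace)).1 = (f n).1 - u := rfl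
  rw [e, energyDensity, energyDensity, hx]

end Admissible
end Coefficients
end

noncomputable section

/-! ### Abstract solvability in terms of bilinear forms. -/

section AbstractForms

variable {E : Type*} [AddCommGroup E] [Module ℝ E]

theorem apply_inv_sqrt_smul {s : E →ₗ[ℝ] E →ₗ[ℝ] ℝ} {u : E} (h : 0 < s u u) :
    s ((√(s u u))⁻¹ • u) ((√(s u u))⁻¹ • u) = 1 := by
  simp only [map_smul, LinearMap.smul_apply, smul_eq_mul]
  rw [← mul_assoc, ← mul_inv, Real.mul_self_sqrt h.le, inv_mul_cancel₀ h.ne']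

/-- The bound is not homogeneous; applied to `u / √(s u u)`, where `1 + s u u` becomes `2`, it turns
into a genuine operator bound. -/
theorem abs_apply_le_of_le_one_add {s : E →ₗ[ℝ] E →ₗ[ℝ] ℝ} (hnn : ∀ u, 0 ≤ s u u)
    (hdef : ∀ u, s u u = 0 → u = 0) {l : E →ₗ[ℝ] ℝ} {C : ℝ}
    (hl : ∀ u, |l u| ≤ C * (1 + s u u)) (u : E) : |l u| ≤ 2 * C * √(s u u) := by
  rcases (hnn u).eq_or_lt with h0 | h0
  · rw [hdef u h0.symm]; simp
  have hr : 0 < √(s u u) := Real.sqrt_pos.2 h0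
  have h1 := hl ((√(s u u))⁻¹ • u)
  rw [apply_inv_sqrt_smul h0, map_smul, smul_eq_mul, abs_mul, abs_of_pos (inv_pos.2 hr),
    inv_mul_le_iff₀ hr] at h1
  linarith

/-- The same normalisation, made in each variable in turn. The additive hypothesis is the form that
integrating a pointwise Young inequality produces. -/
theorem abs_apply₂_le_of_le_add {s B : E →ₗ[ℝ] E →ₗ[ℝ] ℝ} (hnn : ∀ u, 0 ≤ s u u)
    (hdef : ∀ u, s u u = 0 → u = 0) {C : ℝ}
    (hB : ∀ u v, |B u v| ≤ C * (s u u + s v v)) (u v : E) :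
    |B u v| ≤ 2 * C * √(s u u) * √(s v v) := by
  rcases (hnn u).eq_or_lt with h0 | h0
  · rw [hdef u h0.symm]; simp
  have hr : 0 < √(s u u) := Real.sqrt_pos.2 h0
  have key : ∀ v, |B ((√(s u u))⁻¹ • u) v| ≤ C * (1 + s v v) := fun v => by
    refine (hB _ v).trans (le_of_eq ?_)
    rw [apply_inv_sqrt_smul h0]
  have h1 := abs_apply_le_of_le_one_add hnn hdef key v
  rw [map_smul, LinearMap.smul_apply, smul_eq_mul, abs_mul, abs_of_pos (inv_pos.2 hr),
    inv_mul_le_iff₀ hr] at h1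
  linarith

/-- Unique solvability for a bounded bilinear form on a complete inner product space that is a
finite rank perturbation of a coercive form and has trivial kernel. The inner product is given as a
bilinear form. -/
theorem exists_unique_of_coercive_add_finiteRank (s : E →ₗ[ℝ] E →ₗ[ℝ] ℝ)
    (hsymm : ∀ u v, s u v = s v u) (hnn : ∀ u, 0 ≤ s u u) (hdef : ∀ u, s u u = 0 → u = 0)
    (hcomplete : ∀ f : ℕ → E, (∀ ε > 0, ∃ N, ∀ m ≥ N, ∀ n ≥ N, s (f m - f n) (f m - f n) < ε) →
      ∃ u, ∀ ε > 0, ∃ N, ∀ n ≥ N, s (f n - u) (f n - u) ≤ ε)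
    (B : E →ₗ[ℝ] E →ₗ[ℝ] ℝ) {M : ℝ} (hB : ∀ u v, |B u v| ≤ M * (s u u + s v v))
    {ι : Type*} [Fintype ι] (l m : ι → E →ₗ[ℝ] ℝ)
    (hl : ∀ j, ∃ C, ∀ u, |l j u| ≤ C * (1 + s u u))
    (hm : ∀ j, ∃ C, ∀ u, |m j u| ≤ C * (1 + s u u))
    {c : ℝ} (hc : 0 < c) (hcoer : ∀ u, c * s u u ≤ B u u + ∑ j, l j u * m j u)
    (hinj : ∀ u, (∀ v, B u v = 0) → u = 0) (ζ : E →ₗ[ℝ] ℝ)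
    (hζ : ∃ C, ∀ v, |ζ v| ≤ C * √(s v v)) : ∃! u, ∀ v, B u v = ζ v := by
  -- `E` has no norm of its own here: the energy space inherits one from `L¹`, whereas the relevant
  -- Hilbert structure is the one defined by `s`.
  let core : InnerProductSpace.Core ℝ E :=
    { inner := fun u v => s u v
      conj_inner_symm := fun u v => hsymm v u
      re_inner_nonneg := fun u => hnn u
      add_left := fun u v w => by rw [map_add, LinearMap.add_apply]
      smul_left := fun u v r => by rw [map_smul, LinearMap.smul_apply]; rfl
      definite := fun u hu => hdef u hu }
  let _ : NormedAddCommGroup E := core.toNormedAddCommGroup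
  let _ : InnerProductSpace ℝ E := InnerProductSpace.ofCore core.toCore
  have hnorm : ∀ u : E, ‖u‖ = √(s u u) := fun u => rfl
  have hlt : ∀ (u : E) (ε : ℝ), 0 < ε → (s u u < ε ^ 2 → ‖u‖ < ε) := fun u ε hε h => by
    rw [hnorm, Real.sqrt_lt' hε]; exact h
  have hcs : CompleteSpace E := by
    refine Metric.complete_of_cauchySeq_tendsto fun f hf => ?_
    obtain ⟨u, hu⟩ := hcomplete f fun ε hε => by
      obtain ⟨N, hN⟩ := Metric.cauchySeq_iff.1 hf (√ε) (Real.sqrt_pos.2 hε)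
      refine ⟨N, fun m hm n hn => ?_⟩
      have := hN m hm n hn
      rw [dist_eq_norm, hnorm] at this
      exact (Real.sqrt_lt_sqrt_iff (hnn _)).1 this
    refine ⟨u, Metric.tendsto_atTop.2 fun ε hε => ?_⟩
    obtain ⟨N, hN⟩ := hu (ε ^ 2 / 2) (by positivity)
    refine ⟨N, fun n hn => ?_⟩
    rw [dist_eq_norm]
    refine hlt _ _ hε ((hN n hn).trans_lt ?_)
    have : 0 < ε ^ 2 := by positivity
    linarith
  have hbd : ∀ l : E →ₗ[ℝ] ℝ, (∃ C, ∀ u, |l u| ≤ C * (1 + s u u)) →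
      ∃ L : E →L[ℝ] ℝ, ∀ u, L u = l u := by
    rintro l ⟨C, hC⟩
    exact ⟨l.mkContinuous (2 * C) fun u => abs_apply_le_of_le_one_add hnn hdef hC u, fun u => rfl⟩
  choose L hL using fun j => hbd (l j) (hl j)
  choose M' hM' using fun j => hbd (m j) (hm j)
  obtain ⟨C, hC⟩ := hζ
  let B' : E →L[ℝ] E →L[ℝ] ℝ := LinearMap.mkContinuous₂ B (2 * M) fun u v =>
    abs_apply₂_le_of_le_add hnn hdef hB u v
  let ζ' : E →L[ℝ] ℝ := ζ.mkContinuous C hC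
  refine exists_unique_of_coercive_sub_finiteRank B' L M' hc (fun u => ?_) hinj ζ'
  simp only [hL, hM']
  refine le_trans (le_of_eq ?_) (hcoer u)
  rw [mul_assoc, hnorm, Real.mul_self_sqrt (hnn u)]

end AbstractForms

/-! ### The weak form and the inner product on the energy space; Gårding's inequality. -/

namespace Coefficients

variable {d : ℕ} {P : Coefficients d}

/-- The value and the weak gradient of a function in the energy space. -/
def jet (u : P.energySpace) (x : Torus d) : ℝ × (Fin d → ℝ) := (u.1 x, Torus.weakGrad u.1 x)

theorem jet_add (u v : P.energySpace) : ∀ᵐ x, jet (u + v) x = jet u x + jet v x := by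
  filter_upwards [coeFn_add_ae u v] with x hx
  exact Prod.ext hx.1 hx.2

theorem jet_smul (r : ℝ) (u : P.energySpace) : ∀ᵐ x, jet (r • u) x = r • jet u x := by
  filter_upwards [coeFn_smul_ae r u] with x hx
  exact Prod.ext hx.1 hx.2

/-- The bilinear form on the energy space with the given density. -/
def integralForm (D : Torus d → (ℝ × (Fin d → ℝ)) →ₗ[ℝ] (ℝ × (Fin d → ℝ)) →ₗ[ℝ] ℝ)
    (hD : ∀ u v : P.energySpace, Integrable fun x => D x (jet u x) (jet v x)) :
    P.energySpace →ₗ[ℝ] P.energySpace →ₗ[ℝ] ℝ :=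
  LinearMap.mk₂ ℝ (fun u v => ∫ x, D x (jet u x) (jet v x))
    (fun u u' v => by
      rw [← integral_add (hD u v) (hD u' v)]
      refine integral_congr_ae ?_
      filter_upwards [jet_add u u'] with x hx
      rw [hx, map_add, LinearMap.add_apply])
    (fun r u v => by
      rw [smul_eq_mul, ← integral_const_mul]
      refine integral_congr_ae ?_
      filter_upwards [jet_smul r u] with x hx
      rw [hx, map_smul, LinearMap.smul_apply, smul_eq_mul])
    (fun u v v' => by
      rw [← integral_add (hD u v) (hD u v')]
      refine integral_congr_ae ?_
      filter_upwards [jet_add v v'] with x hx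
      rw [hx, map_add])
    (fun r u v => by
      rw [smul_eq_mul, ← integral_const_mul]
      refine integral_congr_ae ?_
      filter_upwards [jet_smul r v] with x hx
      rw [hx, map_smul, smul_eq_mul])

/-- The linear functional `u ↦ ∫ w u` on the energy space. -/
def integralFunctional (w : Torus d → ℝ)
    (hw : ∀ u : P.energySpace, Integrable fun x => w x * u.1 x) : P.energySpace →ₗ[ℝ] ℝ where
  toFun u := ∫ x, w x * u.1 x
  map_add' u v := by
    rw [← integral_add (hw u) (hw v)]
    refine integral_congr_ae ?_
    filter_upwards [coeFn_add_ae u v] with x hx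
    rw [hx.1, mul_add]
  map_smul' r u := by
    rw [RingHom.id_apply, smul_eq_mul, ← integral_const_mul]
    refine integral_congr_ae ?_
    filter_upwards [coeFn_smul_ae r u] with x hx
    rw [hx.1]
    ring

variable (P) in
/-- The density of the weak form of `L`. -/
def weakDensity (x : Torus d) : (ℝ × (Fin d → ℝ)) →ₗ[ℝ] (ℝ × (Fin d → ℝ)) →ₗ[ℝ] ℝ :=
  LinearMap.mk₂ ℝ (fun y z => z.2 ⬝ᵥ (P.A x *ᵥ y.2) - y.1 * (P.c x ⬝ᵥ z.2)
      + z.1 * (P.b x ⬝ᵥ y.2) - P.a x * y.1 * z.1)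
    (fun y y' z => by simp [Matrix.mulVec_add]; ring)
    (fun r y z => by simp [Matrix.mulVec_smul]; ring)
    (fun y z z' => by simp; ring)
    (fun r y z => by simp; ring)

variable (P) in
/-- The density of the inner product of the energy space. -/
def innerDensity (x : Torus d) : (ℝ × (Fin d → ℝ)) →ₗ[ℝ] (ℝ × (Fin d → ℝ)) →ₗ[ℝ] ℝ :=
  LinearMap.mk₂ ℝ (fun y z => 2⁻¹ * (z.2 ⬝ᵥ (P.A x *ᵥ y.2) + y.2 ⬝ᵥ (P.A x *ᵥ z.2))
      + P.kappa x * y.1 * z.1)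
    (fun y y' z => by simp [Matrix.mulVec_add]; ring)
    (fun r y z => by simp [Matrix.mulVec_smul]; ring)
    (fun y z z' => by simp [Matrix.mulVec_add]; ring)
    (fun r y z => by simp [Matrix.mulVec_smul]; ring)

theorem weakDensity_apply (x : Torus d) (y z : ℝ × (Fin d → ℝ)) :
    P.weakDensity x y z = z.2 ⬝ᵥ (P.A x *ᵥ y.2) - y.1 * (P.c x ⬝ᵥ z.2)
      + z.1 * (P.b x ⬝ᵥ y.2) - P.a x * y.1 * z.1 := rfl

theorem innerDensity_apply (x : Torus d) (y z : ℝ × (Fin d → ℝ)) :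
    P.innerDensity x y z = 2⁻¹ * (z.2 ⬝ᵥ (P.A x *ᵥ y.2) + y.2 ⬝ᵥ (P.A x *ᵥ z.2))
      + P.kappa x * y.1 * z.1 := rfl

theorem aemeasurable_dotProduct_mulVec {g k : Torus d → Fin d → ℝ}
    (hg : ∀ i, AEMeasurable fun x => g x i) (hk : ∀ i, AEMeasurable fun x => k x i) :
    AEMeasurable fun x => g x ⬝ᵥ (P.A x *ᵥ k x) := by
  simp only [dotProduct, Matrix.mulVec]
  refine Finset.aemeasurable_fun_sum _ fun i _ => (hg i).mul ?_
  exact Finset.aemeasurable_fun_sum _ fun j _ => (P.aemeasurable_A i j).mul (hk j)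

theorem aemeasurable_dotProduct {g k : Torus d → Fin d → ℝ}
    (hg : ∀ i, AEMeasurable fun x => g x i) (hk : ∀ i, AEMeasurable fun x => k x i) :
    AEMeasurable fun x => g x ⬝ᵥ k x := by
  simp only [dotProduct]
  exact Finset.aemeasurable_fun_sum _ fun i _ => (hg i).mul (hk i)

theorem aemeasurable_coeFn (u : P.energySpace) : AEMeasurable (u.1 : Torus d → ℝ) :=
  (integrable_coeFn u).aestronglyMeasurable.aemeasurable

theorem aestronglyMeasurable_weakDensity (u v : P.energySpace) :
    AEStronglyMeasurable fun x => P.weakDensity x (jet u x) (jet v x) := by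
  have hu := aemeasurable_coeFn u
  have hv := aemeasurable_coeFn v
  have hDu := aemeasurable_weakGrad u
  have hDv := aemeasurable_weakGrad v
  exact ((((aemeasurable_dotProduct_mulVec hDv hDu).sub
    (hu.mul (aemeasurable_dotProduct P.aemeasurable_c hDv))).add
    (hv.mul (aemeasurable_dotProduct P.aemeasurable_b hDu))).sub
    ((P.aemeasurable_a.mul hu).mul hv)).aestronglyMeasurable

theorem aestronglyMeasurable_innerDensity (u v : P.energySpace) :
    AEStronglyMeasurable fun x => P.innerDensity x (jet u x) (jet v x) := by
  have hu := aemeasurable_coeFn u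
  have hv := aemeasurable_coeFn v
  have hDu := aemeasurable_weakGrad u
  have hDv := aemeasurable_weakGrad v
  exact ((((aemeasurable_dotProduct_mulVec hDv hDu).add
    (aemeasurable_dotProduct_mulVec hDu hDv)).const_mul _).add
    ((P.aemeasurable_kappa.mul hu).mul hv)).aestronglyMeasurable

theorem abs_le_half_add_of_sq_le_mul {t a b : ℝ} (ha : 0 ≤ a) (hb : 0 ≤ b) (h : t ^ 2 ≤ a * b) :
    |t| ≤ (a + b) / 2 := by
  refine abs_le_of_sq_le_sq (h.trans ?_) (by linarith)
  nlinarith [sq_nonneg (a - b)]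

/-- The pointwise bounds on the lower order coefficients in terms of `κ`. -/
structure PointwiseBounds (P : Coefficients d) (τ : ℝ) (x : Torus d) : Prop where
  kappa_nonneg : 0 ≤ P.kappa x
  quad_nonneg : ∀ ξ, 0 ≤ ξ ⬝ᵥ (P.A x *ᵥ ξ)
  form_sq_le : ∀ η ξ, (η ⬝ᵥ (P.A x *ᵥ ξ)) ^ 2 ≤
    (ξ ⬝ᵥ (P.A x *ᵥ ξ)) * (τ * (η ⬝ᵥ (P.A x *ᵥ η)))
  b_sq_le : ∀ ξ, (P.b x ⬝ᵥ ξ) ^ 2 ≤ P.kappa x * (τ * (ξ ⬝ᵥ (P.A x *ᵥ ξ)))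
  c_sq_le : ∀ ξ, (P.c x ⬝ᵥ ξ) ^ 2 ≤ P.kappa x * (τ * (ξ ⬝ᵥ (P.A x *ᵥ ξ)))
  abs_a_le : |P.a x| ≤ P.kappa x

namespace PointwiseBounds

variable {τ : ℝ} {x : Torus d}

theorem abs_zero_order_le (h : P.PointwiseBounds τ x) (s t : ℝ) :
    |P.a x * s * t| ≤ (P.kappa x * s ^ 2 + P.kappa x * t ^ 2) / 2 := by
  refine abs_le_half_add_of_sq_le_mul (mul_nonneg h.kappa_nonneg (sq_nonneg _))
    (mul_nonneg h.kappa_nonneg (sq_nonneg _)) ?_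
  have h1 : P.a x ^ 2 ≤ P.kappa x ^ 2 := sq_le_sq.2 (h.abs_a_le.trans (le_abs_self _))
  have := mul_le_mul_of_nonneg_right h1 (sq_nonneg (s * t))
  nlinarith

/-- Young's inequality with a free parameter: `r = 1` serves for boundedness and `r = 2τ` for
Gårding's inequality. -/
theorem abs_first_order_le (h : P.PointwiseBounds τ x) (hτ : 0 < τ) {w : Fin d → ℝ}
    (hw : ∀ ξ, (w ⬝ᵥ ξ) ^ 2 ≤ P.kappa x * (τ * (ξ ⬝ᵥ (P.A x *ᵥ ξ)))) (s : ℝ) (ξ : Fin d → ℝ)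
    {r : ℝ} (hr : 0 < r) :
    |s * (w ⬝ᵥ ξ)| ≤ (r * (P.kappa x * s ^ 2) + τ / r * (ξ ⬝ᵥ (P.A x *ᵥ ξ))) / 2 := by
  refine abs_le_half_add_of_sq_le_mul
    (mul_nonneg hr.le (mul_nonneg h.kappa_nonneg (sq_nonneg _)))
    (mul_nonneg (by positivity) (h.quad_nonneg ξ)) ?_
  have h1 := mul_le_mul_of_nonneg_left (hw ξ) (sq_nonneg s)
  calc (s * (w ⬝ᵥ ξ)) ^ 2 = s ^ 2 * (w ⬝ᵥ ξ) ^ 2 := by ring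
    _ ≤ _ := h1
    _ = _ := by field_simp

theorem abs_second_order_le (h : P.PointwiseBounds τ x) (hτ : 0 < τ) (η ξ : Fin d → ℝ) :
    |η ⬝ᵥ (P.A x *ᵥ ξ)| ≤ (ξ ⬝ᵥ (P.A x *ᵥ ξ) + τ * (η ⬝ᵥ (P.A x *ᵥ η))) / 2 :=
  abs_le_half_add_of_sq_le_mul (h.quad_nonneg ξ) (mul_nonneg hτ.le (h.quad_nonneg η))
    (h.form_sq_le η ξ)

theorem abs_weakDensity_le (h : P.PointwiseBounds τ x) (hτ : 0 < τ) (y z : ℝ × (Fin d → ℝ)) :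
    |P.weakDensity x y z| ≤ (1 + τ) * ((y.2 ⬝ᵥ (P.A x *ᵥ y.2) + P.kappa x * y.1 ^ 2) +
      (z.2 ⬝ᵥ (P.A x *ᵥ z.2) + P.kappa x * z.1 ^ 2)) := by
  have h1 := abs_le.1 (h.abs_second_order_le hτ z.2 y.2)
  have h2 := abs_le.1 (h.abs_first_order_le hτ h.c_sq_le y.1 z.2 one_pos)
  have h3 := abs_le.1 (h.abs_first_order_le hτ h.b_sq_le z.1 y.2 one_pos)
  have h4 := abs_le.1 (h.abs_zero_order_le y.1 z.1)
  have e1 := h.quad_nonneg y.2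
  have e2 := h.quad_nonneg z.2
  have e3 := mul_nonneg h.kappa_nonneg (sq_nonneg y.1)
  have e4 := mul_nonneg h.kappa_nonneg (sq_nonneg z.1)
  rw [weakDensity_apply]
  generalize z.2 ⬝ᵥ (P.A x *ᵥ y.2) = t1 at *
  generalize y.1 * (P.c x ⬝ᵥ z.2) = t2 at *
  generalize z.1 * (P.b x ⬝ᵥ y.2) = t3 at *
  generalize P.a x * y.1 * z.1 = t4 at *
  generalize y.2 ⬝ᵥ (P.A x *ᵥ y.2) = q1 at *
  generalize z.2 ⬝ᵥ (P.A x *ᵥ z.2) = q2 at *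
  generalize P.kappa x * y.1 ^ 2 = k1 at *
  generalize P.kappa x * z.1 ^ 2 = k2 at *
  have m1 := mul_nonneg hτ.le e1
  have m2 := mul_nonneg hτ.le e2
  have m3 := mul_nonneg hτ.le e3
  have m4 := mul_nonneg hτ.le e4
  simp only [div_one] at h2 h3
  rw [abs_le]
  constructor <;> nlinarith

theorem abs_innerDensity_le (h : P.PointwiseBounds τ x) (hτ : 0 < τ) (y z : ℝ × (Fin d → ℝ)) :
    |P.innerDensity x y z| ≤ (1 + τ) * ((y.2 ⬝ᵥ (P.A x *ᵥ y.2) + P.kappa x * y.1 ^ 2) +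
      (z.2 ⬝ᵥ (P.A x *ᵥ z.2) + P.kappa x * z.1 ^ 2)) := by
  have h1 := abs_le.1 (h.abs_second_order_le hτ z.2 y.2)
  have h2 := abs_le.1 (h.abs_second_order_le hτ y.2 z.2)
  have h4 : |P.kappa x * y.1 * z.1| ≤ (P.kappa x * y.1 ^ 2 + P.kappa x * z.1 ^ 2) / 2 :=
    abs_le_half_add_of_sq_le_mul (mul_nonneg h.kappa_nonneg (sq_nonneg _))
      (mul_nonneg h.kappa_nonneg (sq_nonneg _)) (le_of_eq (by ring))
  replace h4 := abs_le.1 h4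
  have e1 := h.quad_nonneg y.2
  have e2 := h.quad_nonneg z.2
  have e3 := mul_nonneg h.kappa_nonneg (sq_nonneg y.1)
  have e4 := mul_nonneg h.kappa_nonneg (sq_nonneg z.1)
  rw [innerDensity_apply]
  generalize z.2 ⬝ᵥ (P.A x *ᵥ y.2) = t1 at *
  generalize y.2 ⬝ᵥ (P.A x *ᵥ z.2) = t2 at *
  generalize P.kappa x * y.1 * z.1 = t4 at *
  generalize y.2 ⬝ᵥ (P.A x *ᵥ y.2) = q1 at *
  generalize z.2 ⬝ᵥ (P.A x *ᵥ z.2) = q2 at *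
  generalize P.kappa x * y.1 ^ 2 = k1 at *
  generalize P.kappa x * z.1 ^ 2 = k2 at *
  have m1 := mul_nonneg hτ.le e1
  have m2 := mul_nonneg hτ.le e2
  have m3 := mul_nonneg hτ.le e3
  have m4 := mul_nonneg hτ.le e4
  rw [abs_le]
  constructor <;> nlinarith

/-- The pointwise Gårding inequality. -/
theorem le_weakDensity_self (h : P.PointwiseBounds τ x) (hτ : 0 < τ) (y : ℝ × (Fin d → ℝ)) :
    2⁻¹ * (y.2 ⬝ᵥ (P.A x *ᵥ y.2)) - (2 * τ + 1) * (P.kappa x * y.1 ^ 2) ≤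
      P.weakDensity x y y := by
  -- With `r = 2τ` each first-order term costs a quarter of the quadratic form and `τ κ y₁²`. Two of
  -- them and the zeroth-order term leave half of the form and the constant `2τ + 1`.
  have hr : 0 < 2 * τ := by positivity
  have h2 := abs_le.1 (h.abs_first_order_le hτ h.c_sq_le y.1 y.2 hr)
  have h3 := abs_le.1 (h.abs_first_order_le hτ h.b_sq_le y.1 y.2 hr)
  have h4 := abs_le.1 (h.abs_zero_order_le y.1 y.1)
  have e : τ / (2 * τ) = 1 / 2 := by field_simp
  rw [e] at h2 h3
  rw [weakDensity_apply]
  linarith [h2.2, h3.1, h4.2]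

end PointwiseBounds

namespace Admissible

variable {σ : Torus d → ℝ} {q τ : ℝ} {β : ℝ≥0∞}

/-- The three summands of `κ` are nonnegative because `A⁻¹` inherits positivity from `A`; hence each
of them is at most `κ`. -/
theorem pointwiseBounds (h : P.Admissible σ q τ β) : ∀ᵐ x, P.PointwiseBounds τ x := by
  filter_upwards [h.quad_pos, h.comparable, h.kappa_pos, P.nonneg_A] with x h1 h2 h3 h4
  have hb := quad_inv_nonneg h1 (P.b x)
  have hc := quad_inv_nonneg h1 (P.c x)
  have ha := abs_nonneg (P.a x)
  have hτ := h.tau_pos.le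
  have hk : P.kappa x = P.c x ⬝ᵥ ((P.A x)⁻¹ *ᵥ P.c x) + P.b x ⬝ᵥ ((P.A x)⁻¹ *ᵥ P.b x)
    + |P.a x| := rfl
  refine ⟨h3.le, h4, form_sq_le_quad_mul_quad h1 h2, fun ξ => ?_, fun ξ => ?_, by linarith⟩
  · refine (dotProduct_sq_le_quad_inv_mul h1 h2 _ ξ).trans ?_
    exact mul_le_mul_of_nonneg_right (by linarith) (mul_nonneg hτ (h4 ξ))
  · refine (dotProduct_sq_le_quad_inv_mul h1 h2 _ ξ).trans ?_
    exact mul_le_mul_of_nonneg_right (by linarith) (mul_nonneg hτ (h4 ξ))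

theorem abs_weakDensity_le (h : P.Admissible σ q τ β) (u v : P.energySpace) :
    ∀ᵐ x, |P.weakDensity x (jet u x) (jet v x)| ≤
      (1 + τ) * (P.energyDensity u.1 (Torus.weakGrad u.1) x +
        P.energyDensity v.1 (Torus.weakGrad v.1) x) := by
  filter_upwards [h.pointwiseBounds] with x hx
  exact hx.abs_weakDensity_le h.tau_pos _ _

theorem integrable_weakDensity (h : P.Admissible σ q τ β) (u v : P.energySpace) :
    Integrable fun x => P.weakDensity x (jet u x) (jet v x) :=
  (((integrable_energyDensity u).add (integrable_energyDensity v)).const_mul (1 + τ)).mono'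
    (aestronglyMeasurable_weakDensity u v) (h.abs_weakDensity_le u v)

theorem integrable_innerDensity (h : P.Admissible σ q τ β) (u v : P.energySpace) :
    Integrable fun x => P.innerDensity x (jet u x) (jet v x) := by
  refine (((integrable_energyDensity u).add (integrable_energyDensity v)).const_mul (1 + τ)).mono'
    (aestronglyMeasurable_innerDensity u v) ?_
  filter_upwards [h.pointwiseBounds] with x hx
  exact hx.abs_innerDensity_le h.tau_pos _ _

/-- The weak form of `L` as a bilinear form. -/
def weakForm (h : P.Admissible σ q τ β) : P.energySpace →ₗ[ℝ] P.energySpace →ₗ[ℝ] ℝ :=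
  integralForm P.weakDensity h.integrable_weakDensity

/-- The inner product of the energy space as a bilinear form. -/
def innerForm (h : P.Admissible σ q τ β) : P.energySpace →ₗ[ℝ] P.energySpace →ₗ[ℝ] ℝ :=
  integralForm P.innerDensity h.integrable_innerDensity

theorem innerForm_symm (h : P.Admissible σ q τ β) (u v : P.energySpace) :
    h.innerForm u v = h.innerForm v u := by
  change (∫ x, P.innerDensity x (jet u x) (jet v x)) = ∫ x, P.innerDensity x (jet v x) (jet u x)
  refine integral_congr_ae (Filter.Eventually.of_forall fun x => ?_)
  simp only [innerDensity_apply]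
  ring

theorem innerForm_self (h : P.Admissible σ q τ β) (u : P.energySpace) :
    h.innerForm u u = energy u := by
  change (∫ x, P.innerDensity x (jet u x) (jet u x)) = _
  refine integral_congr_ae (Filter.Eventually.of_forall fun x => ?_)
  simp only [innerDensity_apply, energyDensity, jet]
  ring

theorem eq_zero_of_energy_eq_zero (h : P.Admissible σ q τ β) {u : P.energySpace}
    (hu : energy u = 0) : u = 0 := by
  have h1 := (integral_eq_zero_iff_of_nonneg_ae (h.energyDensity_nonneg _ _)
    (integrable_energyDensity u)).1 hu
  refine Subtype.ext (Lp.ext ?_)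
  have h0 := Lp.coeFn_zero ℝ 1 (volume : Measure (Torus d))
  filter_upwards [h1, h.kappa_pos, P.nonneg_A, h0] with x hx hk hA hz
  change u.1 x = (0 : Torus d →₁[volume] ℝ) x
  rw [hz]
  simp only [energyDensity, Pi.zero_apply] at hx ⊢
  have h2 := hA (Torus.weakGrad u.1 x)
  have h3 : P.kappa x * u.1 x ^ 2 = 0 :=
    le_antisymm (by linarith) (mul_nonneg hk.le (sq_nonneg _))
  exact pow_eq_zero_iff two_ne_zero |>.1 ((mul_eq_zero.1 h3).resolve_left hk.ne')

theorem abs_weakForm_le (h : P.Admissible σ q τ β) (u v : P.energySpace) :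
    |h.weakForm u v| ≤ (1 + τ) * (energy u + energy v) := by
  have e : (1 + τ) * (energy u + energy v) = ∫ x, (1 + τ) *
      (P.energyDensity u.1 (Torus.weakGrad u.1) x + P.energyDensity v.1 (Torus.weakGrad v.1) x) := by
    rw [integral_const_mul, integral_add (integrable_energyDensity u) (integrable_energyDensity v)]
    rfl
  rw [e]
  refine (abs_integral_le_integral_abs).trans ?_
  exact integral_mono_ae (h.integrable_weakDensity u v).abs
    (((integrable_energyDensity u).add (integrable_energyDensity v)).const_mul (1 + τ))
    (h.abs_weakDensity_le u v)

theorem integrable_kappa (h : P.Admissible σ q τ β) : Integrable P.kappa :=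
  h.kappa_memLp.integrable h.one_le

theorem integrable_kappa_mul (h : P.Admissible σ q τ β) (u : P.energySpace) :
    Integrable fun x => P.kappa x * u.1 x := by
  refine (h.integrable_kappa.add (integrable_kappa_sq u)).mono'
    (P.aemeasurable_kappa.mul (aemeasurable_coeFn u)).aestronglyMeasurable ?_
  filter_upwards [h.kappa_pos] with x hx
  rw [norm_mul, Real.norm_of_nonneg hx.le, Pi.add_apply, Real.norm_eq_abs]
  -- Multiplied by `κ`, this bounds `κ |u|` by `κ + κ u²`, and `κ` itself is integrable since `β ≥
  -- 1`.
  have h1 : |u.1 x| ≤ 1 + u.1 x ^ 2 := by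
    rw [← sq_abs]
    nlinarith [abs_nonneg (u.1 x), sq_nonneg (|u.1 x| - 1)]
  nlinarith [mul_le_mul_of_nonneg_left h1 hx.le]

theorem integral_kappa_sq_le_energy (u : P.energySpace) :
    ∫ x, P.kappa x * u.1 x ^ 2 ≤ energy u := by
  refine integral_mono_ae (integrable_kappa_sq u) (integrable_energyDensity u) ?_
  filter_upwards [P.nonneg_A] with x hx
  simp only [energyDensity]
  linarith [hx (Torus.weakGrad u.1 x)]

theorem energy_eq (u : P.energySpace) : energy u =
    (∫ x, Torus.weakGrad u.1 x ⬝ᵥ (P.A x *ᵥ Torus.weakGrad u.1 x)) +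
      ∫ x, P.kappa x * u.1 x ^ 2 :=
  integral_add (integrable_quad u) (integrable_kappa_sq u)

/-- Gårding's inequality. -/
theorem le_weakForm_self (h : P.Admissible σ q τ β) (u : P.energySpace) :
    2⁻¹ * (∫ x, Torus.weakGrad u.1 x ⬝ᵥ (P.A x *ᵥ Torus.weakGrad u.1 x)) -
      (2 * τ + 1) * (∫ x, P.kappa x * u.1 x ^ 2) ≤ h.weakForm u u := by
  rw [← integral_const_mul, ← integral_const_mul, ← integral_sub
    ((integrable_quad u).const_mul _) ((integrable_kappa_sq u).const_mul _)]
  refine integral_mono_ae (((integrable_quad u).const_mul _).sub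
    ((integrable_kappa_sq u).const_mul _)) (h.integrable_weakDensity u u) ?_
  filter_upwards [h.pointwiseBounds] with x hx
  exact hx.le_weakDensity_self h.tau_pos (jet u x)

end Admissible
end Coefficients
end

noncomputable section

/-! ### Coercivity up to finite rank and conclusion. -/

namespace Coefficients

variable {d : ℕ} {P : Coefficients d}

/-- The functional `u ↦ ∫_s w u` on the energy space. -/
def setFunctional {s : Set (Torus d)} (hs : MeasurableSet s) (w : Torus d → ℝ)
    (hw : ∀ u : P.energySpace, Integrable fun x => w x * u.1 x) : P.energySpace →ₗ[ℝ] ℝ :=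
  integralFunctional (s.indicator w) fun u => by
    refine ((hw u).indicator hs).congr (Filter.Eventually.of_forall fun x => ?_)
    exact Set.indicator_mul_left s w _

theorem setFunctional_apply {s : Set (Torus d)} (hs : MeasurableSet s) (w : Torus d → ℝ)
    (hw : ∀ u : P.energySpace, Integrable fun x => w x * u.1 x) (u : P.energySpace) :
    setFunctional hs w hw u = ∫ x in s, w x * u.1 x := by
  change ∫ x, s.indicator w x * u.1 x = _
  rw [← integral_indicator hs]
  simp only [Set.indicator_mul_left]

theorem abs_setFunctional_le {s : Set (Torus d)} (hs : MeasurableSet s) (w : Torus d → ℝ)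
    (hw : ∀ u : P.energySpace, Integrable fun x => w x * u.1 x) (u : P.energySpace) :
    |setFunctional hs w hw u| ≤ ∫ x, |w x * u.1 x| := by
  rw [setFunctional_apply]
  exact abs_integral_le_integral_abs.trans
    (setIntegral_le_integral (hw u).abs (Filter.Eventually.of_forall fun x => abs_nonneg _))

/-- Pointwise, `2cu = u² + c² - (u - c)² ≥ u² - (u - c)²`. Any constant `c` is allowed, so the plain
average that Poincaré provides can be used rather than the one weighted by `κ`. -/
theorem half_setIntegral_sub_le {α : Type*} [MeasurableSpace α] {μ : Measure α} {s : Set α}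
    {κ u : α → ℝ} (c : ℝ) (hκ : Integrable κ μ) (hκ0 : ∀ᵐ x ∂μ, 0 ≤ κ x)
    (h1 : Integrable (fun x => κ x * u x) μ) (h2 : Integrable (fun x => κ x * u x ^ 2) μ) :
    2⁻¹ * (∫ x in s, κ x * u x ^ 2 ∂μ) - 2⁻¹ * (∫⁻ x in s, ‖κ x * (u x - c) ^ 2‖ₑ ∂μ).toReal ≤
      c * ∫ x in s, κ x * u x ∂μ := by
  have h3 : Integrable (fun x => κ x * (u x - c) ^ 2) μ := by
    refine ((h2.sub (h1.const_mul (2 * c))).add (hκ.const_mul (c ^ 2))).congr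
      (Filter.Eventually.of_forall fun x => ?_)
    simp only [Pi.add_apply, Pi.sub_apply]
    ring
  have e : ∫ x in s, κ x * (u x - c) ^ 2 ∂μ =
      (∫⁻ x in s, ‖κ x * (u x - c) ^ 2‖ₑ ∂μ).toReal := by
    rw [← integral_norm_eq_lintegral_enorm h3.restrict.aestronglyMeasurable]
    refine integral_congr_ae ?_
    filter_upwards [ae_restrict_of_ae hκ0] with x hx
    rw [Real.norm_of_nonneg (mul_nonneg hx (sq_nonneg _))]
  rw [← e, ← integral_const_mul, ← integral_const_mul, ← integral_const_mul,
    ← integral_sub (h2.restrict.const_mul _) (h3.restrict.const_mul _)]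
  refine integral_mono_ae ((h2.restrict.const_mul _).sub (h3.restrict.const_mul _))
    (h1.restrict.const_mul _) ?_
  filter_upwards [ae_restrict_of_ae hκ0] with x hx
  nlinarith [mul_nonneg hx (sq_nonneg c)]

namespace Admissible

variable {σ : Torus d → ℝ} {q τ : ℝ} {β : ℝ≥0∞}

theorem exists_integral_abs_le (h : P.Admissible σ q τ β) :
    ∃ C, ∀ u : P.energySpace, ∫ x, |u.1 x| ≤ C * (1 + energy u) := by
  obtain ⟨C, hC, H⟩ := h.exists_L1_bound
  refine ⟨C.toReal, fun u => ?_⟩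
  have hE := h.energy_nonneg u
  have h1 : ∫ x, |u.1 x| = (∫⁻ x, ‖u.1 x‖ₑ).toReal :=
    integral_norm_eq_lintegral_enorm (integrable_coeFn u).aestronglyMeasurable
  rw [h1]
  refine (ENNReal.toReal_mono (ENNReal.mul_ne_top hC
    (ENNReal.rpow_ne_top_of_nonneg (by norm_num) ENNReal.ofReal_ne_top)) (H u).1).trans ?_
  rw [ENNReal.toReal_mul, ← ENNReal.toReal_rpow, ENNReal.toReal_ofReal hE, ← Real.sqrt_eq_rpow]
  refine mul_le_mul_of_nonneg_left (Real.sqrt_le_iff.2 ⟨by linarith, ?_⟩) ENNReal.toReal_nonneg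
  nlinarith

theorem integral_abs_kappa_mul_le (h : P.Admissible σ q τ β) (u : P.energySpace) :
    ∫ x, |P.kappa x * u.1 x| ≤ ((∫ x, P.kappa x) + 1) * (1 + energy u) := by
  have hκ : 0 ≤ ∫ x, P.kappa x := integral_nonneg_of_ae (h.kappa_pos.mono fun x hx => hx.le)
  have hE := h.energy_nonneg u
  calc ∫ x, |P.kappa x * u.1 x| ≤ ∫ x, (P.kappa x + P.kappa x * u.1 x ^ 2) := by
        refine integral_mono_ae (h.integrable_kappa_mul u).abs
          (h.integrable_kappa.add (integrable_kappa_sq u)) ?_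
        filter_upwards [h.kappa_pos] with x hx
        have h1 : |u.1 x| ≤ 1 + u.1 x ^ 2 := by
          rw [← sq_abs]
          nlinarith [abs_nonneg (u.1 x), sq_nonneg (|u.1 x| - 1)]
        rw [abs_mul, abs_of_pos hx]
        nlinarith [mul_le_mul_of_nonneg_left h1 hx.le]
    _ = (∫ x, P.kappa x) + ∫ x, P.kappa x * u.1 x ^ 2 :=
        integral_add h.integrable_kappa (integrable_kappa_sq u)
    _ ≤ (∫ x, P.kappa x) + energy u := by gcongr; exact integral_kappa_sq_le_energy u
    _ ≤ _ := by nlinarith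

/-- The weak form is coercive up to finitely many averages. -/
theorem exists_tiles_coercive (h : P.Admissible σ q τ β) :
    ∃ N : ℕ, 0 < N ∧ ∀ u : P.energySpace, 4⁻¹ * energy u ≤ h.weakForm u u +
      ∑ k : Fin d → Fin N, (⨍ y in Torus.tile (Torus.corner k) (1 / N : ℝ), u.1 y) *
        ((4 * τ + 3) * ∫ x in Torus.tile (Torus.corner k) (1 / N : ℝ), P.kappa x * u.1 x) := by
  have hτ := h.tau_pos
  -- The factor satisfies `(4τ+3)/2 = (2τ+1) + 1/2`, so it compensates Gårding's negative term and
  -- leaves `K/2`. This choice of `ε` makes the approximation error `Q/4`, so `Q/4` survives of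
  -- Gårding's `Q/2`.
  have hε : 0 < 1 / (2 * (4 * τ + 3)) := by positivity
  obtain ⟨N, hN, H⟩ := h.exists_partition (ENNReal.ofReal_pos.2 hε).ne'
  refine ⟨N, hN, fun u => ?_⟩
  have hQ : 0 ≤ᵐ[volume] fun x => Torus.weakGrad u.1 x ⬝ᵥ (P.A x *ᵥ Torus.weakGrad u.1 x) :=
    P.nonneg_A.mono fun x hx => hx _
  have h1 := H u.1 _ (integrable_coeFn u) (hasWeakGrad u) (integrable_quad u)
  rw [← ofReal_integral_eq_lintegral_ofReal (integrable_quad u) hQ,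
    ← ENNReal.ofReal_mul hε.le] at h1
  have h2 := ENNReal.toReal_mono ENNReal.ofReal_ne_top h1
  rw [ENNReal.toReal_ofReal (mul_nonneg hε.le (integral_nonneg_of_ae hQ)),
    ENNReal.toReal_sum fun k hk => (ENNReal.sum_lt_top.1 (h1.trans_lt ENNReal.ofReal_lt_top) k hk).ne]
    at h2
  have h3 : ∫ x, P.kappa x * u.1 x ^ 2 = ∑ k : Fin d → Fin N,
      ∫ x in Torus.tile (Torus.corner k) (1 / N : ℝ), P.kappa x * u.1 x ^ 2 := by
    rw [← setIntegral_univ, ← Torus.iUnion_tile hN,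
      integral_iUnion_fintype (fun k => Torus.measurableSet_tile _ _)
        (Torus.pairwise_disjoint_tile hN) fun k => (integrable_kappa_sq u).integrableOn]
  have h4 := Finset.sum_le_sum fun (k : Fin d → Fin N) (_ : k ∈ Finset.univ) =>
    half_setIntegral_sub_le (s := Torus.tile (Torus.corner k) (1 / N : ℝ))
      (⨍ y in Torus.tile (Torus.corner k) (1 / N : ℝ), u.1 y) h.integrable_kappa
      (h.kappa_pos.mono fun x hx => hx.le) (h.integrable_kappa_mul u) (integrable_kappa_sq u)
  rw [Finset.sum_sub_distrib, ← Finset.mul_sum, ← Finset.mul_sum, ← h3] at h4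
  have h5 := h.le_weakForm_self u
  have hK : 0 ≤ ∫ x, P.kappa x * u.1 x ^ 2 :=
    integral_nonneg_of_ae (h.kappa_pos.mono fun x hx => mul_nonneg hx.le (sq_nonneg _))
  simp only [mul_left_comm _ (4 * τ + 3)]
  rw [← Finset.mul_sum, energy_eq]
  generalize (∫ x, P.kappa x * u.1 x ^ 2) = K at *
  generalize (∫ x, Torus.weakGrad u.1 x ⬝ᵥ (P.A x *ᵥ Torus.weakGrad u.1 x)) = Q at *
  have h6 := mul_le_mul_of_nonneg_left (h4.trans' (sub_le_sub_left
    (mul_le_mul_of_nonneg_left h2 (by norm_num)) _)) (by positivity : 0 ≤ 4 * τ + 3)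
  have e : (4 * τ + 3) * (2⁻¹ * K - 2⁻¹ * (1 / (2 * (4 * τ + 3)) * Q)) =
      (2 * τ + 1) * K + 2⁻¹ * K - 4⁻¹ * Q := by
    field_simp
    ring
  rw [e] at h6
  linarith

/-- On each tile the pair of functionals is the average of `u` and `4τ + 3` times the integral of `κ
u`; both are bounded for the energy, the first through the `L¹` estimate and the second through
integrability of `κ`. -/
theorem existsUnique_weakForm_eq (h : P.Admissible σ q τ β)
    (hinj : ∀ u, (∀ v, h.weakForm u v = 0) → u = 0) {ζ : P.energySpace →ₗ[ℝ] ℝ}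
    (hζ : P.IsBoundedFunctional ζ) : ∃! u, ∀ v, h.weakForm u v = ζ v := by
  obtain ⟨N, hN, H⟩ := h.exists_tiles_coercive
  obtain ⟨C, hC⟩ := h.exists_integral_abs_le
  have hone : ∀ u : P.energySpace, Integrable fun x => (fun _ => (1 : ℝ)) x * u.1 x := fun u => by
    simpa only [one_mul] using integrable_coeFn u
  have hms := fun k : Fin d → Fin N => Torus.measurableSet_tile (Torus.corner k) (1 / N : ℝ)
  refine exists_unique_of_coercive_add_finiteRank h.innerForm h.innerForm_symm
    (fun u => by rw [innerForm_self]; exact h.energy_nonneg u)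
    (fun u hu => h.eq_zero_of_energy_eq_zero (by rwa [innerForm_self] at hu))
    (fun f hf => ?_) h.weakForm (M := 1 + τ)
    (fun u v => by rw [innerForm_self, innerForm_self]; exact h.abs_weakForm_le u v)
    (fun k => (volume.real (Torus.tile (Torus.corner k) (1 / N : ℝ)))⁻¹ •
      setFunctional (hms k) _ hone)
    (fun k => (4 * τ + 3) • setFunctional (hms k) _ h.integrable_kappa_mul)
    (fun k => ⟨(volume.real (Torus.tile (Torus.corner k) (1 / N : ℝ)))⁻¹ * C, fun u => ?_⟩)
    (fun k => ⟨(4 * τ + 3) * ((∫ x, P.kappa x) + 1), fun u => ?_⟩)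
    (c := 4⁻¹) (by norm_num) (fun u => ?_) hinj ζ ?_
  · simp only [innerForm_self] at hf ⊢
    exact h.exists_limit hf
  · rw [LinearMap.smul_apply, smul_eq_mul, abs_mul, abs_of_nonneg (by positivity), innerForm_self,
      mul_assoc]
    refine mul_le_mul_of_nonneg_left ((abs_setFunctional_le _ _ _ _).trans ?_) (by positivity)
    simpa only [one_mul] using hC u
  · have hτ := h.tau_pos
    rw [LinearMap.smul_apply, smul_eq_mul, abs_mul, abs_of_nonneg (by positivity), innerForm_self,
      mul_assoc]
    exact mul_le_mul_of_nonneg_left ((abs_setFunctional_le _ _ _ _).trans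
      (h.integral_abs_kappa_mul_le u)) (by positivity)
  · rw [innerForm_self]
    refine (H u).trans (le_of_eq ?_)
    simp only [LinearMap.smul_apply, setFunctional_apply, smul_eq_mul, one_mul, setAverage_eq]
  · obtain ⟨C', hC'⟩ := hζ
    refine ⟨C', fun v => ?_⟩
    rw [innerForm_self]
    exact hC' v

/-- Absolute convergence of the weak form is automatic on the energy space, so only the identity
remains. -/
theorem isWeakSolution_iff (h : P.Admissible σ q τ β) {ζ : P.energySpace →ₗ[ℝ] ℝ}
    {u : P.energySpace} : P.IsWeakSolution ζ u ↔ ∀ v, h.weakForm u v = ζ v :=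
  ⟨fun H v => (H v).2, fun H v => ⟨h.integrable_weakDensity u v, H v⟩⟩

end Admissible
end Coefficients
end

theorem theoremA {d : ℕ} (hd : 2 ≤ d) (P : Coefficients d)
    -- weighted ellipticity; in `[0, ∞]` the negative power of `0` is `∞`, so `σ > 0` a.e.
    (σ : Torus d → ℝ) (hσ_meas : AEMeasurable σ) (hσ_nonneg : ∀ x, 0 ≤ σ x)
    (q : ℝ) (hq_ge : 1 / 2 ≤ q) (hq_lt : q < 1)
    (hσ_int : ∫⁻ x, ENNReal.ofReal (σ x) ^ (q / (q - 1)) < ∞)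
    (hell : ∀ᵐ x, ∀ ξ : Fin d → ℝ, σ x * (ξ ⬝ᵥ ξ) ≤ ξ ⬝ᵥ (P.A x *ᵥ ξ))
    -- comparability of the symmetric parts of `A` and `A⁻¹`
    (τ : ℝ) (hτ : 0 < τ)
    (hcomp : ∀ᵐ x, ∀ ξ : Fin d → ℝ,
      ξ ⬝ᵥ ((symPart (P.A x)⁻¹)⁻¹ *ᵥ ξ) ≤ τ * (ξ ⬝ᵥ (symPart (P.A x) *ᵥ ξ)))
    -- positivity and integrability of `κ`
    (hκ_pos : ∀ᵐ x, 0 < P.kappa x)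
    (β : ℝ≥0∞) (hβ : 1 ≤ β) (hκ_mem : MemLp P.kappa β)
    (hβq : 2 * β.conjExponent ≤ ENNReal.ofReal (sobolevConj d (2 * q)))
    -- the kernel of `L` in `X` is trivial
    (hker : ∀ u : P.energySpace, P.IsWeakSolution 0 u → u = 0)
    (ζ : P.energySpace →ₗ[ℝ] ℝ) (hζ : P.IsBoundedFunctional ζ) :
    ∃! u : P.energySpace, P.IsWeakSolution ζ u := by
  have h : P.Admissible σ q τ β := ⟨hd, hσ_meas, hσ_nonneg, hq_ge, hq_lt, hσ_int, hell, hτ, hcomp,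
    hκ_pos, hβ, hκ_mem, hβq⟩
  simp only [h.isWeakSolution_iff] at hker ⊢
  exact h.existsUnique_weakForm_eq hker hζ
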